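/- **Setting.** The computational basis states of $n$ qubits are labelled by $n$-bit strings, identified with the integers $0,\dots,2^n-1$ by binary expansion, and distances between states are measured in the $\ell_2$-norm. A vector is *$t$-sparse* if at most $t$ of its amplitudes in the computational basis are nonzero, and a state is *$\eta$-approximately $t$-sparse* if it is within $\ell_2$-distance $\eta$ of some (not necessarily normalized) $t$-sparse vector. The QFT modulo $2^n$ is $\mathcal F_{2^n}=2^{-n/2}\sum_{x,y}e^{2\pi i xy/2^n}|x\rangle\langle y|$. Algorithms are (probabilistic) classical algorithms in the bit model, and running times are worst case. A family of $n$-qubit states $|\psi\rangle$, each given to algorithms by $n$ and a classical description of length $\mathrm{poly}(n)$, is *computationally tractable* (CT) if there are (i) a randomized algorithm that, on input an integer $k\ge 0$, samples in time $\mathrm{poly}(n,k)$ from a distribution within $\ell_1$-error $2^{-k}$ of $x\mapsto|\langle x|\psi\rangle|^2$, and (ii) a deterministic algorithm that, on input $x$ and $k$, computes $\langle x|\psi\rangle$ up to error $2^{-k}$ in time $\mathrm{poly}(n,k)$. **Theorem.** There is an absolute constant $C>0$ such that the following holds. Consider a family of unitary $n$-qubit circuits $\mathcal C=U_2U_1$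 with normalized input states $|\psi_{\rm in}\rangle$ such that (a) the states $U_1|\psi_{\rm in}\rangle$ form a CT family; (b) $U_2$ is the QFT modulo $2^n$ throughout the family, or $U_2$ is its inverse throughout the family. Then there is a randomized classical algorithm with the following property. For every member of the family, every $t\in\mathbb N$ and all real $0<\varepsilon\le 1/6$, $0<\delta<1$ such that the final state $|\psi_{\rm out}\rangle=\mathcal C|\psi_{\rm in}\rangle$ is $\sqrt\varepsilon$-approximately $t$-sparse, the algorithm, given $n$ and the description of the member, $t$, $\lfloor 1/\varepsilon\rfloor$ and $\lceil\log_2(1/\delta)\rceil$, runs in time $\mathrm{poly}(n,t,1/\varepsilon,\log\frac1\delta)$ (the polynomial depending only on the family) and outputs, as an explicit list of all its nonzero amplitudes, a normalized $s$-sparse state $|\psi\rangle$ with $s\le C\,t/\varepsilon$; and with probability at least $1-\delta$, $$\bigl\||\psi\rangle-|\psi_{\rm out}\rangle\bigr\|_2\le C\sqrt\varepsilon .$$ -/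

import Mathlib

open scoped Matrix

namespace SparseSim

noncomputable section

/-! ### A randomized machine model with a step count

Values are binary trees whose leaves are integers written in binary.  Programs are built from
integer arithmetic, pairing, branching, counted loops and fair coin flips.  Every elementary
operation is charged the bit length of what it reads and of what it writes, so that polynomial time
here is polynomial time on a probabilistic Turing machine.  (Counted loops suffice: a computation
with a polynomial time bound can be run against a clock.) -/

/-- The values on which programs operate. -/
inductive Data : Type
  | int (z : ℤ) : Data
  | pair (a b : Data) : Data

/-- The length of a value, with integers written in binary. -/
def Data.size : Data → ℕ
  | .int z => 1 + Nat.size z.natAbs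
  | .pair a b => 1 + a.size + b.size

/-- Natural numbers as values. -/
def Data.nat (m : ℕ) : Data := .int (m : ℤ)

/-- A list of values as a value; the empty list is the integer `0`. -/
def Data.list : List Data → Data
  | [] => .int 0
  | a :: l => .pair a (Data.list l)

/-- `IsCode d z`: the value `d` is the triple of integers `a, b, m` with `m > 0`,
and it denotes the complex number `z = (a + b i) / m`. -/
def Data.IsCode (d : Data) (z : ℂ) : Prop :=
  ∃ (a b : ℤ) (m : ℕ), 0 < m ∧ d = .pair (.pair (.int a) (.int b)) (.nat m) ∧
    z = ((a : ℂ) + (b : ℂ) * Complex.I) / (m : ℂ)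

/-- The elementary deterministic operations. -/
inductive Op : Type
  | id
  | const (z : ℤ)
  | fst
  | snd
  | isInt
  | add
  | sub
  | mul
  | div
  | le

/-- The result of an elementary operation; it is `0` on values of the wrong shape.
Division rounds down for positive divisors, and division by `0` gives `0`. -/
def Op.apply : Op → Data → Data
  | .id, x => x
  | .const z, _ => .int z
  | .fst, .pair a _ => a
  | .snd, .pair _ b => b
  | .isInt, .int _ => .int 1
  | .add, .pair (.int a) (.int b) => .int (a + b)
  | .sub, .pair (.int a) (.int b) => .int (a - b)
  | .mul, .pair (.int a) (.int b) => .int (a * b)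
  | .div, .pair (.int a) (.int b) => .int (a / b)
  | .le, .pair (.int a) (.int b) => .int (if a ≤ b then 1 else 0)
  | _, _ => .int 0

/-- Randomized programs.
`op o` applies an elementary operation; `coin` ignores its input and returns a uniformly random
bit; `comp g f` runs `f` and then `g` on the result; `pair f g` runs `f` and `g` on the same input
and returns the pair of results; `ite c f g` runs the test `c` on the input and then, on the same
input, `g` if the test returned the integer `0`, and `f` otherwise; `iter f`, on the input
`(k, x)`, applies `f` to `x` successively `k` times. -/
inductive Prog : Type
  | op (o : Op)
  | coin
  | comp (g f : Prog)
  | pair (f g : Prog)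
  | ite (c f g : Prog)
  | iter (f : Prog)

/-- `m` successive applications of a randomized map with a step count. -/
def iterRun (f : Data → PMF (Data × ℕ)) : ℕ → Data → PMF (Data × ℕ)
  | 0, x => PMF.pure (x, 0)
  | m + 1, x => (f x).bind fun r => (iterRun f m r.1).map fun s => (s.1, r.2 + s.2)

/-- `P.run x` is the joint law of the result and of the number of steps of `P` on the input `x`. -/
def Prog.run : Prog → Data → PMF (Data × ℕ)
  | .op o, x => PMF.pure (o.apply x, 1 + x.size + (o.apply x).size)
  | .coin, x => (PMF.uniformOfFintype Bool).map fun b =>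
      (.int (if b then 1 else 0), 1 + x.size + (Data.int (if b then 1 else 0)).size)
  | .comp g f, x => (f.run x).bind fun r => (g.run r.1).map fun s => (s.1, 1 + r.2 + s.2)
  | .pair f g, x => (f.run x).bind fun r => (g.run x).map fun s => (.pair r.1 s.1, 1 + r.2 + s.2)
  | .ite c f g, x => (c.run x).bind fun r =>
      match r.1 with
      | .int 0 => (g.run x).map fun s => (s.1, 1 + r.2 + s.2)
      | _ => (f.run x).map fun s => (s.1, 1 + r.2 + s.2)
  | .iter f, x =>
      match x with
      | .pair (.int k) y => (iterRun f.run k.toNat y).map fun s => (s.1, 1 + x.size + s.2)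
      | _ => PMF.pure (.int 0, 1 + x.size)

/-! ### States and the quantum Fourier transform -/

/-- Vectors of an `n`-qubit system, with the `ℓ²` norm.  The `n`-bit string labelling a
computational basis vector is identified with the integer in `{0, …, 2 ^ n - 1}` that it writes in
binary. -/
abbrev Qubits (n : ℕ) : Type := EuclideanSpace ℂ (Fin (2 ^ n))

/-- A matrix acting on a vector. -/
def act {n : ℕ} (U : Matrix (Fin (2 ^ n)) (Fin (2 ^ n)) ℂ) (ψ : Qubits n) : Qubits n :=
  WithLp.toLp 2 (U *ᵥ WithLp.ofLp ψ)

/-- The quantum Fourier transform modulo `2 ^ n`. -/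
def qft (n : ℕ) : Matrix (Fin (2 ^ n)) (Fin (2 ^ n)) ℂ :=
  Matrix.of fun x y =>
    Complex.exp (2 * Real.pi * Complex.I * ((x : ℕ) : ℂ) * ((y : ℕ) : ℂ) / (2 : ℂ) ^ n) /
      ((Real.sqrt (2 ^ n) : ℝ) : ℂ)

/-- The number of nonzero amplitudes of a vector. -/
def sparsity {n : ℕ} (φ : Qubits n) : ℕ := {x : Fin (2 ^ n) | φ x ≠ 0}.ncard

/-- `φ` is `η`-close in `ℓ²` norm to a (not necessarily normalized) `t`-sparse vector. -/
def IsApproxSparse {n : ℕ} (η : ℝ) (t : ℕ) (φ : Qubits n) : Prop :=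
  ∃ v : Qubits n, sparsity v ≤ t ∧ ‖φ - v‖ ≤ η

/-- The value `d` is an explicit list of the nonzero amplitudes of `φ`, each together with its
basis label, without repetition and in some order. -/
def Lists {n : ℕ} (d : Data) (φ : Qubits n) : Prop :=
  ∃ (l : List (Fin (2 ^ n))) (a : Fin (2 ^ n) → Data),
    l.Nodup ∧ (∀ x, x ∈ l ↔ φ x ≠ 0) ∧ (∀ x ∈ l, (a x).IsCode (φ x)) ∧
      d = Data.list (l.map fun x : Fin (2 ^ n) => .pair (.nat x) (a x))

/-! ### Computationally tractable states

A family of states has members `ψ i` on `nq i` qubits; algorithms are given the number of qubits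
and a classical description `desc i` of polynomial length, for instance a circuit description (a
family with one state per number of qubits is the case `nq n = n`, `desc n = n`). -/

/-- The input naming a member of the family. -/
def instanceData {ι : Type} (nq : ι → ℕ) (desc : ι → Data) (i : ι) : Data :=
  .pair (.nat (nq i)) (desc i)

/-- In time polynomial in the number of qubits and in `k`, the program `S` samples from the
distribution `x ↦ |⟨x|ψ⟩|²` up to `ℓ¹` error `2 ^ (-k)`. -/
def Samples {ι : Type} (nq : ι → ℕ) (desc : ι → Data) (ψ : ∀ i, Qubits (nq i)) (S : Prog) : Prop :=
  ∃ c : ℕ, ∀ (i : ι) (k : ℕ),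
    (∀ out ∈ (S.run (.pair (instanceData nq desc i) (.nat k))).support,
      out.2 ≤ c * (nq i + k + 1) ^ c) ∧
    ∑ x : Fin (2 ^ nq i),
      |(((S.run (.pair (instanceData nq desc i) (.nat k))).map Prod.fst) (.nat x)).toReal
        - ‖ψ i x‖ ^ 2| ≤ (1 / 2) ^ k

/-- In time polynomial in the number of qubits and in `k`, the program `Q` computes, given a basis
label `x`, deterministically the amplitude `⟨x|ψ⟩` up to error `2 ^ (-k)`. -/
def Queries {ι : Type} (nq : ι → ℕ) (desc : ι → Data) (ψ : ∀ i, Qubits (nq i)) (Q : Prog) : Prop :=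
  ∃ c : ℕ, ∀ (i : ι) (x : Fin (2 ^ nq i)) (k : ℕ), ∃ (y : Data) (time : ℕ) (z : ℂ),
    Q.run (.pair (.pair (instanceData nq desc i) (.nat x)) (.nat k)) = PMF.pure (y, time) ∧
      time ≤ c * (nq i + k + 1) ^ c ∧ y.IsCode z ∧ ‖z - ψ i x‖ ≤ (1 / 2) ^ k

/-- A computationally tractable (CT) family of states. -/
def IsCT {ι : Type} (nq : ι → ℕ) (desc : ι → Data) (ψ : ∀ i, Qubits (nq i)) : Prop :=
  (∃ c : ℕ, ∀ i, (desc i).size ≤ c * (nq i + 1) ^ c) ∧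
    (∃ S : Prog, Samples nq desc ψ S) ∧ (∃ Q : Prog, Queries nq desc ψ Q)

/-- The input of the simulation algorithm: the instance, the sparseness `t`, the accuracy as the
integer `⌊1 / ε⌋` and the failure probability as the integer `⌈log₂ (1 / δ)⌉`. -/
def simInput {ι : Type} (nq : ι → ℕ) (desc : ι → Data) (i : ι) (t : ℕ) (ε δ : ℝ) : Data :=
  .pair (instanceData nq desc i)
    (.pair (.nat t) (.pair (.nat ⌊1 / ε⌋₊) (.nat ⌈Real.logb 2 (1 / δ)⌉₊)))

end

end SparseSim

open SparseSim

/-!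
# Classical simulation of a tractable state followed by a quantum Fourier transform

Let `ψ` be the state before the transform, `f` its Fourier transform modulo `N = 2 ^ n` (or the
inverse transform: the two differ by a sign `s = ± 1`), and let `f` be `√ε`-close to a `t`-sparse
vector. It suffices to find a short list of labels that contains all `y` with `|f y|² ≥ 1 / W`,
where `W = t (⌊1 / ε⌋ + 1) ≥ t / ε`, and to estimate `f` on it: the labels outside the list cost at
most `t / W ≤ ε` on the support of the sparse vector and at most `ε` off it.

*Estimation.* The weight of `f` on the labels congruent to `a` modulo `M = 2 ^ m` is an average, over
all translations by multiples of `N / M`, of overlaps `∑ x, conj (ψ x) ψ (x + d) c` with phases `c`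
(`residueWeight_eq`). If `x` is drawn from `|ψ x|²`, the quantity to be averaged would be
`ψ (x + d) c / ψ x`, which is unbounded. Since a pair `x, x + d` may also be met from its other
end, it may be replaced by `overlapRatio`, namely `2 Re (conj α β c) / (|α|² + |β|²)` with
`α = ψ x` and `β = ψ (x + d)`. This is at most `1` in modulus, stays harmless when the amplitudes
are only known approximately, and has the right mean
(`abs_mean_overlapRatio_sub_residueWeight_le`). The same estimator, for pairs of an amplitude of `ψ`
and one of the uniform superposition, gives the coefficients `f y` (`abs_sum_overlapRatio_sub_le`).
By Hoeffding's inequality (`iidList_deviation_le`) and a union bound over all residue classes modulo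
powers of `2` and all labels, one list of `O(W² (n + log (1 / δ)))` samples makes all estimates
accurate up to a fraction of `1 / W`, except with probability `δ` (`Accurate.one_sub_le_good`).

*Search.* The residues of weight at least `1 / W` are found bit by bit: those modulo `2 ^ (m + 1)`
refine those modulo `2 ^ m`. A refinement is kept if its estimated weight is at least `3 / (4 W)`,
so that what is kept has weight at least `1 / (2 W)` and there are at most `2 W` candidates on each
level (`Accurate.treeList_spec`).

*Normalization.* The output must be exactly normalized and have exactly representable amplitudes, so
the estimate `v` cannot be divided by its norm. Instead a basis vector is reflected in the line
through its sum with `v`. The result is a unit vector that depends rationally on `v`, at a distance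
to `v` of at most `√2 |1 - ‖v‖|` (`norm_reflection`), and it has the support of `v` up to one label.

*Programs.* All arithmetic is done on integers. The phases `exp (2 π i z / Z)` are approximated by
`(1 + i φ / k) ^ k`, with the Wallis product in the place of `π / 2` (`norm_cisNum_div_sub_cis_le`).
Running times are bounded by a calculus in which `Runs σ P x y` says that `P` computes `y i` from
`x i` in time polynomial in `σ i`; it is closed under the constructions of the programming language.
The algorithm draws its samples first and is deterministic afterwards: the law of its output is
found in `law_simProg`, a bound on its running time in `polyTime_simProg`, and
`IsCT.exists_simulation` puts everything together.
-/

namespace SparseSim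

/-! ### Deterministic evaluation of programs -/

noncomputable instance : DecidableEq Data := Classical.decEq _

/-- The result of a program when every coin shows `0`. -/
noncomputable def Prog.ev : Prog → Data → Data
  | .op o, x => o.apply x
  | .coin, _ => .int 0
  | .comp g f, x => g.ev (f.ev x)
  | .pair f g, x => .pair (f.ev x) (g.ev x)
  | .ite c f g, x => if c.ev x = .int 0 then g.ev x else f.ev x
  | .iter f, x =>
      match x with
      | .pair (.int k) y => f.ev^[k.toNat] y
      | _ => .int 0

/-- The number of steps of a program when every coin shows `0`. -/
noncomputable def Prog.cost : Prog → Data → ℕ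
  | .op o, x => 1 + x.size + (o.apply x).size
  | .coin, x => 1 + x.size + (Data.int 0).size
  | .comp g f, x => 1 + f.cost x + g.cost (f.ev x)
  | .pair f g, x => 1 + f.cost x + g.cost x
  | .ite c f g, x => 1 + c.cost x + if c.ev x = .int 0 then g.cost x else f.cost x
  | .iter f, x =>
      match x with
      | .pair (.int k) y => 1 + x.size + ∑ j ∈ Finset.range k.toNat, f.cost (f.ev^[j] y)
      | _ => 1 + x.size

/-- The program with every coin flip replaced by the constant `0`. A part of an algorithm that is
meant to be deterministic is passed through this map, so that a bound on its all-`0` run bounds all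
its runs. -/
def Prog.det : Prog → Prog
  | .op o => .op o
  | .coin => .op (.const 0)
  | .comp g f => .comp g.det f.det
  | .pair f g => .pair f.det g.det
  | .ite c f g => .ite c.det f.det g.det
  | .iter f => .iter f.det

theorem iterRun_pure {f : Data → PMF (Data × ℕ)} {g : Data → Data} {c : Data → ℕ}
    (h : ∀ x, f x = PMF.pure (g x, c x)) (m : ℕ) (x : Data) :
    iterRun f m x = PMF.pure (g^[m] x, ∑ j ∈ Finset.range m, c (g^[j] x)) := by
  induction m generalizing x with
  | zero => simp [iterRun]
  | succ m ih =>
    simp only [iterRun, h, PMF.pure_bind, ih, PMF.pure_map, Function.iterate_succ,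
      Function.comp_apply]
    rw [Finset.sum_range_succ']
    simp [Function.iterate_succ, add_comm]

theorem Prog.ite_run_eq (c f g : Prog) (x : Data) :
    (Prog.ite c f g).run x = (c.run x).bind fun r =>
      if r.1 = .int 0 then (g.run x).map fun s => (s.1, 1 + r.2 + s.2)
      else (f.run x).map fun s => (s.1, 1 + r.2 + s.2) := by
  simp only [Prog.run]
  congr 1
  funext r
  split
  · next h => simp [h]
  · next h => rw [if_neg h]

theorem Prog.det_run (P : Prog) : ∀ x, P.det.run x = PMF.pure (P.ev x, P.cost x) := by
  induction P with
  | op o => intro x; rfl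
  | coin => intro x; rfl
  | comp g f ihg ihf =>
    intro x; simp [Prog.det, Prog.run, ihg, ihf, PMF.pure_map, Prog.ev, Prog.cost]
  | pair f g ihf ihg =>
    intro x; simp [Prog.det, Prog.run, ihg, ihf, PMF.pure_map, Prog.ev, Prog.cost]
  | ite c f g ihc ihf ihg =>
    intro x
    rw [Prog.det, Prog.ite_run_eq, ihc, PMF.pure_bind, ihf, ihg]
    simp only [Prog.ev, Prog.cost]
    split_ifs <;> simp [PMF.pure_map]
  | iter f ih =>
    intro x
    match x with
    | .pair (.int k) y =>
      simp [Prog.det, Prog.run, Prog.ev, Prog.cost, iterRun_pure ih, PMF.pure_map]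
    | .pair (.pair _ _) y => rfl
    | .int _ => rfl

/-- The run in which every coin shows `0` is one of the possible runs. -/
theorem Prog.ev_mem_support (P : Prog) : ∀ x, (P.ev x, P.cost x) ∈ (P.run x).support := by
  induction P with
  | op o => intro x; simp [Prog.run, Prog.ev, Prog.cost]
  | coin =>
    intro x
    simp only [Prog.run, Prog.ev, Prog.cost, PMF.support_map]
    exact ⟨false, by simp, by simp⟩
  | comp g f ihg ihf =>
    intro x
    simp only [Prog.run, PMF.mem_support_bind_iff, PMF.support_map]
    exact ⟨_, ihf x, _, ihg _, rfl⟩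
  | pair f g ihf ihg =>
    intro x
    simp only [Prog.run, PMF.mem_support_bind_iff, PMF.support_map]
    exact ⟨_, ihf x, _, ihg _, rfl⟩
  | ite c f g ihc ihf ihg =>
    intro x
    rw [Prog.ite_run_eq]
    simp only [PMF.mem_support_bind_iff]
    refine ⟨_, ihc x, ?_⟩
    simp only [Prog.ev, Prog.cost]
    split_ifs
    · rw [PMF.support_map]; exact ⟨_, ihg _, rfl⟩
    · rw [PMF.support_map]; exact ⟨_, ihf _, rfl⟩
  | iter f ih =>
    have key : ∀ m x, (f.ev^[m] x, ∑ j ∈ Finset.range m, f.cost (f.ev^[j] x)) ∈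
        (iterRun f.run m x).support := by
      intro m
      induction m with
      | zero => intro x; simp [iterRun]
      | succ m ihm =>
        intro x
        simp only [iterRun, PMF.mem_support_bind_iff, PMF.support_map]
        refine ⟨_, ih x, _, ihm _, ?_⟩
        simp only [Function.iterate_succ, Function.comp_apply]
        rw [Finset.sum_range_succ']
        simp [Function.iterate_succ, add_comm]
    intro x
    simp only [Prog.run, Prog.ev, Prog.cost]
    split
    · rw [PMF.support_map]; exact ⟨_, key _ _, rfl⟩
    · simp

/-- A program whose run is deterministic has the result and the cost of its all-`0` run. -/
theorem Prog.ev_cost_of_run_eq_pure {P : Prog} {x y : Data} {T : ℕ}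
    (h : P.run x = PMF.pure (y, T)) : P.ev x = y ∧ P.cost x = T := by
  have := P.ev_mem_support x
  rw [h] at this
  simpa using this

/-! ### Sizes of values -/

theorem size_natAbs_add_le (a b : ℤ) :
    Nat.size (a + b).natAbs ≤ Nat.size a.natAbs + Nat.size b.natAbs + 1 := by
  rw [Nat.size_le]
  have h1 := Nat.lt_size_self a.natAbs
  have h2 := Nat.lt_size_self b.natAbs
  have h3 := Int.natAbs_add_le a b
  have h4 : 2 ^ a.natAbs.size ≤ 2 ^ (a.natAbs.size + b.natAbs.size) :=
    Nat.pow_le_pow_right (by norm_num) (by omega)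
  have h5 : 2 ^ b.natAbs.size ≤ 2 ^ (a.natAbs.size + b.natAbs.size) :=
    Nat.pow_le_pow_right (by norm_num) (by omega)
  rw [pow_succ]
  omega

theorem size_natAbs_mul_le (a b : ℤ) :
    Nat.size (a * b).natAbs ≤ Nat.size a.natAbs + Nat.size b.natAbs := by
  rw [Nat.size_le, Int.natAbs_mul, pow_add]
  exact Nat.mul_lt_mul'' (Nat.lt_size_self _) (Nat.lt_size_self _)

theorem size_natAbs_ediv_le (a b : ℤ) :
    Nat.size (a / b).natAbs ≤ Nat.size a.natAbs := by
  exact Nat.size_le_size (Int.natAbs_ediv_le_natAbs a b)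

/-- The size of a constant operation's result; `0` for the other operations. -/
def Op.extra : Op → ℕ
  | .const z => Nat.size z.natAbs
  | _ => 0

theorem Op.size_apply_le (o : Op) (x : Data) : (o.apply x).size ≤ 2 * x.size + o.extra + 2 := by
  have h0 : Nat.size 0 = 0 := by simp
  have h1 : Nat.size 1 = 1 := by simp
  unfold Op.apply
  split <;> try (simp only [Data.size, Op.extra, Int.natAbs_zero, Int.natAbs_one, h0, h1]; omega)
  · next a b => have := size_natAbs_add_le a b; simp only [Data.size]; omega
  · next a b =>
      have := size_natAbs_add_le a (-b)
      rw [Int.natAbs_neg, ← sub_eq_add_neg] at this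
      simp only [Data.size]; omega
  · next a b => have := size_natAbs_mul_le a b; simp only [Data.size]; omega
  · next a b => have := size_natAbs_ediv_le a b; simp only [Data.size]; omega
  · next a b => simp only [Data.size]; split_ifs <;> simp

theorem Prog.size_le_cost (P : Prog) : ∀ x, x.size ≤ P.cost x := by
  induction P with
  | op o => intro x; simp only [Prog.cost]; omega
  | coin => intro x; simp only [Prog.cost]; omega
  | comp g f ihg ihf => intro x; have := ihf x; simp only [Prog.cost]; omega
  | pair f g ihf ihg => intro x; have := ihf x; simp only [Prog.cost]; omega
  | ite c f g ihc ihf ihg => intro x; have := ihc x; simp only [Prog.cost]; omega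
  | iter f ih => intro x; simp only [Prog.cost]; split <;> omega

theorem Prog.size_ev_le_cost (P : Prog) : ∀ x, (P.ev x).size ≤ P.cost x := by
  induction P with
  | op o => intro x; simp only [Prog.cost, Prog.ev]; omega
  | coin => intro x; simp only [Prog.cost, Prog.ev]; omega
  | comp g f ihg ihf => intro x; have := ihg (f.ev x); simp only [Prog.cost, Prog.ev]; omega
  | pair f g ihf ihg =>
    intro x; have := ihf x; have := ihg x; simp only [Prog.cost, Prog.ev, Data.size]; omega
  | ite c f g ihc ihf ihg =>
    intro x; have := ihf x; have := ihg x; simp only [Prog.cost, Prog.ev]; split_ifs <;> omega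
  | iter f ih =>
    intro x
    simp only [Prog.cost, Prog.ev]
    split
    · next k y =>
      cases hk : k.toNat with
      | zero => simp [Data.size]; omega
      | succ m =>
        rw [Finset.sum_range_succ, Function.iterate_succ_apply']
        have := ih (f.ev^[m] y)
        omega
    · simp [Data.size]

/-! ### Polynomial bounds -/

/-- `f` is bounded by a polynomial in the size parameter `σ`. -/
def PolyBdd {I : Type} (σ f : I → ℕ) : Prop := ∃ c, ∀ i, f i ≤ (σ i + 2) ^ c

namespace PolyBdd

variable {I J : Type} {σ f g : I → ℕ}

theorem mono (hg : PolyBdd σ g) (h : ∀ i, f i ≤ g i) : PolyBdd σ f := by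
  obtain ⟨c, hc⟩ := hg
  exact ⟨c, fun i => (h i).trans (hc i)⟩

theorem const (m : ℕ) : PolyBdd σ (fun _ => m) :=
  ⟨m, fun i => (Nat.lt_two_pow_self).le.trans (Nat.pow_le_pow_left (by omega) m)⟩

theorem param : PolyBdd σ σ := ⟨1, fun i => by simp⟩

theorem add (hf : PolyBdd σ f) (hg : PolyBdd σ g) : PolyBdd σ (fun i => f i + g i) := by
  obtain ⟨c, hc⟩ := hf
  obtain ⟨d, hd⟩ := hg
  refine ⟨c + d + 1, fun i => ?_⟩
  have h2 : 2 ≤ σ i + 2 := by omega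
  have h1 : (σ i + 2) ^ c ≤ (σ i + 2) ^ (c + d) := Nat.pow_le_pow_right (by omega) (by omega)
  have h3 : (σ i + 2) ^ d ≤ (σ i + 2) ^ (c + d) := Nat.pow_le_pow_right (by omega) (by omega)
  calc f i + g i ≤ (σ i + 2) ^ (c + d) + (σ i + 2) ^ (c + d) :=
        add_le_add ((hc i).trans h1) ((hd i).trans h3)
    _ = (σ i + 2) ^ (c + d) * 2 := by ring
    _ ≤ (σ i + 2) ^ (c + d) * (σ i + 2) := Nat.mul_le_mul_left _ h2
    _ = _ := by rw [pow_succ]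

theorem mul (hf : PolyBdd σ f) (hg : PolyBdd σ g) : PolyBdd σ (fun i => f i * g i) := by
  obtain ⟨c, hc⟩ := hf
  obtain ⟨d, hd⟩ := hg
  exact ⟨c + d, fun i => by rw [pow_add]; exact Nat.mul_le_mul (hc i) (hd i)⟩

theorem pow (hf : PolyBdd σ f) (m : ℕ) : PolyBdd σ (fun i => f i ^ m) := by
  obtain ⟨c, hc⟩ := hf
  exact ⟨c * m, fun i => by rw [pow_mul]; exact Nat.pow_le_pow_left (hc i) m⟩

theorem comap {σ' : J → ℕ} {φ : J → I} (hf : PolyBdd σ f) (h : PolyBdd σ' (fun j => σ (φ j))) :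
    PolyBdd σ' (fun j => f (φ j)) := by
  obtain ⟨c, hc⟩ := hf
  have := (h.add (const 2)).pow c
  exact this.mono fun j => hc (φ j)

theorem reindex (hf : PolyBdd σ f) (φ : J → I) :
    PolyBdd (fun j => σ (φ j)) (fun j => f (φ j)) := hf.comap param

end PolyBdd

/-- Values of polynomially bounded size. -/
def Small {I : Type} (σ : I → ℕ) (x : I → Data) : Prop := PolyBdd σ fun i => (x i).size

/-- On the inputs `x i`, the all-`0` run of `P` returns `y i` in time polynomial in `σ i`. -/
def Runs {I : Type} (σ : I → ℕ) (P : Prog) (x y : I → Data) : Prop :=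
  (∀ i, P.ev (x i) = y i) ∧ PolyBdd σ fun i => P.cost (x i)

section Runs

variable {I J : Type} {σ : I → ℕ} {x y z w : I → Data} {P f g c : Prog}

theorem Small.pair (hx : Small σ x) (hy : Small σ y) : Small σ (fun i => .pair (x i) (y i)) :=
  ((PolyBdd.const 1).add hx).add hy

theorem Small.fst (h : Small σ (fun i => .pair (x i) (y i))) : Small σ x :=
  PolyBdd.mono h fun i => by simp [Data.size]; omega

theorem Small.snd (h : Small σ (fun i => .pair (x i) (y i))) : Small σ y :=
  PolyBdd.mono h fun i => by simp [Data.size]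

theorem Small.const (d : Data) : Small σ (fun _ => d) := PolyBdd.const _

theorem Small.reindex (h : Small σ x) (φ : J → I) :
    Small (fun j => σ (φ j)) (fun j => x (φ j)) := PolyBdd.reindex h φ

theorem Small.comap {σ' : J → ℕ} {φ : J → I} (h : Small σ x)
    (hσ : PolyBdd σ' (fun j => σ (φ j))) : Small σ' (fun j => x (φ j)) :=
  PolyBdd.comap (f := fun i => (x i).size) h hσ

theorem Small.int_of_lt_two_pow {v : I → ℤ} {b : I → ℕ} (hb : PolyBdd σ b)
    (h : ∀ i, (v i).natAbs ≤ 2 ^ b i) : Small σ (fun i => .int (v i)) := by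
  refine (hb.add (PolyBdd.const 2)).mono fun i => ?_
  have : Nat.size (v i).natAbs ≤ b i + 1 := by
    rw [Nat.size_le]
    exact (h i).trans_lt (Nat.pow_lt_pow_right (by norm_num) (by omega))
  simp only [Data.size]; omega

theorem Small.int_of_le {v : I → ℤ} {b : I → ℕ} (hb : PolyBdd σ b)
    (h : ∀ i, (v i).natAbs ≤ b i) : Small σ (fun i => .int (v i)) :=
  .int_of_lt_two_pow hb fun i => (h i).trans Nat.lt_two_pow_self.le

theorem Small.nat {v : I → ℕ} (hb : PolyBdd σ v) : Small σ (fun i => .nat (v i)) :=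
  .int_of_le hb fun i => by simp

namespace Runs

theorem small_in (h : Runs σ P x y) : Small σ x :=
  h.2.mono fun i => P.size_le_cost (x i)

theorem small_out (h : Runs σ P x y) : Small σ y :=
  h.2.mono fun i => by rw [← h.1 i]; exact P.size_ev_le_cost (x i)

theorem congr (h : Runs σ P x y) (hz : ∀ i, y i = z i) : Runs σ P x z :=
  ⟨fun i => (h.1 i).trans (hz i), h.2⟩

theorem congr_in (h : Runs σ P x y) (hz : ∀ i, x i = z i) : Runs σ P z y := by
  obtain rfl : x = z := funext hz
  exact h

theorem op {o : Op} (hx : Small σ x) : Runs σ (.op o) x (fun i => o.apply (x i)) := by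
  refine ⟨fun i => rfl, ?_⟩
  refine (((PolyBdd.const 3).mul hx).add (PolyBdd.const (o.extra + 3))).mono fun i => ?_
  have := o.size_apply_le (x i)
  simp only [Prog.cost]; omega

theorem comp (hf : Runs σ f x y) (hg : Runs σ g y z) : Runs σ (.comp g f) x z := by
  refine ⟨fun i => by simp [Prog.ev, hf.1 i, hg.1 i], ?_⟩
  refine (((PolyBdd.const 1).add hf.2).add hg.2).mono fun i => ?_
  simp [Prog.cost, hf.1 i]

theorem pair (hf : Runs σ f x y) (hg : Runs σ g x z) :
    Runs σ (.pair f g) x (fun i => .pair (y i) (z i)) := by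
  refine ⟨fun i => by simp [Prog.ev, hf.1 i, hg.1 i], ?_⟩
  refine (((PolyBdd.const 1).add hf.2).add hg.2).mono fun i => ?_
  simp [Prog.cost]

theorem reindex (h : Runs σ P x y) (φ : J → I) :
    Runs (fun j => σ (φ j)) P (fun j => x (φ j)) (fun j => y (φ j)) :=
  ⟨fun j => h.1 (φ j), h.2.reindex φ⟩

theorem comap {σ' : J → ℕ} {φ : J → I} (h : Runs σ P x y) (hσ : PolyBdd σ' (fun j => σ (φ j))) :
    Runs σ' P (fun j => x (φ j)) (fun j => y (φ j)) :=
  ⟨fun j => h.1 (φ j), h.2.comap hσ⟩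

theorem ite {b : I → ℤ} (hc : Runs σ c x (fun i => .int (b i)))
    (hf : Runs (fun i : {i // b i ≠ 0} => σ i) f (fun i => x i) (fun i => y i))
    (hg : Runs (fun i : {i // b i = 0} => σ i) g (fun i => x i) (fun i => y i)) :
    Runs σ (.ite c f g) x y := by
  refine ⟨fun i => ?_, ?_⟩
  · simp only [Prog.ev, hc.1 i, Data.int.injEq]
    split_ifs with h
    · exact hg.1 ⟨i, h⟩
    · exact hf.1 ⟨i, h⟩
  · obtain ⟨cf, hcf⟩ := hf.2
    obtain ⟨cg, hcg⟩ := hg.2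
    have h1 : PolyBdd σ fun i => (σ i + 2) ^ cf := (PolyBdd.param.add (PolyBdd.const 2)).pow cf
    have h2 : PolyBdd σ fun i => (σ i + 2) ^ cg := (PolyBdd.param.add (PolyBdd.const 2)).pow cg
    refine (((PolyBdd.const 1).add hc.2).add (h1.add h2)).mono fun i => ?_
    simp only [Prog.cost, hc.1 i, Data.int.injEq]
    split_ifs with h
    · have := hcg ⟨i, h⟩; simp only at this; omega
    · have := hcf ⟨i, h⟩; simp only at this; omega

/-- A loop is described by the sequence `s i 0, s i 1, …` of its states. All of them must be small,
which is part of the assumption on the body; no bound follows from the number of rounds alone. -/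
theorem iter {k : I → ℕ} {s : I → ℕ → Data} (hk : PolyBdd σ k)
    (hs : Small σ (fun i => s i 0))
    (hf : Runs (fun p : {p : I × ℕ // p.2 < k p.1} => σ p.1.1) f
      (fun p => s p.1.1 p.1.2) (fun p => s p.1.1 (p.1.2 + 1))) :
    Runs σ (.iter f) (fun i => .pair (.nat (k i)) (s i 0)) (fun i => s i (k i)) := by
  have key : ∀ i j, j ≤ k i → f.ev^[j] (s i 0) = s i j := by
    intro i j
    induction j with
    | zero => intro _; rfl
    | succ j ih =>
      intro h
      rw [Function.iterate_succ_apply', ih (by omega)]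
      exact hf.1 ⟨(i, j), by simp; omega⟩
  refine ⟨fun i => ?_, ?_⟩
  · simpa [Prog.ev, Data.nat] using key i (k i) le_rfl
  · obtain ⟨cf, hcf⟩ := hf.2
    have h1 : PolyBdd σ fun i => (σ i + 2) ^ cf := (PolyBdd.param.add (PolyBdd.const 2)).pow cf
    have h2 := ((Small.nat hk).pair hs)
    refine (((PolyBdd.const 1).add h2).add (hk.mul h1)).mono fun i => ?_
    simp only [Prog.cost, Data.nat, Int.toNat_natCast]
    gcongr
    calc _ ≤ ∑ j ∈ Finset.range (k i), (σ i + 2) ^ cf := by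
          refine Finset.sum_le_sum fun j hj => ?_
          rw [Finset.mem_range] at hj
          rw [key i j hj.le]
          exact hcf ⟨(i, j), hj⟩
      _ = _ := by simp

end Runs

end Runs

/-! ### Derived program constructions -/

/-- Programs whose running time is linear in the size of the input: no loops. -/
def Prog.loopFree : Prog → Bool
  | .op _ => true
  | .coin => true
  | .comp g f => g.loopFree && f.loopFree
  | .pair f g => f.loopFree && g.loopFree
  | .ite c f g => c.loopFree && f.loopFree && g.loopFree
  | .iter _ => false

theorem Prog.loopFree_cost (P : Prog) (h : P.loopFree = true) :
    ∃ c, ∀ x, P.cost x ≤ c * (x.size + 1) := by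
  induction P with
  | op o =>
    refine ⟨o.extra + 3, fun x => ?_⟩
    have := o.size_apply_le x
    simp only [Prog.cost]; nlinarith
  | coin => exact ⟨2, fun x => by simp [Prog.cost, Data.size]; omega⟩
  | comp g f ihg ihf =>
    simp only [Prog.loopFree, Bool.and_eq_true] at h
    obtain ⟨a, ha⟩ := ihg h.1
    obtain ⟨b, hb⟩ := ihf h.2
    refine ⟨1 + b + a * (b + 1), fun x => ?_⟩
    have h1 := hb x
    have h2 := (ha (f.ev x)).trans (Nat.mul_le_mul_left a (Nat.succ_le_succ
      ((f.size_ev_le_cost x).trans h1)))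
    simp only [Prog.cost]
    calc _ ≤ 1 + b * (x.size + 1) + a * (b * (x.size + 1) + 1) := by
            simp only [Nat.succ_eq_add_one] at h2; omega
      _ ≤ _ := by nlinarith [Nat.zero_le (a * x.size)]
  | pair f g ihf ihg =>
    simp only [Prog.loopFree, Bool.and_eq_true] at h
    obtain ⟨a, ha⟩ := ihf h.1
    obtain ⟨b, hb⟩ := ihg h.2
    refine ⟨1 + a + b, fun x => ?_⟩
    have := ha x; have := hb x
    simp only [Prog.cost]; nlinarith
  | ite c f g ihc ihf ihg =>
    simp only [Prog.loopFree, Bool.and_eq_true] at h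
    obtain ⟨a, ha⟩ := ihc h.1.1
    obtain ⟨b, hb⟩ := ihf h.1.2
    obtain ⟨d, hd⟩ := ihg h.2
    refine ⟨1 + a + b + d, fun x => ?_⟩
    have := ha x; have := hb x; have := hd x
    simp only [Prog.cost]
    split_ifs <;> nlinarith
  | iter f ih => simp [Prog.loopFree] at h

/-- The `k`-th entry of an environment `x₀, (x₁, (x₂, …))`. -/
def Prog.var : ℕ → Prog
  | 0 => .op .fst
  | k + 1 => .comp (.var k) (.op .snd)

/-- Run `P` and push its result on the environment of `body`. -/
def Prog.letin (P body : Prog) : Prog := .comp body (.pair P (.op .id))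

/-- A binary operation on the results of two programs. -/
def Prog.bin (o : Op) (f g : Prog) : Prog := .comp (.op o) (.pair f g)

/-- The environment consisting of the results of some programs. -/
def Prog.args : List Prog → Prog
  | [] => .op (.const 0)
  | p :: ps => .pair p (.args ps)

/-- Starting with the result of `init`, replace the current value `cnt` times by the result of
`body`, which sees the current value as entry `0` in front of the environment. -/
def Prog.loop (cnt init body : Prog) : Prog :=
  .comp (.op .fst) (.comp (.iter (.pair body (.op .snd))) (.pair cnt (.pair init (.op .id))))

namespace Runs

variable {I J : Type} {σ : I → ℕ} {x y z w e : I → Data} {P f g c : Prog}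

theorem straight (hx : Small σ x) (h : P.loopFree = true) : Runs σ P x (fun i => P.ev (x i)) := by
  refine ⟨fun _ => rfl, ?_⟩
  obtain ⟨c, hc⟩ := P.loopFree_cost h
  exact ((PolyBdd.const c).mul (PolyBdd.add hx (PolyBdd.const 1))).mono fun i => hc _

/-- A loop-free program computes what it evaluates to. -/
theorem straight' (hx : Small σ x) (h : P.loopFree = true) (hy : ∀ i, P.ev (x i) = y i) :
    Runs σ P x y := (straight hx h).congr hy

theorem letin (hP : Runs σ P x y) (hg : Runs σ g (fun i => .pair (y i) (x i)) z) :
    Runs σ (.letin P g) x z :=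
  (hP.pair (Runs.op (o := .id) hP.small_in)).comp hg

theorem bin {o : Op} (hf : Runs σ f x y) (hg : Runs σ g x z) :
    Runs σ (.bin o f g) x (fun i => o.apply (.pair (y i) (z i))) :=
  (hf.pair hg).comp (Runs.op (hf.pair hg).small_out)

theorem loop {cnt init body : Prog} {k : I → ℕ} {s : I → ℕ → Data}
    (hcnt : Runs σ cnt e (fun i => .nat (k i))) (hinit : Runs σ init e (fun i => s i 0))
    (hk : PolyBdd σ k)
    (hbody : Runs (fun p : {p : I × ℕ // p.2 < k p.1} => σ p.1.1) body
      (fun p => .pair (s p.1.1 p.1.2) (e p.1.1)) (fun p => s p.1.1 (p.1.2 + 1))) :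
    Runs σ (.loop cnt init body) e (fun i => s i (k i)) := by
  have he : Small σ e := hcnt.small_in
  have h1 := hcnt.pair (hinit.pair (Runs.op (o := .id) he))
  have h2 : Runs σ (.iter (.pair body (.op .snd)))
      (fun i => .pair (.nat (k i)) (.pair (s i 0) (e i))) (fun i => .pair (s i (k i)) (e i)) := by
    refine Runs.iter (s := fun i j => .pair (s i j) (e i)) hk
      (hinit.small_out.pair he) ?_
    exact hbody.pair (Runs.op (o := .snd) hbody.small_in)
  exact (h1.comp h2).comp (Runs.op (o := .fst) h2.small_out)

end Runs

/-! ### Concentration of sums over independent samples -/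

section Concentration

variable {α β : Type}

theorem tsum_bind_mul (p : PMF α) (f : α → PMF β) (F : β → ENNReal) :
    ∑' b, (p.bind f) b * F b = ∑' a, p a * ∑' b, f a b * F b := by
  simp_rw [PMF.bind_apply, ← ENNReal.tsum_mul_right, ← ENNReal.tsum_mul_left]
  rw [ENNReal.tsum_comm]
  simp_rw [mul_assoc]

theorem tsum_pure_mul (a : α) (F : α → ENNReal) : ∑' b, (PMF.pure a) b * F b = F a := by
  rw [tsum_eq_single a]
  · simp
  · intro b hb; simp [PMF.pure_apply, hb]

theorem tsum_map_mul (p : PMF α) (g : α → β) (F : β → ENNReal) :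
    ∑' b, (p.map g) b * F b = ∑' a, p a * F (g a) := by
  rw [PMF.map, tsum_bind_mul]
  simp_rw [Function.comp_apply, tsum_pure_mul]

/-- The law of a list of `K` independent samples from `D`. -/
noncomputable def iidList (D : PMF α) : ℕ → PMF (List α)
  | 0 => PMF.pure []
  | K + 1 => (iidList D K).bind fun l => D.map fun a => a :: l

theorem length_of_mem_support_iidList {D : PMF α} {K : ℕ} {l : List α}
    (h : l ∈ (iidList D K).support) : l.length = K := by
  induction K generalizing l with
  | zero => simpa [iidList] using h
  | succ K ih =>
    simp only [iidList, PMF.mem_support_bind_iff, PMF.support_map] at h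
    obtain ⟨l', h1, a, _, rfl⟩ := h
    simp [ih h1]

/-- The mean of a real function of a sample. -/
noncomputable def mean [Fintype α] (D : PMF α) (h : α → ℝ) : ℝ := ∑ a, (D a).toReal * h a

theorem sum_toReal_eq_one [Fintype α] (D : PMF α) : ∑ a, (D a).toReal = 1 := by
  rw [← ENNReal.toReal_sum (fun a _ => D.apply_ne_top a), ← tsum_fintype (L := .unconditional α),
    D.tsum_coe, ENNReal.toReal_one]

theorem tsum_iidList_exp_le [Fintype α] (D : PMF α) (h : α → ℝ) (v : ℝ)
    (hv : mean D (fun a => Real.exp (h a)) ≤ Real.exp v) (K : ℕ) :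
    ∑' l, iidList D K l * ENNReal.ofReal (Real.exp (l.map h).sum) ≤
      ENNReal.ofReal (Real.exp (K * v)) := by
  induction K with
  | zero => simp [iidList]
  | succ K ih =>
    rw [iidList, tsum_bind_mul]
    have : ∀ l : List α, ∑' b, (D.map fun a => a :: l) b *
        ENNReal.ofReal (Real.exp (b.map h).sum) ≤
        ENNReal.ofReal (Real.exp v) * ENNReal.ofReal (Real.exp (l.map h).sum) := by
      intro l
      rw [tsum_map_mul, tsum_fintype]
      calc _ = ∑ a, ENNReal.ofReal ((D a).toReal * Real.exp (h a)) *
            ENNReal.ofReal (Real.exp (l.map h).sum) := by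
            refine Finset.sum_congr rfl fun a _ => ?_
            rw [List.map_cons, List.sum_cons, Real.exp_add, ENNReal.ofReal_mul (by positivity),
              ENNReal.ofReal_mul (by positivity), ENNReal.ofReal_toReal (D.apply_ne_top a),
              mul_assoc]
        _ = ENNReal.ofReal (mean D (fun a => Real.exp (h a))) *
            ENNReal.ofReal (Real.exp (l.map h).sum) := by
            rw [← Finset.sum_mul, mean, ENNReal.ofReal_sum_of_nonneg]
            intro a _; positivity
        _ ≤ _ := by gcongr
    calc _ ≤ ∑' l, iidList D K l *
          (ENNReal.ofReal (Real.exp v) * ENNReal.ofReal (Real.exp (l.map h).sum)) :=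
          ENNReal.tsum_le_tsum fun l => by gcongr; exact this l
      _ = ENNReal.ofReal (Real.exp v) *
          ∑' l, iidList D K l * ENNReal.ofReal (Real.exp (l.map h).sum) := by
          rw [← ENNReal.tsum_mul_left]
          exact tsum_congr fun l => by ring
      _ ≤ ENNReal.ofReal (Real.exp v) * ENNReal.ofReal (Real.exp (K * v)) := by gcongr
      _ = _ := by
          rw [← ENNReal.ofReal_mul (by positivity), ← Real.exp_add]
          congr 2; push_cast; ring

theorem toOuterMeasure_le_of_exp (p : PMF α) (F : α → ℝ) (c : ℝ) (b : ENNReal)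
    (hb : ∑' a, p a * ENNReal.ofReal (Real.exp (F a)) ≤ b) :
    p.toOuterMeasure {a | c ≤ F a} ≤ ENNReal.ofReal (Real.exp (-c)) * b := by
  rw [PMF.toOuterMeasure_apply]
  calc _ ≤ ∑' a, ENNReal.ofReal (Real.exp (-c)) * (p a * ENNReal.ofReal (Real.exp (F a))) := by
        refine ENNReal.tsum_le_tsum fun a => ?_
        by_cases ha : a ∈ {a | c ≤ F a}
        · rw [Set.indicator_of_mem ha]
          have h1 : (1 : ENNReal) ≤
              ENNReal.ofReal (Real.exp (-c)) * ENNReal.ofReal (Real.exp (F a)) := by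
            rw [← ENNReal.ofReal_mul (by positivity), ← Real.exp_add, ENNReal.one_le_ofReal,
              Real.one_le_exp_iff]
            have : c ≤ F a := ha
            linarith
          calc p a = p a * 1 := by simp
            _ ≤ p a * (ENNReal.ofReal (Real.exp (-c)) * ENNReal.ofReal (Real.exp (F a))) := by
                gcongr
            _ = _ := by ring
        · rw [Set.indicator_of_notMem ha]; exact zero_le
    _ ≤ _ := by rw [ENNReal.tsum_mul_left]; gcongr

/-- One-sided Chernoff bound for a bounded centred function. -/
theorem iidList_tail_le [Fintype α] (D : PMF α) (h : α → ℝ) (M τ : ℝ) (hM : 0 < M)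
    (hh : ∀ a, |h a| ≤ M) (hmean : mean D h = 0) (hτ0 : 0 ≤ τ) (hτ : τ ≤ M) (K : ℕ) :
    (iidList D K).toOuterMeasure {l | K * τ ≤ (l.map h).sum} ≤
      ENNReal.ofReal (Real.exp (-(K * (τ / M) ^ 2 / 4))) := by
  set lam := τ / (2 * M ^ 2) with hlam
  have hlam0 : 0 ≤ lam := by positivity
  have hlM : lam * M ≤ 1 := by
    rw [hlam, div_mul_eq_mul_div, div_le_one (by positivity)]
    nlinarith
  have hmgf : mean D (fun a => Real.exp (lam * h a)) ≤ Real.exp ((lam * M) ^ 2) := by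
    have h1 : ∀ a, Real.exp (lam * h a) ≤ 1 + lam * h a + (lam * M) ^ 2 := by
      intro a
      have hb : |lam * h a| ≤ lam * M := by
        rw [abs_mul, abs_of_nonneg hlam0]; exact mul_le_mul_of_nonneg_left (hh a) hlam0
      have := Real.abs_exp_sub_one_sub_id_le (hb.trans hlM)
      have h3 := (abs_le.mp this).2
      have h4 : (lam * h a) ^ 2 ≤ (lam * M) ^ 2 :=
        sq_le_sq' (by linarith [abs_le.mp hb]) (abs_le.mp hb).2
      linarith
    calc mean D (fun a => Real.exp (lam * h a))
        ≤ ∑ a, (D a).toReal * (1 + lam * h a + (lam * M) ^ 2) :=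
          Finset.sum_le_sum fun a _ => mul_le_mul_of_nonneg_left (h1 a) ENNReal.toReal_nonneg
      _ = (∑ a, (D a).toReal) * (1 + (lam * M) ^ 2) + lam * mean D h := by
          rw [mean, Finset.mul_sum, Finset.sum_mul, ← Finset.sum_add_distrib]
          exact Finset.sum_congr rfl fun a _ => by ring
      _ = (lam * M) ^ 2 + 1 := by rw [sum_toReal_eq_one, hmean]; ring
      _ ≤ _ := Real.add_one_le_exp _
  have h2 := tsum_iidList_exp_le D (fun a => lam * h a) _ hmgf K
  have h3 := toOuterMeasure_le_of_exp (iidList D K)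
    (fun l => (l.map fun a => lam * h a).sum) (lam * (K * τ)) _ h2
  refine (MeasureTheory.measure_mono ?_).trans (h3.trans_eq ?_)
  · intro l hl
    simp only [Set.mem_ofPred_eq] at hl ⊢
    rw [List.sum_map_mul_left]
    exact mul_le_mul_of_nonneg_left hl hlam0
  · rw [← ENNReal.ofReal_mul (by positivity), ← Real.exp_add]
    congr 2
    rw [hlam]
    field_simp
    ring

/-- Hoeffding's inequality, with unoptimized constants: the empirical sum of `K` samples deviates
from its mean by `K τ` with exponentially small probability. -/
theorem iidList_deviation_le [Fintype α] (D : PMF α) (h : α → ℝ) (M τ : ℝ) (hM : 0 < M)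
    (hh : ∀ a, |h a| ≤ M) (hτ0 : 0 ≤ τ) (hτ : τ ≤ 2 * M) (K : ℕ) :
    (iidList D K).toOuterMeasure {l | K * τ ≤ |(l.map h).sum - K * mean D h|} ≤
      ENNReal.ofReal (2 * Real.exp (-(K * (τ / M) ^ 2 / 16))) := by
  have hm : |mean D h| ≤ M := by
    calc |mean D h| ≤ ∑ a, |(D a).toReal * h a| := Finset.abs_sum_le_sum_abs _ _
      _ ≤ ∑ a, (D a).toReal * M := by
          refine Finset.sum_le_sum fun a _ => ?_
          rw [abs_mul, abs_of_nonneg ENNReal.toReal_nonneg]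
          exact mul_le_mul_of_nonneg_left (hh a) ENNReal.toReal_nonneg
      _ = M := by rw [← Finset.sum_mul, sum_toReal_eq_one, one_mul]
  have hc : ∀ a, |h a - mean D h| ≤ 2 * M := fun a => by
    have := abs_le.mp (hh a); have := abs_le.mp hm; rw [abs_le]; constructor <;> linarith
  have hmean : mean D (fun a => h a - mean D h) = 0 := by
    have : mean D (fun a => h a - mean D h) = mean D h - (∑ a, (D a).toReal) * mean D h := by
      simp only [mean, mul_sub, Finset.sum_sub_distrib, Finset.sum_mul]
    rw [this, sum_toReal_eq_one]; ring
  have hmean' : mean D (fun a => -(h a - mean D h)) = 0 := by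
    have : mean D (fun a => -(h a - mean D h)) = - mean D (fun a => h a - mean D h) := by
      simp only [mean, mul_neg, Finset.sum_neg_distrib]
    rw [this, hmean, neg_zero]
  have t1 := iidList_tail_le D _ (2 * M) τ (by positivity) hc hmean hτ0 hτ K
  have t2 := iidList_tail_le D _ (2 * M) τ (by positivity)
    (fun a => by rw [abs_neg]; exact hc a) hmean' hτ0 hτ K
  have hsum : ∀ l : List α, (l.map fun a => h a - mean D h).sum =
      (l.map h).sum - l.length * mean D h := by
    intro l
    induction l with
    | nil => simp
    | cons a l ih => simp only [List.map_cons, List.sum_cons, ih, List.length_cons]; push_cast; ring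
  have hsum' : ∀ l : List α, (l.map fun a => -(h a - mean D h)).sum =
      -((l.map h).sum - l.length * mean D h) := by
    intro l
    rw [← hsum l]
    induction l with
    | nil => simp
    | cons a l ih => simp only [List.map_cons, List.sum_cons, ih]; ring
  rw [two_mul, ENNReal.ofReal_add (by positivity) (by positivity)]
  have hexp : (K : ℝ) * (τ / M) ^ 2 / 16 = K * (τ / (2 * M)) ^ 2 / 4 := by
    field_simp; ring
  rw [hexp]
  refine le_trans ?_ (add_le_add t1 t2)
  refine le_trans ?_ (MeasureTheory.measure_union_le _ _)
  apply PMF.toOuterMeasure_mono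
  rintro l ⟨hl, hs⟩
  have hlen := length_of_mem_support_iidList hs
  simp only [Set.mem_ofPred_eq] at hl
  simp only [Set.mem_union, Set.mem_ofPred_eq, hsum, hsum', hlen]
  rcases le_abs.mp hl with h | h
  · exact Or.inl h
  · exact Or.inr h

end Concentration

/-! ### Rational approximation of the exponential function on the unit circle -/

/-- The map `θ ↦ exp (2 π i θ)`. -/
noncomputable def cis (θ : ℝ) : ℂ := Complex.exp ((2 * Real.pi * θ : ℝ) * Complex.I)

theorem norm_cis (θ : ℝ) : ‖cis θ‖ = 1 := Complex.norm_exp_ofReal_mul_I _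

theorem cis_add (a b : ℝ) : cis (a + b) = cis a * cis b := by
  rw [cis, cis, cis, ← Complex.exp_add]; congr 1; push_cast; ring

theorem cis_int (m : ℤ) : cis m = 1 := by
  rw [cis, Complex.exp_eq_one_iff]; exact ⟨m, by push_cast; ring⟩

theorem cis_zero : cis 0 = 1 := by simp [cis]

theorem cis_neg (a : ℝ) : cis (-a) = (starRingEnd ℂ) (cis a) := by
  rw [cis, cis, ← Complex.exp_conj, map_mul, Complex.conj_ofReal, Complex.conj_I]
  congr 1; push_cast; ring

theorem norm_pow_sub_pow_le {a b : ℂ} {R : ℝ} (ha : ‖a‖ ≤ R) (hb : ‖b‖ ≤ R) (hR : 1 ≤ R) (m : ℕ) :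
    ‖a ^ m - b ^ m‖ ≤ m * R ^ m * ‖a - b‖ := by
  induction m with
  | zero => simp
  | succ m ih =>
    have e : a ^ (m + 1) - b ^ (m + 1) = a * (a ^ m - b ^ m) + (a - b) * b ^ m := by ring
    have h1 : ‖b ^ m‖ ≤ R ^ (m + 1) := by
      rw [norm_pow]
      exact (pow_le_pow_left₀ (norm_nonneg _) hb m).trans (pow_le_pow_right₀ hR (by omega))
    calc ‖a ^ (m + 1) - b ^ (m + 1)‖ ≤ ‖a‖ * ‖a ^ m - b ^ m‖ + ‖a - b‖ * ‖b ^ m‖ := by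
          rw [e]; exact (norm_add_le _ _).trans (by rw [norm_mul, norm_mul])
      _ ≤ R * (m * R ^ m * ‖a - b‖) + ‖a - b‖ * R ^ (m + 1) := by gcongr
      _ = _ := by push_cast; ring

/-- `(1 + i φ / k) ^ k` approximates `exp (i φ)`. -/
theorem norm_exp_sub_one_add_pow_le {φ : ℝ} {k : ℕ} (h0 : 0 ≤ φ) (hφ : φ ≤ 7) (hk : 64 ≤ k) :
    ‖Complex.exp (φ * Complex.I) - (1 + (φ / k : ℝ) * Complex.I) ^ k‖ ≤ 120 / k := by
  have hk0 : (64 : ℝ) ≤ k := by exact_mod_cast hk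
  set x : ℝ := φ / k with hx
  have hx0 : 0 ≤ x := by positivity
  have hxk : k * x = φ := by rw [hx]; field_simp
  have hx1 : x ≤ 1 := by rw [hx, div_le_one (by linarith)]; linarith
  have hexp : Complex.exp (φ * Complex.I) = Complex.exp (x * Complex.I) ^ k := by
    rw [← Complex.exp_nat_mul]; congr 1; rw [← hxk]; push_cast; ring
  have hR : (1 : ℝ) ≤ Real.exp (x ^ 2 / 2) := Real.one_le_exp (by positivity)
  have hb : ‖(1 : ℂ) + x * Complex.I‖ ≤ Real.exp (x ^ 2 / 2) := by
    have h1 : ‖(1 : ℂ) + x * Complex.I‖ ^ 2 = 1 + x ^ 2 := by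
      rw [← Complex.normSq_eq_norm_sq, Complex.normSq_apply]; simp; ring
    have h2 : Real.exp (x ^ 2 / 2) ^ 2 = Real.exp (x ^ 2) := by
      rw [← Real.exp_nat_mul]; congr 1; push_cast; ring
    apply le_of_sq_le_sq _ (by positivity)
    rw [h1, h2]; linarith [Real.add_one_le_exp (x ^ 2)]
  have ha : ‖Complex.exp (x * Complex.I)‖ ≤ Real.exp (x ^ 2 / 2) := by
    rw [Complex.norm_exp_ofReal_mul_I]; exact hR
  have hab : ‖Complex.exp (x * Complex.I) - (1 + x * Complex.I)‖ ≤ x ^ 2 := by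
    have := Complex.norm_exp_sub_one_sub_id_le (x := x * Complex.I) (by simpa [abs_of_nonneg hx0])
    rw [sub_sub] at this
    simpa [abs_of_nonneg hx0] using this
  have hRk : Real.exp (x ^ 2 / 2) ^ k ≤ 2 := by
    rw [← Real.exp_nat_mul]
    have h1 : (k : ℝ) * (x ^ 2 / 2) ≤ 49 / 128 := by
      have : (k : ℝ) * (x ^ 2 / 2) = φ ^ 2 / (2 * k) := by rw [← hxk]; field_simp
      rw [this, div_le_div_iff₀ (by positivity) (by norm_num)]
      nlinarith
    calc _ ≤ Real.exp (1 / 2) := Real.exp_le_exp.mpr (by linarith)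
      _ ≤ 2 := by
        have h := Real.exp_one_lt_d9
        have h2 : Real.exp (1 / 2) ^ 2 = Real.exp 1 := by
          rw [← Real.exp_nat_mul]; congr 1; norm_num
        nlinarith [Real.exp_pos (1 / 2)]
  rw [hexp]
  calc _ ≤ k * Real.exp (x ^ 2 / 2) ^ k * ‖Complex.exp (x * Complex.I) - (1 + x * Complex.I)‖ :=
        norm_pow_sub_pow_le ha hb hR k
    _ ≤ k * 2 * x ^ 2 := by gcongr
    _ = 2 * φ ^ 2 / k := by rw [← hxk]; field_simp
    _ ≤ 120 / k := by gcongr; nlinarith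

/-- Numerator and denominator of the partial Wallis product, which tends to `π / 2`. -/
def wallisPair : ℕ → ℕ × ℕ
  | 0 => (1, 1)
  | k + 1 => ((wallisPair k).1 * ((2 * k + 2) * (2 * k + 2)),
      (wallisPair k).2 * ((2 * k + 1) * (2 * k + 3)))

theorem wallisPair_snd_pos (k : ℕ) : 0 < (wallisPair k).2 := by
  induction k with
  | zero => simp [wallisPair]
  | succ k ih => simp only [wallisPair]; positivity

theorem wallisPair_div (k : ℕ) :
    ((wallisPair k).1 : ℝ) / (wallisPair k).2 = Real.Wallis.W k := by
  induction k with
  | zero => simp [wallisPair, Real.Wallis.W]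
  | succ k ih =>
    have := wallisPair_snd_pos k
    rw [Real.Wallis.W_succ, ← ih]
    simp only [wallisPair]
    push_cast
    field_simp

/-- The Gaussian integer whose quotient by `cisDen` approximates `exp (2 π i z / Z)`, up to
`O(1 / k)`; only the residue of `z` modulo `Z` enters. -/
def cisNum (k : ℕ) (z : ℤ) (Z : ℕ) : GaussianInt :=
  (⟨k * (wallisPair k).2 * Z, 4 * (wallisPair k).1 * (z % Z)⟩ : GaussianInt) ^ k

/-- The denominator that belongs to `cisNum`. -/
def cisDen (k : ℕ) (Z : ℕ) : ℕ := (k * (wallisPair k).2 * Z) ^ k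

theorem cisDen_pos {k Z : ℕ} (hk : 0 < k) (hZ : 0 < Z) : 0 < cisDen k Z := by
  have := wallisPair_snd_pos k
  unfold cisDen; positivity

theorem norm_cisNum_div_sub_cis_le {k Z : ℕ} (hk : 64 ≤ k) (hZ : 0 < Z) (z : ℤ) :
    ‖(cisNum k z Z : ℂ) / (cisDen k Z : ℂ) - cis ((z : ℝ) / Z)‖ ≤ 130 / k := by
  have hk0 : (64 : ℝ) ≤ k := by exact_mod_cast hk
  have hZ0 : (0 : ℝ) < Z := by exact_mod_cast hZ
  have hw := wallisPair_snd_pos k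
  set θ : ℝ := ((z % Z : ℤ) : ℝ) / Z with hθ
  have hθ0 : 0 ≤ θ := by
    have : 0 ≤ z % Z := Int.emod_nonneg _ (by omega)
    have : (0 : ℝ) ≤ ((z % Z : ℤ) : ℝ) := by exact_mod_cast this
    positivity
  have hθ1 : θ ≤ 1 := by
    rw [hθ, div_le_one hZ0]
    have := (Int.emod_lt_of_pos z (by omega : (0 : ℤ) < Z)).le
    exact_mod_cast this
  have hcis : cis ((z : ℝ) / Z) = cis θ := by
    have : (z : ℝ) / Z = θ + ((z / Z : ℤ) : ℝ) := by
      rw [hθ]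
      have h := Int.emod_add_mul_ediv z Z
      have h' : ((z % Z : ℤ) : ℝ) + Z * ((z / Z : ℤ) : ℝ) = z := by exact_mod_cast h
      rw [← h']; field_simp
    rw [this, cis_add, cis_int, mul_one]
  set V := Real.Wallis.W k with hV
  have hV1 : V ≤ Real.pi / 2 := Real.Wallis.W_le k
  have hV0 : (2 * k + 1) / (2 * k + 2) * (Real.pi / 2) ≤ V := by
    have := Real.Wallis.le_W k
    simpa using this
  have hVpos : 0 ≤ V := (Real.Wallis.W_pos k).le
  set φ : ℝ := 4 * V * θ with hφ
  have hpi := Real.pi_lt_d2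
  have hφ0 : 0 ≤ φ := by positivity
  have hφ7 : φ ≤ 7 := by
    calc φ ≤ 4 * (Real.pi / 2) * 1 := by rw [hφ]; gcongr
      _ ≤ 7 := by linarith
  have hdiv : (cisNum k z Z : ℂ) / (cisDen k Z : ℂ) = (1 + (φ / k : ℝ) * Complex.I) ^ k := by
    rw [cisNum, cisDen, map_pow]
    push_cast
    rw [← div_pow]
    congr 1
    have hwc : ((wallisPair k).2 : ℂ) ≠ 0 := by exact_mod_cast hw.ne'
    have hZc : (Z : ℂ) ≠ 0 := by exact_mod_cast hZ.ne'
    have hkc : (k : ℂ) ≠ 0 := by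
      have : k ≠ 0 := by omega
      exact_mod_cast this
    rw [hφ, hθ, hV, ← wallisPair_div, GaussianInt.toComplex_def]
    push_cast
    field_simp
  have h1 := norm_exp_sub_one_add_pow_le hφ0 hφ7 hk
  have h2 : ‖Complex.exp (φ * Complex.I) - cis θ‖ ≤ 4 / k := by
    have e : Complex.exp (φ * Complex.I) - cis θ =
        cis θ * (Complex.exp (((φ - 2 * Real.pi * θ : ℝ) : ℂ) * Complex.I) - 1) := by
      rw [cis, mul_sub, ← Complex.exp_add, mul_one]; congr 2; push_cast; ring
    rw [e, norm_mul, norm_cis, one_mul]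
    have h3 : ‖Complex.exp (((φ - 2 * Real.pi * θ : ℝ) : ℂ) * Complex.I) - 1‖ ≤
        |φ - 2 * Real.pi * θ| := by
      have := Real.norm_exp_I_mul_ofReal_sub_one_le (x := φ - 2 * Real.pi * θ)
      rwa [mul_comm, Real.norm_eq_abs] at this
    refine h3.trans ?_
    have h4 : φ - 2 * Real.pi * θ = 4 * (V - Real.pi / 2) * θ := by rw [hφ]; ring
    rw [h4, abs_mul, abs_mul, abs_of_nonneg hθ0, abs_of_nonpos (by linarith : V - Real.pi / 2 ≤ 0)]
    have h5 : Real.pi / 2 - V ≤ 1 / k := by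
      have : (2 * k + 1) / (2 * k + 2) * (Real.pi / 2) =
          Real.pi / 2 - Real.pi / (4 * (k + 1)) := by field_simp; ring
      rw [this] at hV0
      have : Real.pi / (4 * (k + 1)) ≤ 1 / k := by
        rw [div_le_div_iff₀ (by positivity) (by positivity)]; nlinarith
      linarith
    calc |(4 : ℝ)| * -(V - Real.pi / 2) * θ ≤ 4 * (1 / k) * 1 := by
          rw [abs_of_pos (by norm_num : (0 : ℝ) < 4)]
          gcongr
          linarith
      _ = 4 / k := by ring
  rw [hcis, hdiv]
  calc _ ≤ ‖(1 + (φ / k : ℝ) * Complex.I) ^ k - Complex.exp (φ * Complex.I)‖ +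
        ‖Complex.exp (φ * Complex.I) - cis θ‖ := norm_sub_le_norm_sub_add_norm_sub _ _ _
    _ ≤ 120 / k + 4 / k := by rw [norm_sub_rev]; exact add_le_add h1 h2
    _ ≤ 130 / k := by rw [← add_div]; gcongr; norm_num

/-! ### Fourier coefficients modulo `N` -/

section Fourier

open Finset ComplexConjugate

variable {N : ℕ} [NeZero N]

theorem cis_eq_of_dvd {k l : ℤ} (h : (N : ℤ) ∣ k - l) : cis ((k : ℝ) / N) = cis ((l : ℝ) / N) := by
  obtain ⟨m, hm⟩ := h
  have hN : (N : ℝ) ≠ 0 := by exact_mod_cast NeZero.ne N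
  have : (k : ℝ) / N = (l : ℝ) / N + (m : ℤ) := by
    have : (k : ℝ) = l + N * m := by exact_mod_cast (by linarith : k = l + N * m)
    rw [this]; field_simp
  rw [this, cis_add, cis_int, mul_one]

theorem cis_nat_mul (θ : ℝ) (m : ℕ) : cis (m * θ) = cis θ ^ m := by
  rw [cis, cis, ← Complex.exp_nat_mul]; congr 1; push_cast; ring

theorem cis_eq_one_iff (θ : ℝ) : cis θ = 1 ↔ ∃ m : ℤ, θ = m := by
  rw [cis, Complex.exp_eq_one_iff]
  have hpi : (2 * Real.pi * Complex.I : ℂ) ≠ 0 := Complex.two_pi_I_ne_zero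
  constructor
  · rintro ⟨m, hm⟩
    refine ⟨m, ?_⟩
    have h2 : (θ : ℂ) * (2 * Real.pi * Complex.I) = (m : ℂ) * (2 * Real.pi * Complex.I) := by
      rw [← hm]; push_cast; ring
    exact_mod_cast mul_right_cancel₀ hpi h2
  · rintro ⟨m, rfl⟩
    exact ⟨m, by push_cast; ring⟩

/-- Orthogonality of the characters of `ℤ / N`. -/
theorem sum_cis (k : ℤ) :
    ∑ y : Fin N, cis ((k * (y : ℕ) : ℝ) / N) = if (N : ℤ) ∣ k then (N : ℂ) else 0 := by
  have hN : (N : ℝ) ≠ 0 := by exact_mod_cast NeZero.ne N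
  have h1 : ∀ y : Fin N, cis ((k * (y : ℕ) : ℝ) / N) = cis ((k : ℝ) / N) ^ (y : ℕ) := by
    intro y; rw [← cis_nat_mul]; congr 1; ring
  simp_rw [h1]
  rw [Fin.sum_univ_eq_sum_range (fun j => cis ((k : ℝ) / N) ^ j) N]
  split_ifs with h
  · have : cis ((k : ℝ) / N) = 1 := by
      rw [cis_eq_of_dvd (l := 0) (by simpa using h)]; simp [cis_zero]
    simp [this]
  · have hne : cis ((k : ℝ) / N) ≠ 1 := by
      intro h1
      obtain ⟨m, hm⟩ := (cis_eq_one_iff _).mp h1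
      apply h
      rw [div_eq_iff hN] at hm
      exact ⟨m, by rw [mul_comm]; exact_mod_cast hm⟩
    rw [geom_sum_eq hne]
    have : cis ((k : ℝ) / N) ^ N = 1 := by
      rw [← cis_nat_mul]
      have : (N : ℝ) * ((k : ℝ) / N) = (k : ℤ) := by field_simp
      rw [this, cis_int]
    rw [this]; simp

/-- The Fourier transform modulo `N` for `s = 1`, and its inverse for `s = -1`. -/
noncomputable def fourier (s : ℤ) (ψ : Fin N → ℂ) (y : Fin N) : ℂ :=
  (1 / Real.sqrt N : ℝ) * ∑ x : Fin N, cis ((s * ((x : ℕ) * (y : ℕ)) : ℝ) / N) * ψ x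

/-- Modulating the spectrum by the character of frequency `d` amounts to a translation by `d`. -/
theorem sum_cis_mul_fourier {s : ℤ} (hs : IsUnit s) (φ χ : Fin N → ℂ) (d : Fin N) :
    ∑ y : Fin N, cis (-(s * ((d : ℕ) * (y : ℕ)) : ℝ) / N) * (conj (fourier s φ y) * fourier s χ y) =
      ∑ x : Fin N, conj (φ x) * χ (x + d) := by
  have hN : (N : ℝ) ≠ 0 := by exact_mod_cast NeZero.ne N
  have hNc : (N : ℂ) ≠ 0 := by exact_mod_cast NeZero.ne N
  have hsq : ((1 / Real.sqrt N : ℝ) : ℂ) * ((1 / Real.sqrt N : ℝ) : ℂ) = 1 / (N : ℂ) := by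
    rw [← Complex.ofReal_mul]
    have : (1 / Real.sqrt N) * (1 / Real.sqrt N) = (1 / N : ℝ) := by
      rw [div_mul_div_comm, one_mul, Real.mul_self_sqrt (by positivity)]
    rw [this]; push_cast; rfl
  have h1 : ∀ y : Fin N,
      cis (-(s * ((d : ℕ) * (y : ℕ)) : ℝ) / N) * (conj (fourier s φ y) * fourier s χ y) =
      ∑ x : Fin N, ∑ x' : Fin N, (1 / (N : ℂ)) * (conj (φ x) * χ x') *
        cis (((s * ((x' : ℕ) - (x : ℕ) - (d : ℕ)) : ℤ) * (y : ℕ) : ℝ) / N) := by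
    intro y
    rw [fourier, fourier, map_mul, Complex.conj_ofReal, map_sum]
    have : ∀ A B : ℂ, ((1 / Real.sqrt N : ℝ) : ℂ) * A * (((1 / Real.sqrt N : ℝ) : ℂ) * B) =
        1 / (N : ℂ) * (A * B) := by
      intro A B; rw [← hsq]; ring
    rw [this, Finset.sum_mul_sum, Finset.mul_sum, Finset.mul_sum]
    refine Finset.sum_congr rfl fun x _ => ?_
    rw [Finset.mul_sum, Finset.mul_sum]
    refine Finset.sum_congr rfl fun x' _ => ?_
    rw [map_mul, ← cis_neg]
    have : cis (((s * ((x' : ℕ) - (x : ℕ) - (d : ℕ)) : ℤ) * (y : ℕ) : ℝ) / N) =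
        cis (-(s * ((d : ℕ) * (y : ℕ)) : ℝ) / N) *
        (cis (-((s * ((x : ℕ) * (y : ℕ)) : ℝ) / N)) *
          cis ((s * ((x' : ℕ) * (y : ℕ)) : ℝ) / N)) := by
      rw [← cis_add, ← cis_add]; congr 1; push_cast; ring
    rw [this]; ring
  simp_rw [h1]
  rw [Finset.sum_comm]
  refine Finset.sum_congr rfl fun x _ => ?_
  rw [Finset.sum_comm]
  simp_rw [← Finset.mul_sum]
  have h2 : ∀ x' : Fin N, ∑ y : Fin N,
      cis (((s * ((x' : ℕ) - (x : ℕ) - (d : ℕ)) : ℤ) * (y : ℕ) : ℝ) / N) =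
      if x' = x + d then (N : ℂ) else 0 := by
    intro x'
    rw [sum_cis]
    refine if_congr ?_ rfl rfl
    rw [IsUnit.dvd_mul_left hs]
    constructor
    · intro h
      apply Fin.ext
      rw [Fin.val_add]
      have h3 : ((x' : ℕ) : ℤ) ≡ ((x + d : ℕ) : ℤ) [ZMOD N] := by
        refine Int.ModEq.symm ((Int.modEq_iff_dvd).mpr ?_)
        have e : (((x' : ℕ) : ℤ) - ((x : ℕ) + (d : ℕ) : ℕ)) = (x' : ℕ) - (x : ℕ) - (d : ℕ) := by
          push_cast; ring
        rw [e]; exact h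
      have h4 : (x' : ℕ) % N = (x + d) % N := (Int.natCast_modEq_iff.mp h3)
      rwa [Nat.mod_eq_of_lt x'.2] at h4
    · intro h
      have h3 : (x' : ℕ) = (x + d) % N := by rw [h, Fin.val_add]
      have h4 : ((x' : ℕ) : ℤ) = ((x : ℕ) + (d : ℕ)) % N := by rw [h3]; push_cast; rfl
      rw [h4, sub_sub]
      exact (Int.mod_modEq _ _).symm.dvd
  simp_rw [h2]
  rw [Finset.sum_eq_single (x + d)]
  · rw [if_pos rfl]; field_simp
  · intro b _ hb; rw [if_neg hb, mul_zero]
  · intro h; exact absurd (Finset.mem_univ _) h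

/-- The Plancherel identity. -/
theorem sum_norm_sq_fourier {s : ℤ} (hs : IsUnit s) (φ : Fin N → ℂ) :
    ∑ y : Fin N, ‖fourier s φ y‖ ^ 2 = ∑ x : Fin N, ‖φ x‖ ^ 2 := by
  have h := sum_cis_mul_fourier hs φ φ 0
  have e : ∀ z : ℂ, conj z * z = ((‖z‖ ^ 2 : ℝ) : ℂ) := fun z => by
    rw [mul_comm, Complex.mul_conj, Complex.normSq_eq_norm_sq]
  simp only [Fin.val_zero, Nat.cast_zero, zero_mul, mul_zero, neg_zero, zero_div, cis_zero,
    one_mul, add_zero, e] at h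
  exact_mod_cast h

/-- The total weight of the Fourier coefficients at the labels congruent to `a` modulo `M`. -/
noncomputable def residueWeight (s : ℤ) (ψ : Fin N → ℂ) (M a : ℕ) : ℝ :=
  ∑ y ∈ Finset.univ.filter (fun y : Fin N => (y : ℕ) ≡ a [MOD M]), ‖fourier s ψ y‖ ^ 2

/-- The weight on a residue class is an average of overlaps of `ψ` with its translates. -/
theorem residueWeight_eq {s : ℤ} (hs : IsUnit s) (ψ : Fin N → ℂ) {M Q : ℕ} (hMQ : M * Q = N)
    (a : ℕ) : (residueWeight s ψ M a : ℂ) = (1 / (N : ℂ)) * ∑ r : Fin N, ∑ x : Fin N,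
      conj (ψ x) * ψ (x + Fin.ofNat N (r * Q)) * cis ((s * a * ((r : ℕ) * Q) : ℝ) / N) := by
  have hN : (N : ℝ) ≠ 0 := by exact_mod_cast NeZero.ne N
  have hNc : (N : ℂ) ≠ 0 := by exact_mod_cast NeZero.ne N
  have hQ : (Q : ℤ) ≠ 0 := by rintro h; apply NeZero.ne N; rw [← hMQ]; simp_all
  have e : ∀ z : ℂ, conj z * z = ((‖z‖ ^ 2 : ℝ) : ℂ) := fun z => by
    rw [mul_comm, Complex.mul_conj, Complex.normSq_eq_norm_sq]
  have h1 : ∀ r : Fin N, ∑ x : Fin N,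
      conj (ψ x) * ψ (x + Fin.ofNat N (r * Q)) * cis ((s * a * ((r : ℕ) * Q) : ℝ) / N) =
      ∑ y : Fin N, ((‖fourier s ψ y‖ ^ 2 : ℝ) : ℂ) *
        cis (((s * ((a : ℤ) - (y : ℕ)) * Q : ℤ) * (r : ℕ) : ℝ) / N) := by
    intro r
    rw [← Finset.sum_mul, ← sum_cis_mul_fourier hs, Finset.sum_mul]
    refine Finset.sum_congr rfl fun y _ => ?_
    have hd : cis (-(s * (((Fin.ofNat N (r * Q) : Fin N) : ℕ) * (y : ℕ)) : ℝ) / N) =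
        cis (-(s * ((r : ℕ) * Q * (y : ℕ)) : ℝ) / N) := by
      have := cis_eq_of_dvd (N := N) (k := -(s * (((Fin.ofNat N (r * Q) : Fin N) : ℕ) * (y : ℕ))))
        (l := -(s * ((r : ℕ) * Q * (y : ℕ)))) ?_
      · push_cast at this; exact this
      · have h3 : (N : ℤ) ∣ ((r : ℕ) * Q : ℤ) - ((Fin.ofNat N (r * Q) : Fin N) : ℕ) := by
          rw [Fin.val_ofNat]; push_cast
          exact (Int.mod_modEq _ _).dvd
        obtain ⟨m, hm⟩ := h3
        exact ⟨s * m * (y : ℕ), by linear_combination (s * (y : ℕ)) * hm⟩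
    rw [hd, e]
    have : cis (((s * ((a : ℤ) - (y : ℕ)) * Q : ℤ) * (r : ℕ) : ℝ) / N) =
        cis (-(s * ((r : ℕ) * Q * (y : ℕ)) : ℝ) / N) * cis ((s * a * ((r : ℕ) * Q) : ℝ) / N) := by
      rw [← cis_add]; congr 1; push_cast; ring
    rw [this]; ring
  simp_rw [h1]
  rw [Finset.sum_comm]
  simp_rw [← Finset.mul_sum, sum_cis]
  rw [residueWeight, Finset.sum_filter, Finset.mul_sum]
  push_cast
  refine Finset.sum_congr rfl fun y _ => ?_
  have : ((y : ℕ) ≡ a [MOD M]) ↔ (N : ℤ) ∣ s * ((a : ℤ) - (y : ℕ)) * Q := by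
    have hc : (N : ℤ) = M * Q := by exact_mod_cast hMQ.symm
    rw [hc, mul_dvd_mul_iff_right hQ, IsUnit.dvd_mul_left hs]
    exact Nat.modEq_iff_dvd
  rw [if_congr this rfl rfl]
  split_ifs
  · push_cast; field_simp
  · simp

omit [NeZero N] in
theorem residueWeight_self (s : ℤ) (ψ : Fin N → ℂ) (y : Fin N) :
    residueWeight s ψ N y = ‖fourier s ψ y‖ ^ 2 := by
  rw [residueWeight, Finset.sum_eq_single_of_mem y]
  · simp [Nat.ModEq.refl]
  · intro b hb hne
    exfalso; apply hne; apply Fin.ext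
    have : (b : ℕ) ≡ y [MOD N] := by simpa using hb
    exact Nat.ModEq.eq_of_lt_of_lt this b.2 y.2

/-- Distinct residue classes are disjoint, so their weights sum to at most the total. -/
theorem sum_residueWeight_le {s : ℤ} (hs : IsUnit s) (ψ : Fin N → ℂ) (M : ℕ) (A : Finset ℕ)
    (hA : ∀ a ∈ A, a < M) : ∑ a ∈ A, residueWeight s ψ M a ≤ ∑ x, ‖ψ x‖ ^ 2 := by
  classical
  rw [← sum_norm_sq_fourier hs ψ]
  simp only [residueWeight]
  rw [← Finset.sum_biUnion]
  · exact Finset.sum_le_sum_of_subset_of_nonneg (Finset.subset_univ _) fun _ _ _ => by positivity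
  · intro a ha b hb hab
    rw [Function.onFun, Finset.disjoint_left]
    intro y hy hy'
    have h1 : (y : ℕ) ≡ a [MOD M] := by simpa using hy
    have h2 : (y : ℕ) ≡ b [MOD M] := by simpa using hy'
    exact hab (Nat.ModEq.eq_of_lt_of_lt (h1.symm.trans h2) (hA a ha) (hA b hb))

/-! ### Bounded estimators for overlaps -/

/-- The bounded quantity whose mean, under the weights `‖α‖² + ‖β‖²`, is the overlap
`2 Re (conj α β c)`; it is `0` when `α = β = 0`. -/
noncomputable def overlapRatio (α β c : ℂ) : ℝ :=
  2 * (conj α * β * c).re / (‖α‖ ^ 2 + ‖β‖ ^ 2)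

theorem two_mul_abs_re_le (α β c : ℂ) :
    |2 * (conj α * β * c).re| ≤ ‖c‖ * (‖α‖ ^ 2 + ‖β‖ ^ 2) := by
  have h1 : |(conj α * β * c).re| ≤ ‖α‖ * ‖β‖ * ‖c‖ := by
    refine (Complex.abs_re_le_norm _).trans ?_
    rw [norm_mul, norm_mul, Complex.norm_conj]
  rw [abs_mul, abs_two]
  nlinarith [norm_nonneg c, mul_nonneg (norm_nonneg c) (sq_nonneg (‖α‖ - ‖β‖))]

theorem abs_overlapRatio_le (α β c : ℂ) : |overlapRatio α β c| ≤ ‖c‖ := by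
  rw [overlapRatio, abs_div, abs_of_nonneg (by positivity : 0 ≤ ‖α‖ ^ 2 + ‖β‖ ^ 2)]
  exact div_le_of_le_mul₀ (by positivity) (norm_nonneg _) (two_mul_abs_re_le α β c)

theorem overlapRatio_sub (α β c c' : ℂ) :
    overlapRatio α β c - overlapRatio α β c' = overlapRatio α β (c - c') := by
  rw [overlapRatio, overlapRatio, overlapRatio, ← sub_div, mul_sub, Complex.sub_re, mul_sub]

theorem overlapRatio_swap (α β c : ℂ) : overlapRatio α β c = overlapRatio β α (conj c) := by
  rw [overlapRatio, overlapRatio, add_comm (‖α‖ ^ 2)]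
  congr 2
  rw [← Complex.conj_re (conj α * β * c)]
  simp only [map_mul, Complex.conj_conj]
  congr 1; ring

theorem overlapRatio_mul (α β c : ℂ) :
    (‖α‖ ^ 2 + ‖β‖ ^ 2) * overlapRatio α β c = 2 * (conj α * β * c).re := by
  by_cases h : ‖α‖ ^ 2 + ‖β‖ ^ 2 = 0
  · have h1 := two_mul_abs_re_le α β c
    rw [h, mul_zero] at h1
    rw [h, zero_mul, abs_nonpos_iff.mp h1]
  · rw [overlapRatio]; field_simp

/-- Replacing the amplitudes by approximations changes the weighted estimator little, even where
the weights are tiny. -/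
theorem abs_weight_mul_overlapRatio_sub_le {α β α' β' c : ℂ} {η : ℝ} (hα : ‖α‖ ≤ 1) (hβ : ‖β‖ ≤ 1)
    (hαα : ‖α' - α‖ ≤ η) (hββ : ‖β' - β‖ ≤ η) (hη : η ≤ 1) (hc : ‖c‖ ≤ 1) :
    |(‖α‖ ^ 2 + ‖β‖ ^ 2) * overlapRatio α' β' c - 2 * (conj α * β * c).re| ≤ 12 * η := by
  have hη0 : 0 ≤ η := (norm_nonneg _).trans hαα
  have sq : ∀ z z' : ℂ, ‖z‖ ≤ 1 → ‖z' - z‖ ≤ η → |‖z‖ ^ 2 - ‖z'‖ ^ 2| ≤ 3 * η := by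
    intro z z' hz hzz
    have h1 : |‖z‖ - ‖z'‖| ≤ η := (abs_norm_sub_norm_le z z').trans (by rwa [norm_sub_rev])
    have h2 : ‖z'‖ ≤ 2 := by have := abs_le.mp h1; linarith
    have e : ‖z‖ ^ 2 - ‖z'‖ ^ 2 = (‖z‖ + ‖z'‖) * (‖z‖ - ‖z'‖) := by ring
    rw [e, abs_mul, abs_of_nonneg (by positivity : 0 ≤ ‖z‖ + ‖z'‖)]
    exact mul_le_mul (by linarith) h1 (abs_nonneg _) (by norm_num)
  have hα2 : ‖α'‖ ≤ 2 := by
    have := norm_le_norm_add_norm_sub' α' α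
    linarith
  have h1 : |(conj α' * β' * c).re - (conj α * β * c).re| ≤ 3 * η := by
    rw [← Complex.sub_re]
    refine (Complex.abs_re_le_norm _).trans ?_
    have e : conj α' * β' * c - conj α * β * c =
        (conj α' * (β' - β) + conj (α' - α) * β) * c := by rw [map_sub]; ring
    rw [e, norm_mul]
    calc _ ≤ (‖conj α' * (β' - β)‖ + ‖conj (α' - α) * β‖) * 1 := by
          gcongr; exact norm_add_le _ _
      _ = ‖α'‖ * ‖β' - β‖ + ‖α' - α‖ * ‖β‖ := by
          rw [norm_mul, norm_mul, Complex.norm_conj, Complex.norm_conj, mul_one]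
      _ ≤ 2 * η + η * 1 := by gcongr
      _ = 3 * η := by ring
  have e := overlapRatio_mul α' β' c
  have h2 := sq α α' hα hαα
  have h3 := sq β β' hβ hββ
  have h4 := (abs_overlapRatio_le α' β' c).trans hc
  have h5 : (‖α‖ ^ 2 + ‖β‖ ^ 2) * overlapRatio α' β' c - 2 * (conj α * β * c).re =
      ((‖α‖ ^ 2 - ‖α'‖ ^ 2) + (‖β‖ ^ 2 - ‖β'‖ ^ 2)) * overlapRatio α' β' c +
      2 * ((conj α' * β' * c).re - (conj α * β * c).re) := by linear_combination e
  rw [h5]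
  calc _ ≤ |((‖α‖ ^ 2 - ‖α'‖ ^ 2) + (‖β‖ ^ 2 - ‖β'‖ ^ 2)) * overlapRatio α' β' c| +
        |2 * ((conj α' * β' * c).re - (conj α * β * c).re)| := abs_add_le _ _
    _ ≤ (3 * η + 3 * η) * 1 + 2 * (3 * η) := by
        rw [abs_mul, abs_mul, abs_two]
        gcongr
        exact (abs_add_le _ _).trans (add_le_add h2 h3)
    _ = 12 * η := by ring

/-- Sampling `x` from `‖ψ x‖²` and a uniform translation estimates the weight on a residue class.
The two orders of a pair `x, x + d` contribute equally, which replaces the weights `‖ψ x‖²`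
by the symmetric ones. -/
theorem abs_mean_overlapRatio_sub_residueWeight_le {s : ℤ} (hs : IsUnit s) (ψ ψ' : Fin N → ℂ)
    {η : ℝ} (hψ : ∀ x, ‖ψ x‖ ≤ 1) (happ : ∀ x, ‖ψ' x - ψ x‖ ≤ η) (hη : η ≤ 1) {M Q : ℕ}
    (hMQ : M * Q = N) (a : ℕ) :
    |(1 / N : ℝ) * ∑ r : Fin N, ∑ x : Fin N, ‖ψ x‖ ^ 2 * overlapRatio (ψ' x)
        (ψ' (x + Fin.ofNat N (r * Q))) (cis ((s * a * ((r : ℕ) * Q) : ℝ) / N)) -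
      residueWeight s ψ M a| ≤ 6 * N * η := by
  have hN : (0 : ℝ) < N := by exact_mod_cast NeZero.pos N
  set d : Fin N → Fin N := fun r => Fin.ofNat N (r * Q) with hd
  set c : Fin N → ℂ := fun r => cis ((s * a * ((r : ℕ) * Q) : ℝ) / N) with hc
  set X : Fin N → Fin N → ℝ := fun r x => overlapRatio (ψ' x) (ψ' (x + d r)) (c r) with hX
  have hmod : ∀ r : Fin N, (N : ℤ) ∣ ((-r : Fin N) : ℕ) + (r : ℕ) := by
    intro r
    have h1 : ((-r + r : Fin N) : ℕ) = 0 := by simp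
    rw [Fin.val_add] at h1
    exact_mod_cast Nat.dvd_of_mod_eq_zero h1
  have hdneg : ∀ r, d (-r) = -d r := by
    intro r
    rw [eq_neg_iff_add_eq_zero]
    apply Fin.ext
    rw [Fin.val_add, hd, Fin.val_ofNat, Fin.val_ofNat, ← Nat.add_mod, Fin.val_zero, ← add_mul]
    exact Nat.mod_eq_zero_of_dvd (Dvd.dvd.mul_right (by exact_mod_cast hmod r) _)
  have hcneg : ∀ r, c (-r) = conj (c r) := by
    intro r
    rw [hc, ← cis_neg]
    have := cis_eq_of_dvd (N := N) (k := s * a * (((-r : Fin N) : ℕ) * Q))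
      (l := -(s * a * ((r : ℕ) * Q))) ?_
    · push_cast at this
      rw [neg_div] at this
      exact this
    · obtain ⟨m, hm⟩ := hmod r
      exact ⟨s * a * m * Q, by linear_combination (s * a * Q) * hm⟩
  have hsymm : ∑ r, ∑ x, ‖ψ (x + d r)‖ ^ 2 * X r x = ∑ r, ∑ x, ‖ψ x‖ ^ 2 * X r x := by
    rw [← Equiv.sum_comp (Equiv.neg (Fin N)) (fun r => ∑ x, ‖ψ x‖ ^ 2 * X r x)]
    refine Finset.sum_congr rfl fun r _ => ?_
    rw [← Equiv.sum_comp (Equiv.addRight (d r)) (fun x => ‖ψ x‖ ^ 2 * X ((Equiv.neg (Fin N)) r) x)]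
    refine Finset.sum_congr rfl fun x _ => ?_
    simp only [Equiv.neg_apply, Equiv.coe_addRight, hX, hdneg, hcneg, add_neg_cancel_right]
    rw [overlapRatio_swap]
  have hre : (N : ℝ) * residueWeight s ψ M a =
      ∑ r, ∑ x, (conj (ψ x) * ψ (x + d r) * c r).re := by
    have h := residueWeight_eq hs ψ hMQ a
    have h2 : ((N : ℝ) * residueWeight s ψ M a : ℂ) =
        ∑ r, ∑ x, conj (ψ x) * ψ (x + d r) * c r := by
      have : (N : ℂ) ≠ 0 := by exact_mod_cast NeZero.ne N
      rw [h, Complex.ofReal_natCast, ← mul_assoc, mul_one_div_cancel this, one_mul]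
    have h3 := congrArg Complex.re h2
    rw [Complex.re_sum] at h3
    simp_rw [Complex.re_sum] at h3
    rw [← h3, ← Complex.ofReal_mul, Complex.ofReal_re]
  have hmain : |∑ r, ∑ x, ((‖ψ x‖ ^ 2 + ‖ψ (x + d r)‖ ^ 2) * X r x -
      2 * (conj (ψ x) * ψ (x + d r) * c r).re)| ≤ N * (N * (12 * η)) := by
    refine (Finset.abs_sum_le_sum_abs _ _).trans ?_
    calc _ ≤ ∑ r : Fin N, (N : ℝ) * (12 * η) := by
          refine Finset.sum_le_sum fun r _ => ?_
          refine (Finset.abs_sum_le_sum_abs _ _).trans ?_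
          calc _ ≤ ∑ x : Fin N, 12 * η := Finset.sum_le_sum fun x _ =>
                abs_weight_mul_overlapRatio_sub_le (hψ _) (hψ _) (happ _) (happ _) hη
                  (norm_cis _).le
            _ = _ := by simp
      _ = _ := by simp
  have hsplit : ∑ r, ∑ x, ((‖ψ x‖ ^ 2 + ‖ψ (x + d r)‖ ^ 2) * X r x -
      2 * (conj (ψ x) * ψ (x + d r) * c r).re) =
      2 * (∑ r, ∑ x, ‖ψ x‖ ^ 2 * X r x) - 2 * (N * residueWeight s ψ M a) := by
    rw [hre]
    simp_rw [Finset.sum_sub_distrib, add_mul, Finset.sum_add_distrib]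
    rw [hsymm]
    simp_rw [← Finset.mul_sum]
    ring
  rw [hsplit] at hmain
  have e : (1 / N : ℝ) * (∑ r, ∑ x, ‖ψ x‖ ^ 2 * X r x) - residueWeight s ψ M a =
      (1 / (2 * N)) * (2 * (∑ r, ∑ x, ‖ψ x‖ ^ 2 * X r x) - 2 * (N * residueWeight s ψ M a)) := by
    field_simp
  rw [e, abs_mul, abs_of_pos (by positivity : (0 : ℝ) < 1 / (2 * N))]
  calc _ ≤ 1 / (2 * N) * (N * (N * (12 * η))) := by gcongr
    _ = _ := by field_simp; ring

/-- Sampling both from `‖ψ x‖²` and uniformly estimates a linear functional of `ψ` whose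
coefficients all have modulus `‖α‖ = 1 / √N`. -/
theorem abs_sum_overlapRatio_sub_le (ψ ψ' : Fin N → ℂ) {η : ℝ} (hψ : ∀ x, ‖ψ x‖ ≤ 1)
    (happ : ∀ x, ‖ψ' x - ψ x‖ ≤ η) (hη : η ≤ 1) (α : ℂ) (hα : ‖α‖ ^ 2 = 1 / N)
    (c : Fin N → ℂ) (hc : ∀ x, ‖c x‖ ≤ 1) :
    |∑ x : Fin N, (‖ψ x‖ ^ 2 + 1 / N) * overlapRatio α (ψ' x) (c x) -
      2 * (∑ x, conj α * ψ x * c x).re| ≤ 12 * N * η := by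
  have hN : (1 : ℝ) ≤ N := by exact_mod_cast NeZero.one_le
  have hη0 : 0 ≤ η := (norm_nonneg _).trans (happ 0)
  have hα1 : ‖α‖ ≤ 1 := by
    have : ‖α‖ ^ 2 ≤ 1 := by rw [hα, div_le_one (by linarith)]; exact hN
    nlinarith [norm_nonneg α]
  rw [Complex.re_sum, Finset.mul_sum, ← Finset.sum_sub_distrib]
  refine (Finset.abs_sum_le_sum_abs _ _).trans ?_
  calc _ ≤ ∑ x : Fin N, 12 * η := by
        refine Finset.sum_le_sum fun x _ => ?_
        rw [add_comm, ← hα]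
        exact abs_weight_mul_overlapRatio_sub_le hα1 (hψ _) (by simpa using hη0) (happ _) hη (hc _)
    _ = _ := by simp; ring

end Fourier

/-! ### Programs for arithmetic with Gaussian integers -/

namespace Prog

/-- A constant. -/
abbrev cst (z : ℤ) : Prog := .op (.const z)
/-- The first component of the result of `p`. -/
abbrev fst (p : Prog) : Prog := .comp (.op .fst) p
/-- The second component of the result of `p`. -/
abbrev snd (p : Prog) : Prog := .comp (.op .snd) p
/-- The sum of two results. -/
abbrev plus (f g : Prog) : Prog := .bin .add f g
/-- The difference of two results. -/
abbrev minus (f g : Prog) : Prog := .bin .sub f g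
/-- The product of two results. -/
abbrev times (f g : Prog) : Prog := .bin .mul f g
/-- The quotient of two results. -/
abbrev quot (f g : Prog) : Prog := .bin .div f g
/-- The comparison of two results. -/
abbrev leq (f g : Prog) : Prog := .bin .le f g

/-- The environment without its first `k` entries. -/
def tl : ℕ → Prog
  | 0 => .op .id
  | k + 1 => .comp (tl k) (.op .snd)

/-- One step of `fold`: the current value consists of the remaining list and the accumulator. -/
def foldStep (body : Prog) : Prog :=
  .ite (.comp (.op .isInt) (fst (var 0))) (var 0)
    (.pair (snd (fst (var 0)))
      (.comp body (.pair (fst (fst (var 0))) (.pair (snd (var 0)) (tl 1)))))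

/-- Fold `body` over the first `cnt` entries of the list `lst`; `body` sees the current entry and
the accumulator as entries `0` and `1` in front of the environment. -/
def fold (cnt lst init body : Prog) : Prog :=
  snd (.loop cnt (.pair lst init) (foldStep body))

end Prog

theorem Data.list_drop_size_le (l : List Data) (j : ℕ) :
    (Data.list (l.drop j)).size ≤ (Data.list l).size := by
  induction l generalizing j with
  | nil => simp
  | cons a l ih =>
    cases j with
    | zero => simp
    | succ j => simp only [List.drop_succ_cons, Data.list, Data.size]; have := ih j; omega

theorem Data.size_getElem_le (l : List Data) (j : ℕ) (h : j < l.length) :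
    (l[j]).size ≤ (Data.list l).size := by
  induction l generalizing j with
  | nil => simp at h
  | cons a l ih =>
    cases j with
    | zero => simp only [List.getElem_cons_zero, Data.list, Data.size]; omega
    | succ j =>
      simp only [List.getElem_cons_succ, Data.list, Data.size]
      have := ih j (by simpa using h)
      omega

/-- A fold is described by the successive values `A i 0, A i 1, …` of its accumulator. -/
theorem Runs.fold {I : Type} {σ : I → ℕ} {e : I → Data} {cnt lst init body : Prog} {k : I → ℕ}
    {l : I → List Data} {A : I → ℕ → Data}
    (hcnt : Runs σ cnt e (fun i => .nat (k i))) (hlst : Runs σ lst e (fun i => .list (l i)))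
    (hinit : Runs σ init e (fun i => A i 0)) (hk : PolyBdd σ k)
    (hA : Small (fun p : {p : I × ℕ // p.2 ≤ (l p.1).length} => σ p.1.1) (fun p => A p.1.1 p.1.2))
    (hbody : Runs (fun p : {p : I × ℕ // p.2 < (l p.1).length} => σ p.1.1) body
      (fun p => .pair ((l p.1.1)[p.1.2]'p.2) (.pair (A p.1.1 p.1.2) (e p.1.1)))
      (fun p => A p.1.1 (p.1.2 + 1))) :
    Runs σ (.fold cnt lst init body) e (fun i => A i (min (k i) (l i).length)) := by
  have hloop : Runs σ (.loop cnt (.pair lst init) (.foldStep body)) e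
      (fun i => Data.pair (.list ((l i).drop (k i))) (A i (min (k i) (l i).length))) := by
    refine Runs.loop
      (s := fun i j => .pair (.list ((l i).drop j)) (A i (min j (l i).length))) hcnt
      ((hlst.pair hinit).congr fun i => by simp) hk ?_
    have hs1 : Small (fun p : {p : I × ℕ // p.2 < k p.1} => σ p.1.1)
        (fun p => Data.list ((l p.1.1).drop p.1.2)) :=
      PolyBdd.mono (hlst.small_out.reindex fun p : {p : I × ℕ // p.2 < k p.1} => p.1.1)
        fun p => Data.list_drop_size_le _ _
    have hs2 : Small (fun p : {p : I × ℕ // p.2 < k p.1} => σ p.1.1)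
        (fun p => A p.1.1 (min p.1.2 (l p.1.1).length)) :=
      hA.reindex fun p : {p : I × ℕ // p.2 < k p.1} =>
        ⟨(p.1.1, min p.1.2 (l p.1.1).length), by simp⟩
    have hs3 := hcnt.small_in.reindex fun p : {p : I × ℕ // p.2 < k p.1} => p.1.1
    have hs := (hs1.pair hs2).pair hs3
    refine Runs.ite (b := fun p => if (l p.1.1).length ≤ p.1.2 then 1 else 0)
      (Runs.straight' hs rfl fun p => ?_) ?_ ?_
    · split_ifs with h
      · simp [Prog.ev, Op.apply, Prog.var, List.drop_eq_nil_of_le h, Data.list]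
      · rw [List.drop_eq_getElem_cons (by omega)]
        simp [Prog.ev, Op.apply, Prog.var, Data.list]
    · refine Runs.straight' (hs.reindex _) rfl fun p => ?_
      have h : (l p.1.1.1).length ≤ p.1.1.2 := by
        by_contra h; exact p.2 (if_neg h)
      simp only [Prog.ev, Op.apply, Prog.var]
      rw [List.drop_eq_nil_of_le h, List.drop_eq_nil_of_le (by omega), min_eq_right h,
        min_eq_right (by omega)]
    · have hlt : ∀ p : {p : {p : I × ℕ // p.2 < k p.1} //
          (if (l p.1.1).length ≤ p.1.2 then (1 : ℤ) else 0) = 0}, p.1.1.2 < (l p.1.1.1).length := by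
        intro p
        by_contra h
        have := p.2
        rw [if_pos (by omega)] at this
        exact one_ne_zero this
      have h1 := hbody.reindex (fun p : {p : {p : I × ℕ // p.2 < k p.1} //
          (if (l p.1.1).length ≤ p.1.2 then (1 : ℤ) else 0) = 0} =>
            (⟨p.1.1, hlt p⟩ : {p : I × ℕ // p.2 < (l p.1).length}))
      refine ((Runs.straight' (y := fun p => Data.list ((l p.1.1.1).drop (p.1.1.2 + 1)))
        (hs.reindex _) rfl fun p => ?_).pair ((Runs.straight' (hs.reindex _) rfl fun p => ?_).comp
          h1)).congr fun p => ?_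
      · rw [List.drop_eq_getElem_cons (hlt p)]
        simp [Prog.ev, Op.apply, Prog.var, Data.list]
      · rw [List.drop_eq_getElem_cons (hlt p)]
        have := hlt p
        simp [Prog.ev, Op.apply, Prog.var, Data.list, Prog.tl, min_eq_left this.le]
      · have := hlt p
        simp only [Data.pair.injEq, true_and]
        rw [min_eq_left (by omega)]
  exact hloop.comp (Runs.op (o := .snd) hloop.small_out)

/-- A Gaussian integer as a value. -/
def gaussData (g : GaussianInt) : Data := .pair (.int g.re) (.int g.im)

namespace Prog

/-- The product of two Gaussian integers. -/
abbrev gmul (f g : Prog) : Prog :=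
  .pair (minus (times (fst f) (fst g)) (times (snd f) (snd g)))
    (plus (times (fst f) (snd g)) (times (snd f) (fst g)))

/-- On `g, k`: the power `g ^ k` of a Gaussian integer. -/
def gpow : Prog := .loop (var 1) (.pair (cst 1) (cst 0)) (gmul (var 0) (var 1))

/-- On `k`: the power `2 ^ k`. -/
def twoPow : Prog := .loop (var 0) (cst 1) (times (cst 2) (var 0))

/-- On `k`: numerator and denominator of the `k`-th Wallis product, and `k`. -/
def wallis : Prog :=
  .loop (var 0) (.pair (.pair (cst 1) (cst 1)) (cst 0))
    (.pair (.pair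
      (times (fst (fst (var 0))) (times (plus (times (cst 2) (snd (var 0))) (cst 2))
        (plus (times (cst 2) (snd (var 0))) (cst 2))))
      (times (snd (fst (var 0))) (times (plus (times (cst 2) (snd (var 0))) (cst 1))
        (plus (times (cst 2) (snd (var 0))) (cst 3)))))
      (plus (snd (var 0)) (cst 1)))

/-- On `k, z, Z`: the pair of `cisNum k z Z` and `cisDen k Z`. -/
def cisProg : Prog :=
  .letin wallis <|
  .letin (times (times (var 1) (snd (fst (var 0)))) (var 3)) <|
  .letin (.comp gpow (.args [.pair (var 0) (times (times (cst 4) (fst (fst (var 1))))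
    (minus (var 3) (times (var 4) (quot (var 3) (var 4))))), var 2])) <|
  .letin (.comp gpow (.args [.pair (var 1) (cst 0), var 3])) <|
  .pair (var 1) (fst (var 0))

end Prog

theorem gauss_natAbs_pow_le (g : GaussianInt) (j : ℕ) :
    (g ^ j).re.natAbs + (g ^ j).im.natAbs ≤ (g.re.natAbs + g.im.natAbs) ^ j := by
  induction j with
  | zero => simp
  | succ j ih =>
    rw [pow_succ, Zsqrtd.re_mul, Zsqrtd.im_mul, pow_succ]
    refine le_trans ?_ (Nat.mul_le_mul_right _ ih)
    generalize (g ^ j).re = a; generalize (g ^ j).im = b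
    generalize g.re = c; generalize g.im = d
    have h1 : (a * c + -1 * b * d).natAbs ≤ a.natAbs * c.natAbs + b.natAbs * d.natAbs := by
      refine (Int.natAbs_add_le _ _).trans ?_
      simp [Int.natAbs_mul]
    have h2 : (a * d + b * c).natAbs ≤ a.natAbs * d.natAbs + b.natAbs * c.natAbs := by
      refine (Int.natAbs_add_le _ _).trans ?_
      simp [Int.natAbs_mul]
    nlinarith

section

variable {I : Type} {σ : I → ℕ}

theorem Small.gaussData_pow {g : I → GaussianInt} {k : I → ℕ}
    (hg : Small σ (fun i => gaussData (g i))) (hk : PolyBdd σ k) :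
    Small (fun p : {p : I × ℕ // p.2 < k p.1} => σ p.1.1)
      (fun p => gaussData (g p.1.1 ^ p.1.2)) := by
  have h : ∀ p : {p : I × ℕ // p.2 < k p.1},
      ((g p.1.1 ^ p.1.2).re.natAbs + (g p.1.1 ^ p.1.2).im.natAbs) ≤
      2 ^ ((gaussData (g p.1.1)).size * k p.1.1) := by
    intro p
    refine (gauss_natAbs_pow_le _ _).trans ?_
    rw [pow_mul]
    have h1 : (g p.1.1).re.natAbs + (g p.1.1).im.natAbs ≤ 2 ^ (gaussData (g p.1.1)).size := by
      have h1 := Nat.lt_size_self (g p.1.1).re.natAbs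
      have h2 := Nat.lt_size_self (g p.1.1).im.natAbs
      have h3 : 2 ^ (g p.1.1).re.natAbs.size ≤
          2 ^ ((g p.1.1).re.natAbs.size + (g p.1.1).im.natAbs.size) :=
        Nat.pow_le_pow_right (by norm_num) (by omega)
      have h4 : 2 ^ (g p.1.1).im.natAbs.size ≤
          2 ^ ((g p.1.1).re.natAbs.size + (g p.1.1).im.natAbs.size) :=
        Nat.pow_le_pow_right (by norm_num) (by omega)
      have h5 : 2 ^ ((g p.1.1).re.natAbs.size + (g p.1.1).im.natAbs.size + 1) ≤
          2 ^ (gaussData (g p.1.1)).size := by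
        refine Nat.pow_le_pow_right (by norm_num) ?_
        simp only [gaussData, Data.size]; omega
      rw [pow_succ] at h5
      omega
    calc _ ≤ (2 ^ (gaussData (g p.1.1)).size) ^ p.1.2 := Nat.pow_le_pow_left h1 _
      _ ≤ _ := Nat.pow_le_pow_right (by positivity) p.2.le
  have hb : PolyBdd (fun p : {p : I × ℕ // p.2 < k p.1} => σ p.1.1)
      (fun p => (gaussData (g p.1.1)).size * k p.1.1) :=
    (PolyBdd.mul hg hk).reindex _
  exact (Small.int_of_lt_two_pow hb fun p => le_trans (by omega) (h p)).pair
    (Small.int_of_lt_two_pow hb fun p => le_trans (by omega) (h p))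

theorem runs_gpow {g : I → GaussianInt} {k : I → ℕ}
    (hg : Small σ (fun i => gaussData (g i))) (hk : PolyBdd σ k) :
    Runs σ .gpow (fun i => .list [gaussData (g i), .nat (k i)])
      (fun i => gaussData (g i ^ k i)) := by
  have he : Small σ (fun i => Data.list [gaussData (g i), .nat (k i)]) :=
    hg.pair ((Small.nat hk).pair (Small.const _))
  refine Runs.loop (s := fun i j => gaussData (g i ^ j)) (Runs.straight' he rfl fun i => ?_)
    (Runs.straight' he rfl fun i => ?_) hk
    (Runs.straight' ((hg.gaussData_pow hk).pair (he.reindex _)) rfl fun p => ?_)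
  · simp [Prog.ev, Op.apply, Prog.var, Data.list]
  · simp [Prog.ev, Op.apply, gaussData]
  · simp [Prog.ev, Op.apply, Prog.var, Data.list, gaussData, Prog.bin, pow_succ, sub_eq_add_neg]

theorem runs_twoPow {e : I → Data} {k : I → ℕ} (hk : PolyBdd σ k) (he : Small σ e) :
    Runs σ .twoPow (fun i => .pair (.nat (k i)) (e i)) (fun i => .nat (2 ^ k i)) := by
  have he' : Small σ (fun i => Data.pair (.nat (k i)) (e i)) := (Small.nat hk).pair he
  have hs : Small (fun p : {p : I × ℕ // p.2 < k p.1} => σ p.1.1)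
      (fun p => Data.nat (2 ^ p.1.2)) :=
    Small.int_of_lt_two_pow (hk.reindex _) fun p => by
      simpa using Nat.pow_le_pow_right (by norm_num) p.2.le
  refine Runs.loop (s := fun i j => .nat (2 ^ j)) (Runs.straight' he' rfl fun i => ?_)
    (Runs.straight' he' rfl fun i => ?_) hk
    (Runs.straight' (hs.pair (he'.reindex _)) rfl fun p => ?_)
  · simp [Prog.ev, Op.apply, Prog.var]
  · simp [Prog.ev, Op.apply, Data.nat]
  · simp [Prog.ev, Op.apply, Prog.var, Prog.bin, Data.nat, pow_succ, mul_comm]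

theorem wallisPair_le (j k : ℕ) (hjk : j ≤ k) :
    (wallisPair j).1 ≤ (2 * k + 2) ^ (2 * j) ∧ (wallisPair j).2 ≤ (2 * k + 2) ^ (2 * j) := by
  induction j with
  | zero => simp [wallisPair]
  | succ j ih =>
    obtain ⟨h1, h2⟩ := ih (by omega)
    have e : (2 * k + 2) ^ (2 * (j + 1)) = (2 * k + 2) ^ (2 * j) * ((2 * k + 2) * (2 * k + 2)) := by
      ring
    rw [e]
    exact ⟨Nat.mul_le_mul h1 (Nat.mul_le_mul (by omega) (by omega)),
      Nat.mul_le_mul h2 (Nat.mul_le_mul (by omega) (by omega))⟩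

theorem runs_wallis {e : I → Data} {k : I → ℕ} (hk : PolyBdd σ k) (he : Small σ e) :
    Runs σ .wallis (fun i => .pair (.nat (k i)) (e i))
      (fun i => .pair (.pair (.nat (wallisPair (k i)).1) (.nat (wallisPair (k i)).2))
        (.nat (k i))) := by
  have he' : Small σ (fun i => Data.pair (.nat (k i)) (e i)) := (Small.nat hk).pair he
  have hb : PolyBdd (fun p : {p : I × ℕ // p.2 < k p.1} => σ p.1.1)
      (fun p => (2 * k p.1.1 + 2) * (2 * k p.1.1)) :=
    ((((PolyBdd.const 2).mul hk).add (PolyBdd.const 2)).mul ((PolyBdd.const 2).mul hk)).reindex _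
  have hw : ∀ p : {p : I × ℕ // p.2 < k p.1}, (2 * k p.1.1 + 2) ^ (2 * p.1.2) ≤
      2 ^ ((2 * k p.1.1 + 2) * (2 * k p.1.1)) := by
    intro p
    rw [pow_mul 2]
    calc _ ≤ (2 ^ (2 * k p.1.1 + 2)) ^ (2 * p.1.2) := Nat.pow_le_pow_left Nat.lt_two_pow_self.le _
      _ ≤ _ := Nat.pow_le_pow_right (by positivity) (by have := p.2; omega)
  have hs : Small (fun p : {p : I × ℕ // p.2 < k p.1} => σ p.1.1)
      (fun p => Data.pair (.pair (.nat (wallisPair p.1.2).1) (.nat (wallisPair p.1.2).2))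
        (.nat p.1.2)) := by
    refine ((Small.int_of_lt_two_pow hb fun p => ?_).pair
      (Small.int_of_lt_two_pow hb fun p => ?_)).pair
      (Small.int_of_le (hk.reindex fun p : {p : I × ℕ // p.2 < k p.1} => p.1.1) fun p => ?_)
    · simpa using (wallisPair_le _ _ p.2.le).1.trans (hw p)
    · simpa using (wallisPair_le _ _ p.2.le).2.trans (hw p)
    · simpa using p.2.le
  refine Runs.loop (s := fun i j => .pair (.pair (.nat (wallisPair j).1) (.nat (wallisPair j).2))
    (.nat j)) (Runs.straight' he' rfl fun i => ?_)
    (Runs.straight' he' rfl fun i => ?_) hk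
    (Runs.straight' (hs.pair (he'.reindex _)) rfl fun p => ?_)
  · simp [Prog.ev, Op.apply, Prog.var]
  · simp [Prog.ev, Op.apply, Data.nat, wallisPair]
  · simp [Prog.ev, Op.apply, Prog.var, Prog.bin, Data.nat, wallisPair]

theorem runs_cisProg {k : I → ℕ} {z : I → ℤ} {Z : I → ℕ} (hk : PolyBdd σ k)
    (hz : Small σ (fun i => .int (z i))) (hZ : Small σ (fun i => .nat (Z i))) :
    Runs σ .cisProg (fun i => .list [.nat (k i), .int (z i), .nat (Z i)])
      (fun i => .pair (gaussData (cisNum (k i) (z i) (Z i))) (.nat (cisDen (k i) (Z i)))) := by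
  have h1 := runs_wallis hk (hz.pair (hZ.pair (Small.const (.int 0))))
  refine Runs.letin h1 ?_
  have s1 := h1.small_out.pair h1.small_in
  have h2 : Runs σ (.times (.times (.var 1) (.snd (.fst (.var 0)))) (.var 3)) _
      (fun i => .nat (k i * (wallisPair (k i)).2 * Z i)) :=
    Runs.straight' s1 rfl fun i => by
      simp [Prog.ev, Op.apply, Prog.var, Prog.bin, Data.nat]
  refine Runs.letin h2 ?_
  have s2 := h2.small_out.pair s1
  have h3 : Runs σ (.args [.pair (.var 0) (.times (.times (.cst 4) (.fst (.fst (.var 1))))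
    (.minus (.var 3) (.times (.var 4) (.quot (.var 3) (.var 4))))), .var 2]) _
      (fun i => .list [gaussData ⟨k i * (wallisPair (k i)).2 * Z i,
        4 * (wallisPair (k i)).1 * (z i % Z i)⟩, .nat (k i)]) :=
    Runs.straight' s2 rfl fun i => by
      simp [Prog.ev, Op.apply, Prog.var, Prog.bin, Data.nat, Prog.args, Data.list, gaussData,
        Int.emod_def]
  have h4 := h3.comp (runs_gpow h3.small_out.fst hk)
  refine Runs.letin h4 ?_
  have s4 := h4.small_out.pair s2
  have h5 : Runs σ (.args [.pair (.var 1) (.cst 0), .var 3]) _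
      (fun i => .list [gaussData ((k i * (wallisPair (k i)).2 * Z i : ℕ) : GaussianInt),
        .nat (k i)]) :=
    Runs.straight' s4 rfl fun i => by
      simp [Prog.ev, Op.apply, Prog.var, Data.nat, Prog.args, Data.list, gaussData]
  have h6 := h5.comp (runs_gpow h5.small_out.fst hk)
  refine Runs.letin h6 ?_
  refine Runs.straight' (h6.small_out.pair s4) rfl fun i => ?_
  simp only [Prog.ev, Op.apply, Prog.var, cisNum, cisDen, gaussData, ← Nat.cast_pow, Data.nat,
    Zsqrtd.re_natCast]

end

/-! ### Folds over lists -/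

namespace Prog

/-- The sum of the results of `body` over the first `cnt` entries of `lst`; `body` sees the current
entry in front of the environment. -/
def sum (cnt lst body : Prog) : Prog :=
  fold cnt lst (cst 0) (plus (var 1) (.comp body (.pair (var 0) (tl 2))))

end Prog

theorem Data.size_list_le {l : List Data} {b : ℕ} (h : ∀ d ∈ l, d.size ≤ b) :
    (Data.list l).size ≤ 1 + l.length * (1 + b) := by
  induction l with
  | nil => simp [Data.list, Data.size]
  | cons a l ih =>
    have h1 := ih fun d hd => h d (by simp [hd])
    have h2 := h a (by simp)
    simp only [Data.list, Data.size, List.length_cons]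
    rw [Nat.succ_mul]; omega

section

variable {I α β : Type} {σ : I → ℕ}

theorem Small.list {l : I → List α} {enc : I → α → Data} (hlen : PolyBdd σ fun i => (l i).length)
    (h : Small (fun p : {p : I × α // p.2 ∈ l p.1} => σ p.1.1) (fun p => enc p.1.1 p.1.2)) :
    Small σ (fun i => .list ((l i).map (enc i))) := by
  obtain ⟨c, hc⟩ := h
  have h1 : PolyBdd σ fun i => (σ i + 2) ^ c := (PolyBdd.param.add (PolyBdd.const 2)).pow c
  refine ((PolyBdd.const 1).add (hlen.mul ((PolyBdd.const 1).add h1))).mono fun i => ?_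
  have := Data.size_list_le (l := (l i).map (enc i)) (b := (σ i + 2) ^ c) fun d hd => by
    obtain ⟨a, ha, rfl⟩ := List.mem_map.mp hd
    exact hc ⟨(i, a), ha⟩
  simpa using this

theorem Small.of_mem_map {l : I → List α} {enc : I → α → Data}
    (h : Small σ (fun i => .list ((l i).map (enc i)))) :
    Small (fun p : {p : I × α // p.2 ∈ l p.1} => σ p.1.1) (fun p => enc p.1.1 p.1.2) := by
  refine PolyBdd.mono (h.reindex fun p : {p : I × α // p.2 ∈ l p.1} => p.1.1) fun p => ?_
  obtain ⟨j, hj, he⟩ := List.getElem_of_mem p.2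
  have := Data.size_getElem_le ((l p.1.1).map (enc p.1.1)) j (by simpa using hj)
  simpa [he] using this

/-- A fold computing `List.foldl`, given that the accumulator stays small. -/
theorem Runs.foldl {e : I → Data} {cnt lst init body : Prog} {k : I → ℕ}
    {l : I → List α} {enc : I → α → Data} {encB : I → β → Data} {F : I → β → α → β} {b : I → β}
    (hcnt : Runs σ cnt e (fun i => .nat (k i)))
    (hlst : Runs σ lst e (fun i => .list ((l i).map (enc i))))
    (hinit : Runs σ init e (fun i => encB i (b i))) (hk : PolyBdd σ k)
    (hA : Small (fun p : {p : I × ℕ // p.2 ≤ (l p.1).length} => σ p.1.1)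
      (fun p => encB p.1.1 (((l p.1.1).take p.1.2).foldl (F p.1.1) (b p.1.1))))
    (hbody : Runs (fun p : {p : I × ℕ // p.2 < (l p.1).length} => σ p.1.1) body
      (fun p => .pair (enc p.1.1 ((l p.1.1)[p.1.2]'p.2))
        (.pair (encB p.1.1 (((l p.1.1).take p.1.2).foldl (F p.1.1) (b p.1.1))) (e p.1.1)))
      (fun p => encB p.1.1 (F p.1.1 (((l p.1.1).take p.1.2).foldl (F p.1.1) (b p.1.1))
        ((l p.1.1)[p.1.2]'p.2)))) :
    Runs σ (.fold cnt lst init body) e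
      (fun i => encB i (((l i).take (k i)).foldl (F i) (b i))) := by
  have := Runs.fold (l := fun i => (l i).map (enc i))
    (A := fun i j => encB i (((l i).take j).foldl (F i) (b i))) hcnt hlst
    (hinit.congr fun i => by simp) hk
    (hA.reindex fun p : {p : I × ℕ // p.2 ≤ ((l p.1).map (enc p.1)).length} =>
      (⟨p.1, by simpa using p.2⟩ : {p : I × ℕ // p.2 ≤ (l p.1).length}))
    (((hbody.reindex fun p : {p : I × ℕ // p.2 < ((l p.1).map (enc p.1)).length} =>
      (⟨p.1, by simpa using p.2⟩ : {p : I × ℕ // p.2 < (l p.1).length})).congr_in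
        fun p => by simp).congr fun p => by
          have hp : p.1.2 < (l p.1.1).length := by simpa using p.2
          rw [List.take_succ_eq_append_getElem hp, List.foldl_append]
          simp)
  refine this.congr fun i => ?_
  simp only [List.length_map]
  rcases le_total (k i) (l i).length with h | h
  · rw [min_eq_left h]
  · rw [min_eq_right h, List.take_of_length_le h, List.take_length]

theorem natAbs_sum_le (l : List ℤ) (b : ℕ) (h : ∀ z ∈ l, z.natAbs ≤ b) :
    l.sum.natAbs ≤ l.length * b := by
  induction l with
  | nil => simp
  | cons a l ih =>
    have h1 := ih fun d hd => h d (by simp [hd])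
    have h2 := h a (by simp)
    simp only [List.sum_cons, List.length_cons]
    have := Int.natAbs_add_le a l.sum
    rw [Nat.succ_mul]; omega

theorem foldl_add_eq_sum (l : List α) (f : α → ℤ) (z : ℤ) :
    l.foldl (fun s a => s + f a) z = z + (l.map f).sum := by
  induction l generalizing z with
  | nil => simp
  | cons a l ih => simp [ih, add_assoc]

theorem Runs.sum {e : I → Data} {cnt lst body : Prog} {l : I → List α} {enc : I → α → Data}
    {f : I → α → ℤ} (hcnt : Runs σ cnt e (fun i => .nat (l i).length))
    (hlst : Runs σ lst e (fun i => .list ((l i).map (enc i))))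
    (hk : PolyBdd σ fun i => (l i).length)
    (hbody : Runs (fun p : {p : I × α // p.2 ∈ l p.1} => σ p.1.1) body
      (fun p => .pair (enc p.1.1 p.1.2) (e p.1.1)) (fun p => .int (f p.1.1 p.1.2))) :
    Runs σ (.sum cnt lst body) e (fun i => .int ((l i).map (f i)).sum) := by
  obtain ⟨c, hc⟩ := hbody.small_out
  have h1 : PolyBdd σ fun i => (σ i + 2) ^ c := (PolyBdd.param.add (PolyBdd.const 2)).pow c
  have hA : Small (fun p : {p : I × ℕ // p.2 ≤ (l p.1).length} => σ p.1.1)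
      (fun p => Data.int (((l p.1.1).take p.1.2).foldl (fun s a => s + f p.1.1 a) 0)) := by
    refine Small.int_of_lt_two_pow ((hk.add h1).reindex
      fun p : {p : I × ℕ // p.2 ≤ (l p.1).length} => p.1.1) fun p => ?_
    rw [foldl_add_eq_sum, zero_add]
    refine (natAbs_sum_le _ (2 ^ ((σ p.1.1 + 2) ^ c)) fun z hz => ?_).trans ?_
    · obtain ⟨a, ha, rfl⟩ := List.mem_map.mp hz
      have := hc ⟨(p.1.1, a), List.mem_of_mem_take ha⟩
      simp only [Data.size] at this
      exact (Nat.lt_size_self _).le.trans (Nat.pow_le_pow_right (by norm_num) (by omega))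
    · rw [pow_add]
      refine Nat.mul_le_mul_right _ ?_
      simp only [List.length_map, List.length_take]
      exact (min_le_right _ _).trans Nat.lt_two_pow_self.le
  have he := hcnt.small_in
  have hhead : Small (fun p : {p : I × ℕ // p.2 < (l p.1).length} => σ p.1.1)
      (fun p => enc p.1.1 ((l p.1.1)[p.1.2]'p.2)) :=
    (Small.of_mem_map hlst.small_out).reindex fun p : {p : I × ℕ // p.2 < (l p.1).length} =>
      (⟨(p.1.1, (l p.1.1)[p.1.2]'p.2), List.getElem_mem _⟩ : {p : I × α // p.2 ∈ l p.1})
  have hacc := hA.reindex fun p : {p : I × ℕ // p.2 < (l p.1).length} =>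
      (⟨p.1, p.2.le⟩ : {p : I × ℕ // p.2 ≤ (l p.1).length})
  have hs := hhead.pair
    (hacc.pair (he.reindex fun p : {p : I × ℕ // p.2 < (l p.1).length} => p.1.1))
  have hb := hbody.reindex fun p : {p : I × ℕ // p.2 < (l p.1).length} =>
      (⟨(p.1.1, (l p.1.1)[p.1.2]'p.2), List.getElem_mem _⟩ : {p : I × α // p.2 ∈ l p.1})
  have h2 : Runs (fun p : {p : I × ℕ // p.2 < (l p.1).length} => σ p.1.1)
      (.pair (.var 0) (.tl 2)) _ (fun p => .pair (enc p.1.1 ((l p.1.1)[p.1.2]'p.2)) (e p.1.1)) :=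
    Runs.straight' hs rfl fun p => by simp [Prog.ev, Prog.var, Prog.tl, Op.apply]
  have h3 : Runs (fun p : {p : I × ℕ // p.2 < (l p.1).length} => σ p.1.1) (.var 1) _
      (fun p => Data.int (((l p.1.1).take p.1.2).foldl (fun s a => s + f p.1.1 a) 0)) :=
    Runs.straight' hs rfl fun p => by simp [Prog.ev, Prog.var, Op.apply]
  refine (Runs.foldl (k := fun i => (l i).length) (encB := fun _ z => .int z)
    (F := fun i s a => s + f i a) (b := fun _ => 0) hcnt hlst
    (Runs.straight' he rfl fun i => rfl) hk hA ((h3.bin (h2.comp hb)).congr fun p => ?_)).congr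
    fun i => ?_
  · rfl
  · rw [List.take_length, foldl_add_eq_sum, zero_add]

end

/-! ### The estimators as programs -/

/-- What the deterministic part of the algorithm works with: the number `n` of qubits, the
description `inst` of the state, the answers `qv` of amplitude queries, the accuracy parameter `W`,
and the list `smp` of `K` samples. -/
structure Ctx where
  n : ℕ
  inst : Data
  qv : ℕ → GaussianInt × ℕ
  W : ℕ
  K : ℕ
  smp : List (ℕ × ℕ)

namespace Ctx

/-- The precision of amplitude queries and of sampling, in bits. -/
def k (c : Ctx) : ℕ := c.n + c.W + 8
/-- The precision of the approximations of `exp`. -/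
def kap (c : Ctx) : ℕ := 4096 * c.W
/-- The fixed-point unit of the estimators. -/
def B (c : Ctx) : ℕ := 64 * c.W
/-- The greatest number of candidates that are examined on each level. -/
def cap (c : Ctx) : ℕ := 2 * c.W
/-- The size parameter in which running times are polynomial. -/
def sz (c : Ctx) : ℕ := c.n + c.W + c.K

end Ctx

/-- An amplitude, given by a Gaussian integer and a denominator, as a value. -/
def codeData (a : GaussianInt × ℕ) : Data := .pair (gaussData a.1) (.nat a.2)

/-- The amplitude `(1 - i) ^ n / 2 ^ n`, of modulus `2 ^ (-n / 2)`. It stands in for the amplitude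
`2 ^ (-n / 2)` of the uniform superposition, which is irrational for odd `n`. -/
def flatAmp (n : ℕ) : GaussianInt × ℕ := (⟨1, -1⟩ ^ n, 2 ^ n)

/-- A sample as a value. -/
def sampleData (p : ℕ × ℕ) : Data := .pair (.nat p.1) (.nat p.2)

/-- The parameters as a list of values. -/
def Ctx.params (c : Ctx) : List Data :=
  [.nat (2 ^ c.n), .nat c.n, c.inst, .nat c.k, .nat c.kap, .nat c.B, .nat c.K, .nat c.cap,
    codeData (flatAmp c.n)]

/-- The environment of the deterministic part: the samples as entry `0`, and the parameters
`2 ^ n`, `n`, `inst`, `k`, `kap`, `B`, `K`, `cap`, `flatAmp n` as entries `1` to `9`. -/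
def Ctx.env (c : Ctx) : Data := .pair (.list (c.smp.map sampleData)) (.list c.params)

/-- The contexts `V` are those on which `Q` answers amplitude queries in polynomial time. -/
structure Admissible (Q : Prog) (V : Ctx → Prop) : Prop where
  length : ∀ c, V c → c.smp.length = c.K
  lt : ∀ c, V c → ∀ p ∈ c.smp, p.1 < 2 ^ c.n ∧ p.2 < 2 ^ c.n
  inst : Small (fun c : {c // V c} => c.1.sz) (fun c => c.1.inst)
  query : Runs (fun p : {p : Ctx × ℕ // V p.1 ∧ p.2 < 2 ^ p.1.n} => p.1.1.sz) Q
    (fun p => .pair (.pair p.1.1.inst (.nat p.1.2)) (.nat p.1.1.k))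
    (fun p => codeData (p.1.1.qv p.1.2))

/-- The fixed-point value, in units of `1 / B`, of `overlapRatio α β (exp (2 π i z / Z))`. The
denominators of `α` and `β` are cleared crosswise. -/
def estVal (c : Ctx) (α β : GaussianInt × ℕ) (z : ℤ) (Z : ℕ) : ℤ :=
  let a : GaussianInt := ⟨α.1.re * β.2, α.1.im * β.2⟩
  let b : GaussianInt := ⟨β.1.re * α.2, β.1.im * α.2⟩
  let e := cisNum c.kap z Z
  (c.B * (2 * ((a.re * b.re + a.im * b.im) * e.re - (a.re * b.im - a.im * b.re) * e.im))) /
    ((a.re * a.re + a.im * a.im + (b.re * b.re + b.im * b.im)) * cisDen c.kap Z)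

/-- The contribution of the sample `(x, r)` to the estimate of the weight on the residue class of
`a` modulo `2 ^ n / q`. -/
def weightTerm (c : Ctx) (s : ℤ) (a q : ℕ) (p : ℕ × ℕ) : ℤ :=
  estVal c (c.qv p.1) (c.qv ((p.1 + p.2 * q) % 2 ^ c.n)) (s * a * (p.2 * q)) (2 ^ c.n)

/-- The estimate of the weight on a residue class, in units of `1 / (K B)`. -/
def weightSum (c : Ctx) (s : ℤ) (a q : ℕ) : ℤ := (c.smp.map (weightTerm c s a q)).sum

/-- The contribution of the label `x` to the estimate of the Fourier coefficient at `y`, multiplied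
by `i ^ (-off / 2)`: for `off = 2` its real part is the imaginary part of the coefficient. The term
`- n 2 ^ n` compensates the phase of `flatAmp`. -/
def ampTerm (c : Ctx) (s : ℤ) (y off x : ℕ) : ℤ :=
  estVal c (flatAmp c.n) (c.qv x) (8 * s * x * y - c.n * 2 ^ c.n - off * 2 ^ c.n) (8 * 2 ^ c.n)

/-- The estimate of the real part (`off = 0`) or the imaginary part (`off = 2`) of the Fourier
coefficient at `y`, in units of `1 / (2 K B)`. -/
def ampSum (c : Ctx) (s : ℤ) (y off : ℕ) : ℤ :=
  (c.smp.map fun p => ampTerm c s y off p.1 + ampTerm c s y off p.2).sum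

namespace Prog

/-- Environment: `α, β, z, Z`, then that of the context. -/
def estProg : Prog :=
  .letin (.comp cisProg (.args [var 9, var 2, var 3])) <|
  .letin (.pair (times (fst (fst (var 1))) (snd (var 2)))
    (times (snd (fst (var 1))) (snd (var 2)))) <|
  .letin (.pair (times (fst (fst (var 3))) (snd (var 2)))
    (times (snd (fst (var 3))) (snd (var 2)))) <|
  quot (times (var 13) (times (cst 2) (minus
      (times (plus (times (fst (var 1)) (fst (var 0))) (times (snd (var 1)) (snd (var 0))))
        (fst (fst (var 2))))
      (times (minus (times (fst (var 1)) (snd (var 0))) (times (snd (var 1)) (fst (var 0))))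
        (snd (fst (var 2)))))))
    (times (plus
      (plus (times (fst (var 1)) (fst (var 1))) (times (snd (var 1)) (snd (var 1))))
      (plus (times (fst (var 0)) (fst (var 0))) (times (snd (var 0)) (snd (var 0)))))
      (snd (var 2)))

/-- The answer to the amplitude query at `x`, in an environment with `d` entries before that of the
context. -/
def query (Q : Prog) (d : ℕ) (x : Prog) : Prog :=
  .comp Q (.pair (.pair (var (d + 3)) x) (var (d + 4)))

/-- Environment: `(x, r), a, q`, then that of the context. -/
def weightTermProg (Q : Prog) (s : ℤ) : Prog :=
  .letin (times (snd (var 0)) (var 2)) <|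
  .letin (plus (fst (var 1)) (var 0)) <|
  .letin (query Q 5 (fst (var 2))) <|
  .letin (query Q 6 (minus (var 1) (times (var 7) (quot (var 1) (var 7))))) <|
  .comp estProg (.pair (var 1) (.pair (var 0)
    (.pair (times (times (cst s) (var 5)) (var 3)) (.pair (var 8) (tl 7)))))

/-- Environment: `a, q`, then that of the context. -/
def weightProg (Q : Prog) (s : ℤ) : Prog := sum (var 9) (var 2) (weightTermProg Q s)

/-- Environment: `x, y, off`, then that of the context. -/
def ampTermProg (Q : Prog) (s : ℤ) : Prog :=
  .letin (query Q 3 (var 0)) <|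
  .comp estProg (.pair (var 13) (.pair (var 0)
    (.pair (minus (minus (times (times (times (cst 8) (cst s)) (var 1)) (var 2))
      (times (var 6) (var 5))) (times (var 3) (var 5)))
      (.pair (times (cst 8) (var 5)) (tl 4)))))

/-- Environment: `y, off`, then that of the context. -/
def ampProg (Q : Prog) (s : ℤ) : Prog :=
  sum (var 9) (var 2) (plus
    (.comp (ampTermProg Q s) (.pair (fst (var 0)) (tl 1)))
    (.comp (ampTermProg Q s) (.pair (snd (var 0)) (tl 1))))

end Prog

section

variable {Q : Prog} {V : Ctx → Prop} {I : Type} {τ : I → ℕ} {c : I → {c // V c}}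

theorem Admissible.small_params (hV : Admissible Q V) (hτ : PolyBdd τ fun i => (c i).1.sz) :
    Small τ (fun i => .list (c i).1.params) := by
  have hn : PolyBdd τ fun i => (c i).1.n := hτ.mono fun i => by simp only [Ctx.sz]; omega
  have hW : PolyBdd τ fun i => (c i).1.W := hτ.mono fun i => by simp only [Ctx.sz]; omega
  have hK : PolyBdd τ fun i => (c i).1.K := hτ.mono fun i => by simp only [Ctx.sz]; omega
  have hN : Small τ (fun i => .nat (2 ^ (c i).1.n)) := Small.int_of_lt_two_pow hn fun i => by simp
  have hg : ∀ i, ((⟨1, -1⟩ : GaussianInt) ^ (c i).1.n).re.natAbs +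
      ((⟨1, -1⟩ : GaussianInt) ^ (c i).1.n).im.natAbs ≤ 2 ^ (c i).1.n := fun i => by
    simpa using gauss_natAbs_pow_le ⟨1, -1⟩ (c i).1.n
  have hflat : Small τ (fun i => codeData (flatAmp (c i).1.n)) :=
    ((Small.int_of_lt_two_pow hn fun i => by
        have := hg i; simp only [flatAmp]; omega).pair
      (Small.int_of_lt_two_pow hn fun i => by
        have := hg i; simp only [flatAmp]; omega)).pair hN
  exact hN.pair ((Small.nat hn).pair ((hV.inst.comap hτ).pair
    ((Small.nat ((hn.add hW).add (.const 8))).pair ((Small.nat ((PolyBdd.const _).mul hW)).pair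
    ((Small.nat ((PolyBdd.const _).mul hW)).pair ((Small.nat hK).pair
    ((Small.nat ((PolyBdd.const _).mul hW)).pair (hflat.pair (Small.const _)))))))))

theorem Admissible.small_env (hV : Admissible Q V) (hτ : PolyBdd τ fun i => (c i).1.sz) :
    Small τ (fun i => (c i).1.env) := by
  have hn : PolyBdd τ fun i => (c i).1.n := hτ.mono fun i => by simp only [Ctx.sz]; omega
  have hK : PolyBdd τ fun i => (c i).1.K := hτ.mono fun i => by simp only [Ctx.sz]; omega
  refine Small.pair (Small.list (hK.mono fun i => (hV.length _ (c i).2).le) ?_)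
    (hV.small_params hτ)
  have hn' := hn.reindex fun p : {p : I × (ℕ × ℕ) // p.2 ∈ (c p.1).1.smp} => p.1.1
  exact (Small.int_of_lt_two_pow hn' fun p => by
      simpa using (hV.lt _ (c p.1.1).2 _ p.2).1.le).pair
    (Small.int_of_lt_two_pow hn' fun p => by
      simpa using (hV.lt _ (c p.1.1).2 _ p.2).2.le)

theorem runs_estProg (hτ : PolyBdd τ fun i => (c i).1.sz)
    {α β : I → GaussianInt × ℕ} {z : I → ℤ} {Z : I → ℕ}
    (hs : Small τ (fun i => .pair (codeData (α i)) (.pair (codeData (β i)) (.pair (.int (z i))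
      (.pair (.nat (Z i)) (c i).1.env))))) :
    Runs τ .estProg (fun i => .pair (codeData (α i)) (.pair (codeData (β i)) (.pair (.int (z i))
      (.pair (.nat (Z i)) (c i).1.env))))
      (fun i => .int (estVal (c i).1 (α i) (β i) (z i) (Z i))) := by
  have hW : PolyBdd τ fun i => (c i).1.W := hτ.mono fun i => by simp only [Ctx.sz]; omega
  have h1 : Runs τ (.args [.var 9, .var 2, .var 3]) _
      (fun i => .list [.nat (c i).1.kap, .int (z i), .nat (Z i)]) :=
    Runs.straight' hs rfl fun i => by
      simp [Prog.ev, Op.apply, Prog.var, Prog.args, Data.list, Ctx.env, Ctx.params]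
  have h2 := h1.comp (runs_cisProg ((PolyBdd.const 4096).mul hW) hs.snd.snd.fst
    hs.snd.snd.snd.fst)
  refine Runs.letin h2 ?_
  have s2 := h2.small_out.pair hs
  have h3 : Runs τ (.pair (.times (.fst (.fst (.var 1))) (.snd (.var 2)))
      (.times (.snd (.fst (.var 1))) (.snd (.var 2)))) _
      (fun i => gaussData ⟨(α i).1.re * (β i).2, (α i).1.im * (β i).2⟩) :=
    Runs.straight' s2 rfl fun i => by
      simp [Prog.ev, Op.apply, Prog.var, Prog.bin, codeData, gaussData, Data.nat]
  refine Runs.letin h3 ?_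
  have s3 := h3.small_out.pair s2
  have h4 : Runs τ (.pair (.times (.fst (.fst (.var 3))) (.snd (.var 2)))
      (.times (.snd (.fst (.var 3))) (.snd (.var 2)))) _
      (fun i => gaussData ⟨(β i).1.re * (α i).2, (β i).1.im * (α i).2⟩) :=
    Runs.straight' s3 rfl fun i => by
      simp [Prog.ev, Op.apply, Prog.var, Prog.bin, codeData, gaussData, Data.nat]
  refine Runs.letin h4 ?_
  have s4 := h4.small_out.pair s3
  refine Runs.straight' s4 rfl fun i => ?_
  simp only [Prog.ev, Op.apply, Prog.var, Prog.bin, gaussData, Data.nat, Ctx.env, Ctx.params,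
    Data.list, estVal]

theorem Admissible.runs_query (hV : Admissible Q V) (hτ : PolyBdd τ fun i => (c i).1.sz)
    {d : ℕ} {p : Prog} {e : I → Data} {x : I → ℕ} (hx : ∀ i, x i < 2 ^ (c i).1.n)
    (hp : Runs τ p e (fun i => .nat (x i)))
    (h1 : Runs τ (.var (d + 3)) e (fun i => (c i).1.inst))
    (h2 : Runs τ (.var (d + 4)) e (fun i => .nat (c i).1.k)) :
    Runs τ (.query Q d p) e (fun i => codeData ((c i).1.qv (x i))) :=
  ((h1.pair hp).pair h2).comp (hV.query.comap (φ := fun i =>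
    (⟨((c i).1, x i), (c i).2, hx i⟩ : {p : Ctx × ℕ // V p.1 ∧ p.2 < 2 ^ p.1.n})) hτ)

theorem Admissible.runs_weightTermProg (hV : Admissible Q V) (hτ : PolyBdd τ fun i => (c i).1.sz)
    {s : ℤ} {a q : I → ℕ} {p : I → ℕ × ℕ} (hp : ∀ i, (p i).1 < 2 ^ (c i).1.n)
    (hs : Small τ (fun i => .pair (sampleData (p i)) (.pair (.nat (a i)) (.pair (.nat (q i))
      (c i).1.env)))) :
    Runs τ (.weightTermProg Q s) (fun i => .pair (sampleData (p i)) (.pair (.nat (a i))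
      (.pair (.nat (q i)) (c i).1.env)))
      (fun i => .int (weightTerm (c i).1 s (a i) (q i) (p i))) := by
  have h1 : Runs τ (.times (.snd (.var 0)) (.var 2)) _ (fun i => .nat ((p i).2 * q i)) :=
    Runs.straight' hs rfl fun i => by
      simp [Prog.ev, Op.apply, Prog.var, Prog.bin, sampleData, Data.nat]
  refine Runs.letin h1 ?_
  have s1 := h1.small_out.pair hs
  have h2 : Runs τ (.plus (.fst (.var 1)) (.var 0)) _ (fun i => .nat ((p i).1 + (p i).2 * q i)) :=
    Runs.straight' s1 rfl fun i => by
      simp [Prog.ev, Op.apply, Prog.var, Prog.bin, sampleData, Data.nat]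
  refine Runs.letin h2 ?_
  have s2 := h2.small_out.pair s1
  have h3 := hV.runs_query hτ (d := 5) hp
    (Runs.straight' (P := .fst (.var 2)) s2 rfl fun i => by
      simp [Prog.ev, Op.apply, Prog.var, sampleData])
    (Runs.straight' s2 rfl fun i => by
      simp [Prog.ev, Op.apply, Prog.var, Ctx.env, Ctx.params, Data.list])
    (Runs.straight' s2 rfl fun i => by
      simp [Prog.ev, Op.apply, Prog.var, Ctx.env, Ctx.params, Data.list])
  refine Runs.letin h3 ?_
  have s3 := h3.small_out.pair s2
  have h4 := hV.runs_query hτ (d := 6)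
    (x := fun i => ((p i).1 + (p i).2 * q i) % 2 ^ (c i).1.n)
    (fun i => Nat.mod_lt _ (by positivity))
    (Runs.straight' (P := .minus (.var 1) (.times (.var 7) (.quot (.var 1) (.var 7)))) s3 rfl
      fun i => by
        simp [Prog.ev, Op.apply, Prog.var, Prog.bin, Ctx.env, Ctx.params, Data.list, Data.nat,
          Int.emod_def])
    (Runs.straight' s3 rfl fun i => by
      simp [Prog.ev, Op.apply, Prog.var, Ctx.env, Ctx.params, Data.list])
    (Runs.straight' s3 rfl fun i => by
      simp [Prog.ev, Op.apply, Prog.var, Ctx.env, Ctx.params, Data.list])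
  refine Runs.letin h4 ?_
  have s4 := h4.small_out.pair s3
  have h5 : Runs τ (.pair (.var 1) (.pair (.var 0)
      (.pair (.times (.times (.cst s) (.var 5)) (.var 3)) (.pair (.var 8) (.tl 7))))) _
      (fun i => .pair (codeData ((c i).1.qv (p i).1))
        (.pair (codeData ((c i).1.qv (((p i).1 + (p i).2 * q i) % 2 ^ (c i).1.n)))
        (.pair (.int (s * a i * ((p i).2 * q i))) (.pair (.nat (2 ^ (c i).1.n)) (c i).1.env)))) :=
    Runs.straight' s4 rfl fun i => by
      simp [Prog.ev, Op.apply, Prog.var, Prog.bin, Prog.tl, Ctx.env, Ctx.params, Data.list,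
        Data.nat]
  exact h5.comp (runs_estProg hτ h5.small_out)

theorem Admissible.runs_weightProg (hV : Admissible Q V) (hτ : PolyBdd τ fun i => (c i).1.sz)
    {s : ℤ} {a q : I → ℕ}
    (hs : Small τ (fun i => .pair (.nat (a i)) (.pair (.nat (q i)) (c i).1.env))) :
    Runs τ (.weightProg Q s) (fun i => .pair (.nat (a i)) (.pair (.nat (q i)) (c i).1.env))
      (fun i => .int (weightSum (c i).1 s (a i) (q i))) := by
  have hK : PolyBdd τ fun i => (c i).1.K := hτ.mono fun i => by simp only [Ctx.sz]; omega
  have hsmp : Runs τ (.var 2) _ (fun i => Data.list ((c i).1.smp.map sampleData)) :=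
    Runs.straight' hs rfl fun i => by simp [Prog.ev, Op.apply, Prog.var, Ctx.env]
  refine Runs.sum (Runs.straight' hs rfl fun i => ?_) hsmp
    (hK.mono fun i => (hV.length _ (c i).2).le) ?_
  · simp [Prog.ev, Op.apply, Prog.var, Ctx.env, Ctx.params, Data.list, hV.length _ (c i).2]
  · exact hV.runs_weightTermProg (c := fun p : {p : I × (ℕ × ℕ) // p.2 ∈ (c p.1).1.smp} => c p.1.1)
      (hτ.reindex fun p : {p : I × (ℕ × ℕ) // p.2 ∈ (c p.1).1.smp} => p.1.1)
      (fun p => (hV.lt _ (c p.1.1).2 _ p.2).1)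
      ((Small.of_mem_map hsmp.small_out).pair
        (hs.reindex fun p : {p : I × (ℕ × ℕ) // p.2 ∈ (c p.1).1.smp} => p.1.1))

theorem Admissible.runs_ampTermProg (hV : Admissible Q V) (hτ : PolyBdd τ fun i => (c i).1.sz)
    {s : ℤ} {x y off : I → ℕ} (hx : ∀ i, x i < 2 ^ (c i).1.n)
    (hs : Small τ (fun i => .pair (.nat (x i)) (.pair (.nat (y i)) (.pair (.nat (off i))
      (c i).1.env)))) :
    Runs τ (.ampTermProg Q s) (fun i => .pair (.nat (x i)) (.pair (.nat (y i))
      (.pair (.nat (off i)) (c i).1.env)))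
      (fun i => .int (ampTerm (c i).1 s (y i) (off i) (x i))) := by
  have h3 := hV.runs_query hτ (d := 3) hx
    (Runs.straight' (P := .var 0) hs rfl fun i => by simp [Prog.ev, Op.apply, Prog.var])
    (Runs.straight' hs rfl fun i => by
      simp [Prog.ev, Op.apply, Prog.var, Ctx.env, Ctx.params, Data.list])
    (Runs.straight' hs rfl fun i => by
      simp [Prog.ev, Op.apply, Prog.var, Ctx.env, Ctx.params, Data.list])
  refine Runs.letin h3 ?_
  have s3 := h3.small_out.pair hs
  have h5 : Runs τ (.pair (.var 13) (.pair (.var 0)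
    (.pair (.minus (.minus (.times (.times (.times (.cst 8) (.cst s)) (.var 1)) (.var 2))
      (.times (.var 6) (.var 5))) (.times (.var 3) (.var 5)))
      (.pair (.times (.cst 8) (.var 5)) (.tl 4))))) _
      (fun i => .pair (codeData (flatAmp (c i).1.n)) (.pair (codeData ((c i).1.qv (x i)))
        (.pair (.int (8 * s * x i * y i - (c i).1.n * 2 ^ (c i).1.n - off i * 2 ^ (c i).1.n))
        (.pair (.nat (8 * 2 ^ (c i).1.n)) (c i).1.env)))) :=
    Runs.straight' s3 rfl fun i => by
      simp [Prog.ev, Op.apply, Prog.var, Prog.bin, Prog.tl, Ctx.env, Ctx.params, Data.list,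
        Data.nat]
  exact h5.comp (runs_estProg hτ h5.small_out)

theorem Admissible.runs_ampProg (hV : Admissible Q V) (hτ : PolyBdd τ fun i => (c i).1.sz)
    {s : ℤ} {y off : I → ℕ}
    (hs : Small τ (fun i => .pair (.nat (y i)) (.pair (.nat (off i)) (c i).1.env))) :
    Runs τ (.ampProg Q s) (fun i => .pair (.nat (y i)) (.pair (.nat (off i)) (c i).1.env))
      (fun i => .int (ampSum (c i).1 s (y i) (off i))) := by
  have hK : PolyBdd τ fun i => (c i).1.K := hτ.mono fun i => by simp only [Ctx.sz]; omega
  have hsmp : Runs τ (.var 2) _ (fun i => Data.list ((c i).1.smp.map sampleData)) :=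
    Runs.straight' hs rfl fun i => by simp [Prog.ev, Op.apply, Prog.var, Ctx.env]
  refine Runs.sum (Runs.straight' hs rfl fun i => ?_) hsmp
    (hK.mono fun i => (hV.length _ (c i).2).le) ?_
  · simp [Prog.ev, Op.apply, Prog.var, Ctx.env, Ctx.params, Data.list, hV.length _ (c i).2]
  · have s1 := (Small.of_mem_map hsmp.small_out).pair
      (hs.reindex fun p : {p : I × (ℕ × ℕ) // p.2 ∈ (c p.1).1.smp} => p.1.1)
    have hτ' := hτ.reindex fun p : {p : I × (ℕ × ℕ) // p.2 ∈ (c p.1).1.smp} => p.1.1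
    have h1 : Runs _ (.pair (.fst (.var 0)) (.tl 1)) _
        (fun p : {p : I × (ℕ × ℕ) // p.2 ∈ (c p.1).1.smp} => .pair (.nat p.1.2.1)
          (.pair (.nat (y p.1.1)) (.pair (.nat (off p.1.1)) (c p.1.1).1.env))) :=
      Runs.straight' s1 rfl fun p => by simp [Prog.ev, Op.apply, Prog.var, Prog.tl, sampleData]
    have h2 : Runs _ (.pair (.snd (.var 0)) (.tl 1)) _
        (fun p : {p : I × (ℕ × ℕ) // p.2 ∈ (c p.1).1.smp} => .pair (.nat p.1.2.2)
          (.pair (.nat (y p.1.1)) (.pair (.nat (off p.1.1)) (c p.1.1).1.env))) :=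
      Runs.straight' s1 rfl fun p => by simp [Prog.ev, Op.apply, Prog.var, Prog.tl, sampleData]
    have hlt : ∀ p : {p : I × (ℕ × ℕ) // p.2 ∈ (c p.1).1.smp},
        p.1.2.1 < 2 ^ (c p.1.1).1.n ∧ p.1.2.2 < 2 ^ (c p.1.1).1.n :=
      fun p => hV.lt _ (c p.1.1).2 _ p.2
    have h3 := h1.comp (hV.runs_ampTermProg (s := s) hτ' (fun p => (hlt p).1) h1.small_out)
    have h4 := h2.comp (hV.runs_ampTermProg (s := s) hτ' (fun p => (hlt p).2) h2.small_out)
    exact h3.bin h4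

end

/-! ### The search for heavy residue classes as a program -/

/-- A list of natural numbers as a value. -/
def natList (l : List ℕ) : Data := .list (l.map .nat)

/-- The empirical weight of the residue class of `b` modulo `2 ^ n / q` is at least `3 / (4 W)`.
In units of `1 / (K B)`, where `B = 64 W`, this is `48 K`. -/
def Heavy (c : Ctx) (s : ℤ) (q b : ℕ) : Prop := (48 * c.K : ℤ) ≤ weightSum c s b q

instance (c : Ctx) (s : ℤ) (q b : ℕ) : Decidable (Heavy c s q b) :=
  inferInstanceAs (Decidable ((48 * c.K : ℤ) ≤ weightSum c s b q))

/-- Keep `b` if it is heavy. -/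
def push (c : Ctx) (s : ℤ) (q : ℕ) (acc : List ℕ) (b : ℕ) : List ℕ :=
  if Heavy c s q b then b :: acc else acc

/-- Keep the heavy ones among the two residues modulo `2 M` that refine the residue `a`. -/
def pushBoth (c : Ctx) (s : ℤ) (q M : ℕ) (acc : List ℕ) (a : ℕ) : List ℕ :=
  push c s q (push c s q acc a) (a + M)

/-- The heavy refinements of the first `cap` residues of a list. -/
def levelList (c : Ctx) (s : ℤ) (q M : ℕ) (l : List ℕ) : List ℕ :=
  (l.take c.cap).foldl (pushBoth c s q M) []

/-- The candidate residues modulo `2 ^ m`. -/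
def treeList (c : Ctx) (s : ℤ) : ℕ → List ℕ
  | 0 => [0]
  | m + 1 => levelList c s (2 ^ (c.n - (m + 1))) (2 ^ m) (treeList c s m)

namespace Prog

/-- Environment: `b, acc, q`, then that of the context. -/
def pushProg (Q : Prog) (s : ℤ) : Prog :=
  .ite (leq (times (cst 48) (var 10)) (.comp (weightProg Q s) (.pair (var 0) (tl 2))))
    (.pair (var 0) (var 1)) (var 1)

/-- Environment: `a, acc, q, M, l`, then that of the context. -/
def pushBothProg (Q : Prog) (s : ℤ) : Prog :=
  .letin (.comp (pushProg Q s) (.pair (var 0) (.pair (var 1) (.pair (var 2) (tl 5))))) <|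
  .comp (pushProg Q s) (.pair (plus (var 1) (var 4)) (.pair (var 0) (.pair (var 3) (tl 6))))

/-- Environment: `q, M, l`, then that of the context. -/
def levelProg (Q : Prog) (s : ℤ) : Prog := fold (var 11) (var 2) (cst 0) (pushBothProg Q s)

/-- Environment: `(l, (q, M))`, then that of the context. -/
def treeStep (Q : Prog) (s : ℤ) : Prog :=
  .pair (.comp (levelProg Q s) (.pair (quot (fst (snd (var 0))) (cst 2))
      (.pair (snd (snd (var 0))) (.pair (fst (var 0)) (tl 1)))))
    (.pair (quot (fst (snd (var 0))) (cst 2)) (times (cst 2) (snd (snd (var 0)))))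

/-- Environment: that of the context. -/
def treeProg (Q : Prog) (s : ℤ) : Prog :=
  fst (.loop (var 2) (.pair (.pair (cst 0) (cst 0)) (.pair (var 1) (cst 1))) (treeStep Q s))

end Prog

theorem length_push_le (c : Ctx) (s : ℤ) (q : ℕ) (acc : List ℕ) (b : ℕ) :
    (push c s q acc b).length ≤ acc.length + 1 := by
  unfold push; split_ifs <;> simp

theorem mem_push {c : Ctx} {s : ℤ} {q : ℕ} {acc : List ℕ} {b d : ℕ} :
    d ∈ push c s q acc b ↔ d ∈ acc ∨ (d = b ∧ Heavy c s q b) := by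
  unfold push; split_ifs with h <;> simp [h, or_comm]

theorem length_foldl_pushBoth_le (c : Ctx) (s : ℤ) (q M : ℕ) (l acc : List ℕ) :
    (l.foldl (pushBoth c s q M) acc).length ≤ acc.length + 2 * l.length := by
  induction l generalizing acc with
  | nil => simp
  | cons a l ih =>
    have h1 := ih (pushBoth c s q M acc a)
    have h2 := length_push_le c s q (push c s q acc a) (a + M)
    have h3 := length_push_le c s q acc a
    simp only [List.foldl_cons, List.length_cons]
    unfold pushBoth at *
    omega

theorem mem_foldl_pushBoth {c : Ctx} {s : ℤ} {q M : ℕ} {l acc : List ℕ} {d : ℕ} :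
    d ∈ l.foldl (pushBoth c s q M) acc ↔
      d ∈ acc ∨ (Heavy c s q d ∧ ∃ a ∈ l, d = a ∨ d = a + M) := by
  induction l generalizing acc with
  | nil => simp
  | cons a l ih =>
    rw [List.foldl_cons, ih, pushBoth, mem_push, mem_push]
    constructor
    · rintro (((h | ⟨rfl, h⟩) | ⟨rfl, h⟩) | ⟨h, b, hb, hd⟩)
      · exact Or.inl h
      · exact Or.inr ⟨h, _, by simp, Or.inl rfl⟩
      · exact Or.inr ⟨h, _, by simp, Or.inr rfl⟩
      · exact Or.inr ⟨h, b, by simp [hb], hd⟩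
    · rintro (h | ⟨h, b, hb, hd⟩)
      · exact Or.inl (Or.inl (Or.inl h))
      · rcases List.mem_cons.mp hb with rfl | hb
        · rcases hd with rfl | rfl
          · exact Or.inl (Or.inl (Or.inr ⟨rfl, h⟩))
          · exact Or.inl (Or.inr ⟨rfl, h⟩)
        · exact Or.inr ⟨h, b, hb, hd⟩

theorem nodup_foldl_pushBoth {c : Ctx} {s : ℤ} {q M : ℕ} {l acc : List ℕ} (hl : l.Nodup)
    (hacc : acc.Nodup) (hM : ∀ a ∈ l, a < M) (hd : ∀ a ∈ l, a ∉ acc ∧ a + M ∉ acc) :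
    (l.foldl (pushBoth c s q M) acc).Nodup := by
  induction l generalizing acc with
  | nil => simpa
  | cons a l ih =>
    rw [List.foldl_cons]
    obtain ⟨hal, hl⟩ := List.nodup_cons.mp hl
    have ha := hM a (by simp)
    have h1 := hd a (by simp)
    have hpush : ∀ (acc : List ℕ) b, acc.Nodup → b ∉ acc → (push c s q acc b).Nodup := by
      intro acc b h1 h2
      unfold push; split_ifs
      · exact List.nodup_cons.mpr ⟨h2, h1⟩
      · exact h1
    refine ih hl (hpush _ _ (hpush _ _ hacc h1.1) ?_) (fun b hb => hM b (by simp [hb])) ?_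
    · rw [mem_push]
      rintro (h | ⟨h, -⟩)
      · exact h1.2 h
      · omega
    · intro b hb
      have hbM := hM b (by simp [hb])
      have hne : b ≠ a := fun h => hal (h ▸ hb)
      have h2 := hd b (by simp [hb])
      rw [pushBoth, mem_push, mem_push, mem_push, mem_push]
      refine ⟨?_, ?_⟩
      · rintro ((h | ⟨h, -⟩) | ⟨h, -⟩)
        · exact h2.1 h
        · exact hne h
        · omega
      · rintro ((h | ⟨h, -⟩) | ⟨h, -⟩)
        · exact h2.2 h
        · omega
        · omega

theorem lt_of_mem_treeList {c : Ctx} {s : ℤ} {m a : ℕ} (h : a ∈ treeList c s m) : a < 2 ^ m := by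
  induction m generalizing a with
  | zero => simp [treeList] at h; simp [h]
  | succ m ih =>
    rw [treeList, levelList, mem_foldl_pushBoth] at h
    obtain h | ⟨-, b, hb, h⟩ := h
    · simp at h
    · have := ih (List.mem_of_mem_take hb)
      rw [pow_succ]; omega

theorem nodup_treeList (c : Ctx) (s : ℤ) (m : ℕ) : (treeList c s m).Nodup := by
  induction m with
  | zero => simp [treeList]
  | succ m ih =>
    exact nodup_foldl_pushBoth (ih.sublist (List.take_sublist _ _)) List.nodup_nil
      (fun a ha => lt_of_mem_treeList (List.mem_of_mem_take ha)) (by simp)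

theorem length_treeList_le (c : Ctx) (s : ℤ) (m : ℕ) :
    (treeList c s m).length ≤ 2 * c.cap + 1 := by
  cases m with
  | zero => simp [treeList]
  | succ m =>
    refine (length_foldl_pushBoth_le _ _ _ _ _ _).trans ?_
    simp only [List.length_nil, List.length_take]
    omega

section

variable {Q : Prog} {V : Ctx → Prop} {I : Type} {τ : I → ℕ} {c : I → {c // V c}}

theorem Small.natList {l : I → List ℕ} {b : I → ℕ} (hlen : PolyBdd τ fun i => (l i).length)
    (hb : PolyBdd τ b) (h : ∀ i, ∀ a ∈ l i, a ≤ 2 ^ b i) : Small τ (fun i => natList (l i)) :=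
  Small.list (enc := fun _ => Data.nat) hlen
    (Small.int_of_lt_two_pow (hb.reindex fun p : {p : I × ℕ // p.2 ∈ l p.1} => p.1.1)
      fun p => by simpa using h _ _ p.2)

theorem Admissible.runs_pushProg (hV : Admissible Q V) (hτ : PolyBdd τ fun i => (c i).1.sz)
    {s : ℤ} {b q : I → ℕ} {acc : I → List ℕ}
    (hs : Small τ (fun i => .pair (.nat (b i)) (.pair (natList (acc i)) (.pair (.nat (q i))
      (c i).1.env)))) :
    Runs τ (.pushProg Q s) (fun i => .pair (.nat (b i)) (.pair (natList (acc i))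
      (.pair (.nat (q i)) (c i).1.env)))
      (fun i => natList (push (c i).1 s (q i) (acc i) (b i))) := by
  have h1 : Runs τ (.pair (.var 0) (.tl 2)) _
      (fun i => .pair (.nat (b i)) (.pair (.nat (q i)) (c i).1.env)) :=
    Runs.straight' hs rfl fun i => by simp [Prog.ev, Op.apply, Prog.var, Prog.tl]
  have h2 := h1.comp (hV.runs_weightProg (s := s) hτ h1.small_out)
  have h3 : Runs τ (.times (.cst 48) (.var 10)) _ (fun i => .int (48 * (c i).1.K)) :=
    Runs.straight' hs rfl fun i => by
      simp [Prog.ev, Op.apply, Prog.var, Prog.bin, Ctx.env, Ctx.params, Data.list, Data.nat]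
  refine Runs.ite (b := fun i => if Heavy (c i).1 s (q i) (b i) then 1 else 0)
    ((h3.bin h2).congr fun i => ?_)
    (Runs.straight' (hs.reindex fun p : {i // (if Heavy (c i).1 s (q i) (b i) then (1 : ℤ) else 0)
      ≠ 0} => p.1) rfl fun p => ?_)
    (Runs.straight' (hs.reindex fun p : {i // (if Heavy (c i).1 s (q i) (b i) then (1 : ℤ) else 0)
      = 0} => p.1) rfl fun p => ?_)
  · simp only [Op.apply]; rfl
  · have : Heavy (c p.1).1 s (q p.1) (b p.1) := by
      by_contra h; exact p.2 (if_neg h)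
    simp [Prog.ev, Op.apply, Prog.var, push, this, natList, Data.list]
  · have : ¬ Heavy (c p.1).1 s (q p.1) (b p.1) := by
      intro h; have := p.2; rw [if_pos h] at this; exact one_ne_zero this
    simp [Prog.ev, Op.apply, Prog.var, push, this]

theorem Admissible.runs_pushBothProg (hV : Admissible Q V) (hτ : PolyBdd τ fun i => (c i).1.sz)
    {s : ℤ} {a q M : I → ℕ} {acc : I → List ℕ} {l : I → Data}
    (hs : Small τ (fun i => .pair (.nat (a i)) (.pair (natList (acc i)) (.pair (.nat (q i))
      (.pair (.nat (M i)) (.pair (l i) (c i).1.env)))))) :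
    Runs τ (.pushBothProg Q s) (fun i => .pair (.nat (a i)) (.pair (natList (acc i))
      (.pair (.nat (q i)) (.pair (.nat (M i)) (.pair (l i) (c i).1.env)))))
      (fun i => natList (pushBoth (c i).1 s (q i) (M i) (acc i) (a i))) := by
  have h1 : Runs τ (.pair (.var 0) (.pair (.var 1) (.pair (.var 2) (.tl 5)))) _
      (fun i => .pair (.nat (a i)) (.pair (natList (acc i)) (.pair (.nat (q i)) (c i).1.env))) :=
    Runs.straight' hs rfl fun i => by simp [Prog.ev, Op.apply, Prog.var, Prog.tl]
  have h2 := h1.comp (hV.runs_pushProg (s := s) hτ h1.small_out)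
  refine Runs.letin h2 ?_
  have s2 := h2.small_out.pair hs
  have h3 : Runs τ (.pair (.plus (.var 1) (.var 4)) (.pair (.var 0) (.pair (.var 3) (.tl 6)))) _
      (fun i => .pair (.nat (a i + M i)) (.pair (natList (push (c i).1 s (q i) (acc i) (a i)))
        (.pair (.nat (q i)) (c i).1.env))) :=
    Runs.straight' s2 rfl fun i => by
      simp [Prog.ev, Op.apply, Prog.var, Prog.bin, Prog.tl, Data.nat]
  exact h3.comp (hV.runs_pushProg (s := s) hτ h3.small_out)

theorem Admissible.runs_levelProg (hV : Admissible Q V) (hτ : PolyBdd τ fun i => (c i).1.sz)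
    {s : ℤ} {q M : I → ℕ} {l : I → List ℕ} (hl : ∀ i, ∀ a ∈ l i, a ≤ 2 ^ (c i).1.n)
    (hM : ∀ i, M i ≤ 2 ^ (c i).1.n) (hlen : PolyBdd τ fun i => (l i).length)
    (hs : Small τ (fun i => .pair (.nat (q i)) (.pair (.nat (M i)) (.pair (natList (l i))
      (c i).1.env)))) :
    Runs τ (.levelProg Q s) (fun i => .pair (.nat (q i)) (.pair (.nat (M i))
      (.pair (natList (l i)) (c i).1.env)))
      (fun i => natList (levelList (c i).1 s (q i) (M i) (l i))) := by
  have hW : PolyBdd τ fun i => (c i).1.W := hτ.mono fun i => by simp only [Ctx.sz]; omega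
  have hn : PolyBdd τ fun i => (c i).1.n := hτ.mono fun i => by simp only [Ctx.sz]; omega
  have hA : Small (fun p : {p : I × ℕ // p.2 ≤ (l p.1).length} => τ p.1.1)
      (fun p => natList (((l p.1.1).take p.1.2).foldl
        (pushBoth (c p.1.1).1 s (q p.1.1) (M p.1.1)) [])) := by
    refine Small.natList
      ((((PolyBdd.const 2).mul hlen).reindex
        fun p : {p : I × ℕ // p.2 ≤ (l p.1).length} => p.1.1).mono fun p => ?_)
      ((hn.add (.const 1)).reindex fun p : {p : I × ℕ // p.2 ≤ (l p.1).length} => p.1.1)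
      fun p a ha => ?_
    · refine (length_foldl_pushBoth_le _ _ _ _ _ _).trans ?_
      simp only [List.length_nil, List.length_take]
      have := p.2
      omega
    · rw [mem_foldl_pushBoth] at ha
      obtain h | ⟨-, b, hb, h⟩ := ha
      · simp at h
      · have h1 := hl _ _ (List.mem_of_mem_take hb)
        have h2 := hM p.1.1
        rw [pow_succ]; omega
  have hlst : Runs τ (.var 2) _ (fun i => Data.list ((l i).map Data.nat)) :=
    Runs.straight' hs rfl fun i => by simp [Prog.ev, Op.apply, Prog.var, natList]
  refine Runs.foldl (encB := fun _ => natList) (b := fun _ => [])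
    (F := fun i => pushBoth (c i).1 s (q i) (M i)) (enc := fun _ => Data.nat)
    (k := fun i => (c i).1.cap) (Runs.straight' hs rfl fun i => ?_) hlst
    (Runs.straight' hs rfl fun i => ?_) ((PolyBdd.const 2).mul hW) hA ?_
  · simp [Prog.ev, Op.apply, Prog.var, Ctx.env, Ctx.params, Data.list]
  · rfl
  · refine hV.runs_pushBothProg (c := fun p : {p : I × ℕ // p.2 < (l p.1).length} => c p.1.1)
      (hτ.reindex fun p : {p : I × ℕ // p.2 < (l p.1).length} => p.1.1) ?_
    refine Small.pair ?_ (Small.pair ?_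
      (hs.reindex fun p : {p : I × ℕ // p.2 < (l p.1).length} => p.1.1))
    · exact (Small.of_mem_map hlst.small_out).reindex
        fun p : {p : I × ℕ // p.2 < (l p.1).length} =>
          (⟨(p.1.1, (l p.1.1)[p.1.2]'p.2), List.getElem_mem _⟩ : {p : I × ℕ // p.2 ∈ l p.1})
    · exact hA.reindex fun p : {p : I × ℕ // p.2 < (l p.1).length} =>
        (⟨p.1, p.2.le⟩ : {p : I × ℕ // p.2 ≤ (l p.1).length})

theorem Admissible.runs_treeProg (hV : Admissible Q V) (hτ : PolyBdd τ fun i => (c i).1.sz)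
    {s : ℤ} : Runs τ (.treeProg Q s) (fun i => (c i).1.env)
      (fun i => natList (treeList (c i).1 s (c i).1.n)) := by
  have hW : PolyBdd τ fun i => (c i).1.W := hτ.mono fun i => by simp only [Ctx.sz]; omega
  have hn : PolyBdd τ fun i => (c i).1.n := hτ.mono fun i => by simp only [Ctx.sz]; omega
  have he := hV.small_env hτ
  set J := {p : I × ℕ // p.2 < (c p.1).1.n}
  have hτJ := hτ.reindex fun p : J => p.1.1
  have hnJ := hn.reindex fun p : J => p.1.1
  have hlenJ : PolyBdd (fun p : J => τ p.1.1)
      (fun p => (treeList (c p.1.1).1 s p.1.2).length) :=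
    (((PolyBdd.const 2).mul ((PolyBdd.const 2).mul hW)).add (.const 1)).reindex
      (fun p : J => p.1.1) |>.mono fun p => length_treeList_le _ _ _
  have hle : ∀ p : J, 2 ^ p.1.2 ≤ 2 ^ (c p.1.1).1.n := fun p =>
    Nat.pow_le_pow_right (by norm_num) p.2.le
  have hmem : ∀ p : J, ∀ a ∈ treeList (c p.1.1).1 s p.1.2, a ≤ 2 ^ (c p.1.1).1.n :=
    fun p a ha => (lt_of_mem_treeList ha).le.trans (hle p)
  have hloop : Runs τ (.loop (.var 2) (.pair (.pair (.cst 0) (.cst 0)) (.pair (.var 1) (.cst 1)))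
      (.treeStep Q s)) (fun i => (c i).1.env)
      (fun i => .pair (natList (treeList (c i).1 s (c i).1.n))
        (.pair (.nat (2 ^ ((c i).1.n - (c i).1.n))) (.nat (2 ^ (c i).1.n)))) := by
    refine Runs.loop (s := fun i j => .pair (natList (treeList (c i).1 s j))
        (.pair (.nat (2 ^ ((c i).1.n - j))) (.nat (2 ^ j))))
      (Runs.straight' he rfl fun i => ?_) (Runs.straight' he rfl fun i => ?_) hn ?_
    · simp [Prog.ev, Op.apply, Prog.var, Ctx.env, Ctx.params, Data.list]
    · simp [Prog.ev, Op.apply, Prog.var, Ctx.env, Ctx.params, Data.list, natList, treeList,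
        Data.nat]
    · have s1 : Small (fun p : J => τ p.1.1) (fun p => Data.pair
          (.pair (natList (treeList (c p.1.1).1 s p.1.2))
            (.pair (.nat (2 ^ ((c p.1.1).1.n - p.1.2))) (.nat (2 ^ p.1.2)))) (c p.1.1).1.env) :=
        ((Small.natList hlenJ hnJ fun p a ha => hmem p a ha).pair
          ((Small.int_of_lt_two_pow hnJ fun p => by
              simpa using Nat.pow_le_pow_right (by norm_num) (Nat.sub_le _ _)).pair
            (Small.int_of_lt_two_pow hnJ fun p => by simpa using hle p))).pair
          (he.reindex fun p : J => p.1.1)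
      have hq : ∀ p : J, 2 ^ ((c p.1.1).1.n - p.1.2) = 2 * 2 ^ ((c p.1.1).1.n - (p.1.2 + 1)) :=
        fun p => by
          rw [← pow_succ']; congr 1; have := p.2; omega
      have h1 : Runs _ (.pair (.quot (.fst (.snd (.var 0))) (.cst 2))
          (.pair (.snd (.snd (.var 0))) (.pair (.fst (.var 0)) (.tl 1)))) _
          (fun p : J => .pair (.nat (2 ^ ((c p.1.1).1.n - (p.1.2 + 1)))) (.pair (.nat (2 ^ p.1.2))
            (.pair (natList (treeList (c p.1.1).1 s p.1.2)) (c p.1.1).1.env))) :=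
        Runs.straight' s1 rfl fun p => by
          simp [Prog.ev, Op.apply, Prog.var, Prog.bin, Prog.tl, Data.nat, hq]
      have h2 := h1.comp (hV.runs_levelProg (s := s) hτJ hmem hle hlenJ h1.small_out)
      refine h2.pair (Runs.straight' s1 rfl fun p => ?_)
      simp [Prog.ev, Op.apply, Prog.var, Prog.bin, Data.nat, hq, pow_succ, mul_comm]
  exact hloop.comp (Runs.op (o := .fst) hloop.small_out)

end

/-! ### Normalization as a program -/

/-- The estimate of the Fourier coefficient at `y`, in units of `1 / (2 K B)`. -/
def ampVec (c : Ctx) (s : ℤ) (y : ℕ) : GaussianInt := ⟨ampSum c s y 0, ampSum c s y 2⟩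

/-- The squared modulus of `ampVec`. -/
def ampSq (c : Ctx) (s : ℤ) (y : ℕ) : ℤ :=
  ampSum c s y 0 * ampSum c s y 0 + ampSum c s y 2 * ampSum c s y 2

/-- The sign of the real part of the estimate at `0`. -/
def zeroSign (c : Ctx) (s : ℤ) : ℤ := if 0 ≤ ampSum c s 0 0 then 1 else -1

/-- One plus the absolute value of the real part of the estimate at `0`, in units of
`1 / (2 K B)`; it is positive if `K` and `B` are. -/
def axis (c : Ctx) (s : ℤ) : ℤ := 2 * c.K * c.B + zeroSign c s * ampSum c s 0 0

/-- Collect the nonzero labels at which the estimate does not vanish, and add up the squared moduli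
of the estimates there. As the squared modulus is a nonnegative integer, one comparison tests both
conditions. -/
def collect (c : Ctx) (s : ℤ) (acc : List ℕ × ℤ) (y : ℕ) : List ℕ × ℤ :=
  if 1 ≤ y * ampSq c s y then (y :: acc.1, acc.2 + ampSq c s y) else acc

/-- The labels in the support of the output, apart from `0`, and the common denominator of the
output, starting from a list `L` of candidates. With the unit vector `u = ± |0⟩` and the estimated
vector `v`, the denominator is `‖v + u‖²` in units of `1 / (2 K B) ^ 2`. -/
def collected (c : Ctx) (s : ℤ) (L : List ℕ) : List ℕ × ℤ :=
  (L.take c.cap).foldl (collect c s) ([], axis c s * axis c s + ampSum c s 0 2 * ampSum c s 0 2)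

/-- The numerator of the output amplitude at `0`, for the common denominator `S`. -/
def zeroAmp (c : Ctx) (s S : ℤ) : GaussianInt :=
  ⟨2 * axis c s * (zeroSign c s * axis c s) - zeroSign c s * S, 2 * axis c s * ampSum c s 0 2⟩

/-- An entry of the output list. -/
def entryData (y : ℕ) (g : GaussianInt) (S : ℤ) : Data :=
  .pair (.nat y) (.pair (gaussData g) (.int S))

/-- The numerator of the output amplitude at a label other than `0`. -/
def outAmp (c : Ctx) (s : ℤ) (y : ℕ) : GaussianInt :=
  ⟨2 * axis c s * ampSum c s y 0, 2 * axis c s * ampSum c s y 2⟩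

/-- The part of the output list that belongs to the label `0`. -/
def zeroEntry (c : Ctx) (s S : ℤ) : List Data :=
  if 1 ≤ (zeroAmp c s S).re * (zeroAmp c s S).re + (zeroAmp c s S).im * (zeroAmp c s S).im then
    [entryData 0 (zeroAmp c s S) S] else []

/-- The output list, given the candidates `L`. -/
def outputList (c : Ctx) (s : ℤ) (L : List ℕ) : List Data :=
  (collected c s L).1.foldl (fun acc y => entryData y (outAmp c s y) (collected c s L).2 :: acc)
    (zeroEntry c s (collected c s L).2)

namespace Prog

/-- The estimate at the result of `y`, in an environment with `d` entries before that of the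
context. -/
def ampPair (Q : Prog) (s : ℤ) (d : ℕ) (y : Prog) : Prog :=
  .pair (.comp (ampProg Q s) (.pair y (.pair (cst 0) (tl d))))
    (.comp (ampProg Q s) (.pair y (.pair (cst 2) (tl d))))

/-- The squared modulus of a Gaussian integer. -/
abbrev gsq (f : Prog) : Prog := plus (times (fst f) (fst f)) (times (snd f) (snd f))

/-- Environment: `y`, the accumulator, four entries, then that of the context. -/
def collectProg (Q : Prog) (s : ℤ) : Prog :=
  .letin (ampPair Q s 6 (var 0)) <|
  .letin (gsq (var 0)) <|
  .ite (leq (cst 1) (times (var 2) (var 0)))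
    (.pair (.pair (.pair (var 2) (var 1)) (fst (var 3))) (plus (snd (var 3)) (var 0)))
    (var 3)

/-- Environment: the collected data, the axis, the sign and the estimate at `0`, then two more. -/
def zeroEntryProg : Prog :=
  .letin (.pair
    (minus (times (times (cst 2) (var 1)) (times (var 2) (var 1))) (times (var 2) (snd (var 0))))
    (times (times (cst 2) (var 1)) (snd (var 3)))) <|
  .ite (leq (cst 1) (gsq (var 0)))
    (.pair (.pair (cst 0) (.pair (var 0) (snd (var 1)))) (cst 0)) (cst 0)

/-- Environment: `(y, w)`, the accumulator, then that of `zeroEntryProg`. -/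
def entryProg : Prog :=
  .pair (.pair (fst (var 0))
    (.pair (.pair (times (times (cst 2) (var 3)) (fst (snd (var 0))))
      (times (times (cst 2) (var 3)) (snd (snd (var 0))))) (snd (var 2)))) (var 1)

/-- Environment: the candidates, then that of the context. -/
def outputProg (Q : Prog) (s : ℤ) : Prog :=
  .letin (ampPair Q s 1 (cst 0)) <|
  .letin (.ite (leq (cst 0) (fst (var 0))) (cst 1) (cst (-1))) <|
  .letin (plus (times (times (cst 2) (var 10)) (var 9)) (times (var 0) (fst (var 1)))) <|
  .letin (fold (var 12) (var 3) (.pair (cst 0)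
    (plus (times (var 0) (var 0)) (times (snd (var 2)) (snd (var 2))))) (collectProg Q s)) <|
  fold (var 13) (fst (var 0)) zeroEntryProg entryProg

end Prog

theorem foldl_collect (c : Ctx) (s : ℤ) (l : List ℕ) (a : List ℕ × ℤ) :
    l.foldl (collect c s) a = ((l.filter fun y => 1 ≤ y * ampSq c s y).reverse ++ a.1,
      a.2 + ((l.filter fun y => 1 ≤ y * ampSq c s y).map (ampSq c s)).sum) := by
  induction l generalizing a with
  | nil => simp
  | cons y l ih =>
    rw [List.foldl_cons, ih, collect]
    by_cases h : 1 ≤ y * ampSq c s y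
    · simp [h, add_assoc]
    · simp [h]

theorem outputList_eq (c : Ctx) (s : ℤ) (L : List ℕ) :
    outputList c s L = ((collected c s L).1.map
      fun y => entryData y (outAmp c s y) (collected c s L).2).reverse ++
      zeroEntry c s (collected c s L).2 := by
  unfold outputList
  generalize (collected c s L).1 = l
  generalize zeroEntry c s (collected c s L).2 = z
  induction l generalizing z with
  | nil => simp
  | cons y l ih => simp [ih]

section

variable {Q : Prog} {V : Ctx → Prop} {I : Type} {τ : I → ℕ} {c : I → {c // V c}}

theorem Admissible.runs_ampPair (hV : Admissible Q V) (hτ : PolyBdd τ fun i => (c i).1.sz)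
    {s : ℤ} {d : ℕ} {p : Prog} {e : I → Data} {y : I → ℕ} (hp : Runs τ p e (fun i => .nat (y i)))
    (ht : Runs τ (.tl d) e (fun i => (c i).1.env)) :
    Runs τ (.ampPair Q s d p) e (fun i => gaussData (ampVec (c i).1 s (y i))) := by
  have h1 : ∀ m : ℕ, Runs τ (.cst m) e (fun _ => .nat m) := fun m =>
    Runs.straight' hp.small_in rfl fun i => rfl
  have h2 := hp.pair ((h1 0).pair ht)
  have h3 := hp.pair ((h1 2).pair ht)
  exact (h2.comp (hV.runs_ampProg hτ h2.small_out)).pair (h3.comp (hV.runs_ampProg hτ h3.small_out))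

/-- The accumulator of `collect` as a value. -/
def collectData (c : Ctx) (s : ℤ) (a : List ℕ × ℤ) : Data :=
  .pair (.list (a.1.map fun y => .pair (.nat y) (gaussData (ampVec c s y)))) (.int a.2)

theorem Admissible.runs_collectProg (hV : Admissible Q V) (hτ : PolyBdd τ fun i => (c i).1.sz)
    {s : ℤ} {y : I → ℕ} {acc : I → List ℕ × ℤ} {e₁ e₂ e₃ e₄ : I → Data}
    (hs : Small τ (fun i => .pair (.nat (y i)) (.pair (collectData (c i).1 s (acc i))
      (.pair (e₁ i) (.pair (e₂ i) (.pair (e₃ i) (.pair (e₄ i) (c i).1.env))))))) :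
    Runs τ (.collectProg Q s) (fun i => .pair (.nat (y i)) (.pair (collectData (c i).1 s (acc i))
      (.pair (e₁ i) (.pair (e₂ i) (.pair (e₃ i) (.pair (e₄ i) (c i).1.env))))))
      (fun i => collectData (c i).1 s (collect (c i).1 s (acc i) (y i))) := by
  have h1 := hV.runs_ampPair (s := s) (d := 6) (p := .var 0) (y := y) hτ
    (Runs.straight' hs rfl fun i => by simp [Prog.ev, Op.apply, Prog.var])
    (Runs.straight' hs rfl fun i => by simp [Prog.ev, Op.apply, Prog.tl])
  refine Runs.letin h1 ?_
  have s1 := h1.small_out.pair hs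
  have h2 : Runs τ (.gsq (.var 0)) _ (fun i => .int (ampSq (c i).1 s (y i))) :=
    Runs.straight' s1 rfl fun i => by
      simp [Prog.ev, Op.apply, Prog.var, Prog.bin, gaussData, ampVec, ampSq]
  refine Runs.letin h2 ?_
  have s2 := h2.small_out.pair s1
  refine Runs.straight' s2 rfl fun i => ?_
  by_cases h : 1 ≤ (y i : ℤ) * ampSq (c i).1 s (y i)
  · simp [Prog.ev, Op.apply, Prog.var, Prog.bin, Data.nat, collectData, collect, h, Data.list]
  · simp [Prog.ev, Op.apply, Prog.var, Prog.bin, Data.nat, collectData, collect, h]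

theorem mem_collected {c : Ctx} {s : ℤ} {L : List ℕ} {y : ℕ} :
    y ∈ (collected c s L).1 ↔ y ∈ L.take c.cap ∧ 1 ≤ y * ampSq c s y := by
  rw [collected, foldl_collect]; simp

/-- The environment of the last steps of the algorithm. -/
def outEnv (c : Ctx) (s : ℤ) (L : List ℕ) : Data :=
  .pair (collectData c s (collected c s L)) (.pair (.int (axis c s)) (.pair (.int (zeroSign c s))
    (.pair (gaussData (ampVec c s 0)) (.pair (natList L) c.env))))

theorem runs_zeroEntryProg {s : ℤ} {L : I → List ℕ}
    (hs : Small τ (fun i => outEnv (c i).1 s (L i))) :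
    Runs τ .zeroEntryProg (fun i => outEnv (c i).1 s (L i))
      (fun i => .list (zeroEntry (c i).1 s (collected (c i).1 s (L i)).2)) := by
  have h1 : Runs τ (.pair
      (.minus (.times (.times (.cst 2) (.var 1)) (.times (.var 2) (.var 1)))
        (.times (.var 2) (.snd (.var 0))))
      (.times (.times (.cst 2) (.var 1)) (.snd (.var 3)))) (fun i => outEnv (c i).1 s (L i))
      (fun i => gaussData (zeroAmp (c i).1 s (collected (c i).1 s (L i)).2)) :=
    Runs.straight' hs rfl fun i => by
      simp [Prog.ev, Op.apply, Prog.var, Prog.bin, gaussData, ampVec, zeroAmp, outEnv, collectData]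
  refine Runs.letin h1 ?_
  refine Runs.straight' (h1.small_out.pair hs) rfl fun i => ?_
  simp only [Prog.ev, Op.apply, Prog.var, Prog.bin, gaussData, outEnv, collectData, zeroEntry]
  split_ifs <;> simp_all [Data.list, entryData, gaussData, Data.nat]

theorem Admissible.runs_outputProg (hV : Admissible Q V) (hτ : PolyBdd τ fun i => (c i).1.sz)
    {s : ℤ} {L : I → List ℕ} (hlen : PolyBdd τ fun i => (L i).length)
    (hs : Small τ (fun i => .pair (natList (L i)) (c i).1.env)) :
    Runs τ (.outputProg Q s) (fun i => .pair (natList (L i)) (c i).1.env)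
      (fun i => .list (outputList (c i).1 s (L i))) := by
  have hW : PolyBdd τ fun i => (c i).1.W := hτ.mono fun i => by simp only [Ctx.sz]; omega
  have hcap : PolyBdd τ fun i => (c i).1.cap := (PolyBdd.const 2).mul hW
  have h1 := hV.runs_ampPair (s := s) (d := 1) (p := .cst 0) (y := fun _ => 0) hτ
    (Runs.straight' hs rfl fun i => rfl)
    (Runs.straight' hs rfl fun i => by simp [Prog.ev, Op.apply, Prog.tl])
  refine Runs.letin h1 ?_
  have s1 := h1.small_out.pair hs
  have h2 : Runs τ (.ite (.leq (.cst 0) (.fst (.var 0))) (.cst 1) (.cst (-1))) _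
      (fun i => .int (zeroSign (c i).1 s)) :=
    Runs.straight' s1 rfl fun i => by
      simp only [Prog.ev, Op.apply, Prog.var, Prog.bin, gaussData, ampVec, zeroSign]
      split_ifs <;> simp_all
  refine Runs.letin h2 ?_
  have s2 := h2.small_out.pair s1
  have h3 : Runs τ (.plus (.times (.times (.cst 2) (.var 10)) (.var 9))
      (.times (.var 0) (.fst (.var 1)))) _ (fun i => .int (axis (c i).1 s)) :=
    Runs.straight' s2 rfl fun i => by
      simp [Prog.ev, Op.apply, Prog.var, Prog.bin, gaussData, ampVec, axis, Ctx.env, Ctx.params,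
        Data.list, Data.nat]
  refine Runs.letin h3 ?_
  have s3 := h3.small_out.pair s2
  -- The accumulator is a sum over candidates, so the estimates at all candidates must be small.
  have hL : Small (fun p : {p : I × ℕ // p.2 ∈ L p.1} => τ p.1.1) (fun p => Data.nat p.1.2) :=
    Small.of_mem_map (enc := fun _ => Data.nat) hs.fst
  have hw : Small (fun p : {p : I × ℕ // p.2 ∈ L p.1} => τ p.1.1)
      (fun p => gaussData (ampVec (c p.1.1).1 s p.1.2)) := by
    have hs' := hL.pair ((hV.small_env hτ).reindex fun p : {p : I × ℕ // p.2 ∈ L p.1} => p.1.1)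
    exact (hV.runs_ampPair (c := fun p : {p : I × ℕ // p.2 ∈ L p.1} => c p.1.1) (s := s) (d := 1)
      (p := .var 0) (y := fun p => p.1.2) (hτ.reindex _)
      (Runs.straight' hs' rfl fun i => by simp [Prog.ev, Op.apply, Prog.var])
      (Runs.straight' hs' rfl fun i => by simp [Prog.ev, Op.apply, Prog.tl])).small_out
  have hm : Small (fun p : {p : I × ℕ // p.2 ∈ L p.1} => τ p.1.1)
      (fun p => Data.int (ampSq (c p.1.1).1 s p.1.2)) :=
    (Runs.straight' (P := .gsq (.op .id)) hw rfl fun p => by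
      simp [Prog.ev, Op.apply, Prog.bin, gaussData, ampVec, ampSq]).small_out
  have hlst : Runs τ (.var 3) _ (fun i => Data.list ((L i).map Data.nat)) :=
    Runs.straight' s3 rfl fun i => by simp [Prog.ev, Op.apply, Prog.var, natList]
  have hinit : Runs τ (.pair (.cst 0)
      (.plus (.times (.var 0) (.var 0)) (.times (.snd (.var 2)) (.snd (.var 2))))) _
      (fun i => collectData (c i).1 s ([], axis (c i).1 s * axis (c i).1 s +
        ampSum (c i).1 s 0 2 * ampSum (c i).1 s 0 2)) :=
    Runs.straight' s3 rfl fun i => by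
      simp [Prog.ev, Op.apply, Prog.var, Prog.bin, gaussData, ampVec, collectData, Data.list]
  have hA : Small (fun p : {p : I × ℕ // p.2 ≤ (L p.1).length} => τ p.1.1)
      (fun p => collectData (c p.1.1).1 s (((L p.1.1).take p.1.2).foldl (collect (c p.1.1).1 s)
        ([], axis (c p.1.1).1 s * axis (c p.1.1).1 s +
        ampSum (c p.1.1).1 s 0 2 * ampSum (c p.1.1).1 s 0 2))) := by
    have hi := hinit.small_out.reindex fun p : {p : I × ℕ // p.2 ≤ (L p.1).length} => p.1.1
    have hlen' := hlen.reindex fun p : {p : I × ℕ // p.2 ≤ (L p.1).length} => p.1.1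
    simp only [foldl_collect]
    refine Small.pair (Small.list ?_ ?_) ?_
    · refine hlen'.mono fun p => ?_
      simp only [List.append_nil, List.length_reverse]
      exact (List.length_filter_le _ _).trans ((List.length_take_le' _ _))
    · exact (hL.pair hw).reindex (fun q : {q : {p : I × ℕ // p.2 ≤ (L p.1).length} × ℕ //
        q.2 ∈ (((L q.1.1.1).take q.1.1.2).filter fun y => 1 ≤ y * ampSq (c q.1.1.1).1 s y).reverse
          ++ []} => (⟨(q.1.1.1.1, q.1.2), by
            have hq := q.2
            simp only [List.append_nil, List.mem_reverse, List.mem_filter] at hq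
            exact List.mem_of_mem_take hq.1⟩ : {p : I × ℕ // p.2 ∈ L p.1}))
    · obtain ⟨d, hd⟩ := hm
      have hb : PolyBdd τ fun i => (τ i + 2) ^ d := (PolyBdd.param.add (PolyBdd.const 2)).pow d
      have hsum : Small (fun p : {p : I × ℕ // p.2 ≤ (L p.1).length} => τ p.1.1)
          (fun p => Data.int ((((L p.1.1).take p.1.2).filter
            fun y => 1 ≤ y * ampSq (c p.1.1).1 s y).map (ampSq (c p.1.1).1 s)).sum) := by
        refine Small.int_of_lt_two_pow ((hlen.add hb).reindex
          fun p : {p : I × ℕ // p.2 ≤ (L p.1).length} => p.1.1) fun p => ?_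
        refine (natAbs_sum_le _ (2 ^ ((τ p.1.1 + 2) ^ d)) fun z hz => ?_).trans ?_
        · obtain ⟨a, ha, rfl⟩ := List.mem_map.mp hz
          have := hd ⟨(p.1.1, a), List.mem_of_mem_take (List.mem_of_mem_filter ha)⟩
          simp only [Data.size] at this
          exact (Nat.lt_size_self _).le.trans (Nat.pow_le_pow_right (by norm_num) (by omega))
        · rw [pow_add]
          refine Nat.mul_le_mul_right _ ?_
          rw [List.length_map]
          exact ((List.length_filter_le _ _).trans (List.length_take_le' _ _)).trans
            Nat.lt_two_pow_self.le
      exact (Runs.straight' (P := .op .add) (hi.snd.pair hsum) rfl fun p => by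
        simp [Prog.ev, Op.apply]).small_out
  have h4 : Runs τ (.fold (.var 12) (.var 3) (.pair (.cst 0)
      (.plus (.times (.var 0) (.var 0)) (.times (.snd (.var 2)) (.snd (.var 2)))))
      (.collectProg Q s)) (fun i => .pair (.int (axis (c i).1 s)) (.pair (.int (zeroSign (c i).1 s))
        (.pair (gaussData (ampVec (c i).1 s 0)) (.pair (natList (L i)) (c i).1.env))))
      (fun i => collectData (c i).1 s (collected (c i).1 s (L i))) := by
    refine Runs.foldl (encB := fun i => collectData (c i).1 s)
      (F := fun i => collect (c i).1 s) (enc := fun _ => Data.nat)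
      (b := fun i => ([], axis (c i).1 s * axis (c i).1 s +
        ampSum (c i).1 s 0 2 * ampSum (c i).1 s 0 2))
      (k := fun i => (c i).1.cap) (Runs.straight' s3 rfl fun i => ?_) hlst hinit hcap hA ?_
    · simp [Prog.ev, Op.apply, Prog.var, Ctx.env, Ctx.params, Data.list]
    · refine hV.runs_collectProg (c := fun p : {p : I × ℕ // p.2 < (L p.1).length} => c p.1.1)
        (hτ.reindex fun p : {p : I × ℕ // p.2 < (L p.1).length} => p.1.1) ?_
      refine Small.pair ?_ (Small.pair ?_
        (s3.reindex fun p : {p : I × ℕ // p.2 < (L p.1).length} => p.1.1))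
      · exact hL.reindex fun p : {p : I × ℕ // p.2 < (L p.1).length} =>
          (⟨(p.1.1, (L p.1.1)[p.1.2]'p.2), List.getElem_mem _⟩ : {p : I × ℕ // p.2 ∈ L p.1})
      · exact hA.reindex fun p : {p : I × ℕ // p.2 < (L p.1).length} =>
          (⟨p.1, p.2.le⟩ : {p : I × ℕ // p.2 ≤ (L p.1).length})
  refine Runs.letin h4 ?_
  have s4 : Small τ (fun i => outEnv (c i).1 s (L i)) := h4.small_out.pair s3
  change Runs τ _ (fun i => outEnv (c i).1 s (L i)) _
  have h5 := runs_zeroEntryProg s4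
  have hlst2 : Runs τ (.fst (.var 0)) (fun i => outEnv (c i).1 s (L i))
      (fun i => Data.list ((collected (c i).1 s (L i)).1.map
        fun y => .pair (.nat y) (gaussData (ampVec (c i).1 s y)))) :=
    Runs.straight' s4 rfl fun i => by simp [Prog.ev, Op.apply, Prog.var, outEnv, collectData]
  have hle : ∀ i, (collected (c i).1 s (L i)).1.length ≤ (c i).1.cap := by
    intro i
    rw [collected, foldl_collect]
    simp only [List.append_nil, List.length_reverse]
    exact (List.length_filter_le _ _).trans (List.length_take_le _ _)
  set J := {p : I × ℕ // p.2 ∈ (collected (c p.1).1 s (L p.1)).1}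
  have hent : Small (fun p : J => τ p.1.1) (fun p => entryData p.1.2
      (outAmp (c p.1.1).1 s p.1.2) (collected (c p.1.1).1 s (L p.1.1)).2) := by
    have hp : Small (fun p : J => τ p.1.1)
        (fun p => Data.pair (.nat p.1.2) (gaussData (ampVec (c p.1.1).1 s p.1.2))) :=
      Small.of_mem_map hlst2.small_out
    exact (Runs.straight' (P := .fst (.entryProg))
      (hp.pair ((Small.const (.int 0)).pair (s4.reindex fun p : J => p.1.1))) rfl fun p => by
        simp [Prog.entryProg, Prog.ev, Op.apply, Prog.var, Prog.bin, entryData, outEnv, collectData,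
          gaussData, outAmp, ampVec]).small_out
  have hA2 : Small (fun p : {p : I × ℕ // p.2 ≤ (collected (c p.1).1 s (L p.1)).1.length} =>
      τ p.1.1) (fun p => Data.list (((collected (c p.1.1).1 s (L p.1.1)).1.take p.1.2).foldl
        (fun acc y => entryData y (outAmp (c p.1.1).1 s y)
          (collected (c p.1.1).1 s (L p.1.1)).2 :: acc)
        (zeroEntry (c p.1.1).1 s (collected (c p.1.1).1 s (L p.1.1)).2))) := by
    obtain ⟨d, hd⟩ := hent
    obtain ⟨d', hd'⟩ := h5.small_out
    have hb : PolyBdd τ fun i => (τ i + 2) ^ d := (PolyBdd.param.add (PolyBdd.const 2)).pow d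
    have hb' : PolyBdd τ fun i => (τ i + 2) ^ d' := (PolyBdd.param.add (PolyBdd.const 2)).pow d'
    refine PolyBdd.mono ((hb'.add (hcap.mul ((PolyBdd.const 1).add hb))).reindex
      fun p : {p : I × ℕ // p.2 ≤ (collected (c p.1).1 s (L p.1)).1.length} => p.1.1) fun p => ?_
    have key : ∀ (l : List ℕ) (z : List Data) (S : ℤ) (b : ℕ),
        (∀ y ∈ l, (entryData y (outAmp (c p.1.1).1 s y) S).size ≤ b) →
        (Data.list (l.foldl (fun acc y => entryData y (outAmp (c p.1.1).1 s y) S :: acc) z)).size ≤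
          (Data.list z).size + l.length * (1 + b) := by
      intro l
      induction l with
      | nil => simp
      | cons y l ih =>
        intro z S b h
        have h1 := ih (entryData y (outAmp (c p.1.1).1 s y) S :: z) S b
          fun y hy => h y (by simp [hy])
        have h2 := h y (by simp)
        simp only [Data.list, Data.size] at h1
        simp only [List.foldl_cons, List.length_cons]
        rw [Nat.succ_mul]; omega
    have hmem : ∀ y ∈ (collected (c p.1.1).1 s (L p.1.1)).1.take p.1.2,
        (entryData y (outAmp (c p.1.1).1 s y) (collected (c p.1.1).1 s (L p.1.1)).2).size ≤
          (τ p.1.1 + 2) ^ d := fun y hy => hd ⟨(p.1.1, y), List.mem_of_mem_take hy⟩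
    refine (key _ _ _ _ hmem).trans ?_
    refine Nat.add_le_add (hd' p.1.1) (Nat.mul_le_mul_right _ ?_)
    exact (List.length_take_le' _ _).trans (hle _)
  refine (Runs.foldl (encB := fun _ => Data.list) (k := fun i => (c i).1.cap)
    (b := fun i => zeroEntry (c i).1 s (collected (c i).1 s (L i)).2)
    (F := fun i acc y => entryData y (outAmp (c i).1 s y) (collected (c i).1 s (L i)).2 :: acc)
    (enc := fun i y => .pair (.nat y) (gaussData (ampVec (c i).1 s y)))
    (Runs.straight' s4 rfl fun i => ?_) hlst2 h5 hcap hA2 ?_).congr fun i => ?_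
  · simp [Prog.ev, Op.apply, Prog.var, outEnv, Ctx.env, Ctx.params, Data.list]
  · refine Runs.straight' ?_ rfl fun p => ?_
    · refine Small.pair ?_ (Small.pair ?_ (s4.reindex
        fun p : {p : I × ℕ // p.2 < (collected (c p.1).1 s (L p.1)).1.length} => p.1.1))
      · exact (Small.of_mem_map hlst2.small_out).reindex
          fun p : {p : I × ℕ // p.2 < (collected (c p.1).1 s (L p.1)).1.length} =>
          (⟨(p.1.1, (collected (c p.1.1).1 s (L p.1.1)).1[p.1.2]'p.2), List.getElem_mem _⟩ : J)
      · exact hA2.reindex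
          fun p : {p : I × ℕ // p.2 < (collected (c p.1).1 s (L p.1)).1.length} =>
          (⟨p.1, p.2.le⟩ : {p : I × ℕ // p.2 ≤ (collected (c p.1).1 s (L p.1)).1.length})
    · simp [Prog.entryProg, Prog.ev, Op.apply, Prog.var, Prog.bin, entryData, outEnv, collectData,
          gaussData, outAmp, ampVec, Data.list]
  · rw [List.take_of_length_le (hle i)]; rfl

/-- The deterministic part of the algorithm, on the environment of a context. -/
def Prog.postProg (Q : Prog) (s : ℤ) : Prog :=
  .comp (.outputProg Q s) (.pair (.treeProg Q s) (.op .id))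

theorem Admissible.runs_postProg (hV : Admissible Q V) (hτ : PolyBdd τ fun i => (c i).1.sz)
    {s : ℤ} : Runs τ (.postProg Q s) (fun i => (c i).1.env)
      (fun i => .list (outputList (c i).1 s (treeList (c i).1 s (c i).1.n))) := by
  have hW : PolyBdd τ fun i => (c i).1.W := hτ.mono fun i => by simp only [Ctx.sz]; omega
  have h1 := (hV.runs_treeProg (s := s) hτ).pair (Runs.op (o := .id) (hV.small_env hτ))
  refine h1.comp (hV.runs_outputProg hτ ?_ h1.small_out)
  exact (((PolyBdd.const 2).mul ((PolyBdd.const 2).mul hW)).add (.const 1)).mono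
    fun i => length_treeList_le _ _ _

end

/-! ### Laws and running times of randomized programs -/

/-- The law of the result of a program. -/
noncomputable def Prog.law (P : Prog) (x : Data) : PMF Data := (P.run x).map Prod.fst

/-- The law after `m` independent randomized steps. -/
noncomputable def iterLaw (F : Data → PMF Data) : ℕ → Data → PMF Data
  | 0, x => PMF.pure x
  | m + 1, x => (F x).bind (iterLaw F m)

namespace Prog

theorem law_op (o : Op) (x : Data) : law (.op o) x = PMF.pure (o.apply x) := by
  simp [law, run, PMF.pure_map]

theorem law_coin (x : Data) : law .coin x =
    (PMF.uniformOfFintype Bool).map fun b => .int (if b then 1 else 0) := by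
  simp [law, run, PMF.map_comp, Function.comp_def]

theorem law_comp (g f : Prog) (x : Data) : law (.comp g f) x = (law f x).bind (law g) := by
  simp only [law, run, PMF.map_bind, PMF.bind_map, PMF.map_comp]
  rfl

theorem law_pair (f g : Prog) (x : Data) :
    law (.pair f g) x = (law f x).bind fun a => (law g x).map fun b => .pair a b := by
  simp only [law, run, PMF.map_bind, PMF.bind_map, PMF.map_comp]
  rfl

theorem law_det (P : Prog) (x : Data) : law P.det x = PMF.pure (P.ev x) := by
  rw [law, det_run, PMF.pure_map]

theorem iterRun_map_fst (F : Data → PMF (Data × ℕ)) (m : ℕ) (x : Data) :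
    (iterRun F m x).map Prod.fst = iterLaw (fun x => (F x).map Prod.fst) m x := by
  induction m generalizing x with
  | zero => simp [iterRun, iterLaw, PMF.pure_map]
  | succ m ih =>
    simp only [iterRun, iterLaw, PMF.map_bind, PMF.bind_map, PMF.map_comp]
    congr 1
    funext r
    rw [Function.comp_apply, ← ih]
    rfl

theorem law_iter (f : Prog) (k : ℕ) (x : Data) :
    law (.iter f) (.pair (.nat k) x) = iterLaw (law f) k x := by
  simp only [law, run, Data.nat, PMF.map_comp, Int.toNat_natCast]
  exact iterRun_map_fst f.run k x

/-- Results are no longer than the running time. -/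
theorem size_le_of_mem_support (P : Prog) :
    ∀ x, ∀ out ∈ (P.run x).support, out.1.size ≤ out.2 := by
  induction P with
  | op o =>
    intro x out h
    simp only [run, PMF.support_pure, Set.mem_singleton_iff] at h
    subst h; simp only; omega
  | coin =>
    intro x out h
    simp only [run, PMF.support_map] at h
    obtain ⟨b, -, rfl⟩ := h
    simp only; omega
  | comp g f ihg ihf =>
    intro x out h
    simp only [run, PMF.mem_support_bind_iff, PMF.support_map] at h
    obtain ⟨r, hr, s, hs, rfl⟩ := h
    have := ihg _ s hs
    simp only; omega
  | pair f g ihf ihg =>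
    intro x out h
    simp only [run, PMF.mem_support_bind_iff, PMF.support_map] at h
    obtain ⟨r, hr, s, hs, rfl⟩ := h
    have := ihg _ s hs
    have := ihf _ r hr
    simp only [Data.size]; omega
  | ite c f g ihc ihf ihg =>
    intro x out h
    rw [ite_run_eq] at h
    simp only [PMF.mem_support_bind_iff] at h
    obtain ⟨r, hr, h⟩ := h
    split_ifs at h <;> rw [PMF.support_map] at h <;> obtain ⟨s, hs, rfl⟩ := h
    · have := ihg _ s hs; simp only; omega
    · have := ihf _ s hs; simp only; omega
  | iter f ih =>
    have key : ∀ m x, ∀ out ∈ (iterRun f.run m x).support, out.1.size ≤ x.size + out.2 := by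
      intro m
      induction m with
      | zero =>
        intro x out h
        simp only [iterRun, PMF.support_pure, Set.mem_singleton_iff] at h
        subst h; simp
      | succ m ihm =>
        intro x out h
        simp only [iterRun, PMF.mem_support_bind_iff, PMF.support_map] at h
        obtain ⟨r, hr, s, hs, rfl⟩ := h
        have := ih _ r hr
        have := ihm _ s hs
        simp only; omega
    intro x out h
    match x with
    | .pair (.int k) y =>
      simp only [run, PMF.support_map] at h
      obtain ⟨s, hs, rfl⟩ := h
      have := key _ _ s hs
      simp only [Data.size]; omega
    | .pair (.pair _ _) y =>
      simp only [run, PMF.support_pure, Set.mem_singleton_iff] at h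
      subst h; simp [Data.size]
    | .int _ =>
      simp only [run, PMF.support_pure, Set.mem_singleton_iff] at h
      subst h; simp [Data.size]

end Prog

/-- On the inputs `x i`, all runs of `P` take time polynomial in `σ i`. -/
def PolyTime {I : Type} (σ : I → ℕ) (P : Prog) (x : I → Data) : Prop :=
  ∃ c, ∀ i, ∀ out ∈ (P.run (x i)).support, out.2 ≤ (σ i + 2) ^ c

section PolyTime

variable {I J : Type} {σ : I → ℕ} {x y : I → Data} {P f g : Prog}

theorem PolyTime.of_le {T : I → ℕ} (hT : PolyBdd σ T)
    (h : ∀ i, ∀ out ∈ (P.run (x i)).support, out.2 ≤ T i) : PolyTime σ P x := by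
  obtain ⟨c, hc⟩ := hT
  exact ⟨c, fun i out ho => (h i out ho).trans (hc i)⟩

theorem Runs.polyTime_det (h : Runs σ P x y) : PolyTime σ P.det x := by
  refine .of_le h.2 fun i out ho => ?_
  rw [Prog.det_run] at ho
  simp only [PMF.support_pure, Set.mem_singleton_iff] at ho
  subst ho; rfl

theorem PolyTime.op {o : Op} (hx : Small σ x) : PolyTime σ (.op o) x :=
  (Runs.op (o := o) hx).polyTime_det

theorem PolyTime.coin (hx : Small σ x) : PolyTime σ .coin x := by
  refine .of_le (PolyBdd.add hx (.const 4)) fun i out ho => ?_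
  simp only [Prog.run, PMF.support_map] at ho
  obtain ⟨b, -, rfl⟩ := ho
  cases b <;> simp [Data.size] <;> omega

theorem PolyTime.reindex (h : PolyTime σ P x) (φ : J → I) :
    PolyTime (fun j => σ (φ j)) P (fun j => x (φ j)) := by
  obtain ⟨c, hc⟩ := h
  exact ⟨c, fun j => hc (φ j)⟩

theorem PolyTime.bound (h : PolyTime σ P x) :
    ∃ T, PolyBdd σ T ∧ ∀ i, ∀ out ∈ (P.run (x i)).support, out.2 ≤ T i := by
  obtain ⟨c, hc⟩ := h
  exact ⟨_, (PolyBdd.param.add (PolyBdd.const 2)).pow c, hc⟩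

theorem PolyTime.small_out (h : PolyTime σ P x) :
    Small (fun p : {p : I × Data // p.2 ∈ (P.law (x p.1)).support} => σ p.1.1)
      (fun p => p.1.2) := by
  obtain ⟨c, hc⟩ := h
  refine ⟨c, fun p => ?_⟩
  obtain ⟨⟨i, d⟩, hp⟩ := p
  simp only [Prog.law, PMF.support_map] at hp
  obtain ⟨out, ho, rfl⟩ := hp
  exact (P.size_le_of_mem_support _ out ho).trans (hc i out ho)

theorem PolyTime.comp (hf : PolyTime σ f x)
    (hg : PolyTime (fun p : {p : I × Data // p.2 ∈ (f.law (x p.1)).support} => σ p.1.1) g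
      (fun p => p.1.2)) : PolyTime σ (.comp g f) x := by
  obtain ⟨T, hT, hfT⟩ := hf.bound
  obtain ⟨c, hc⟩ := hg
  refine .of_le (((PolyBdd.const 1).add hT).add ((PolyBdd.param.add (PolyBdd.const 2)).pow c))
    fun i out ho => ?_
  simp only [Prog.run, PMF.mem_support_bind_iff, PMF.support_map] at ho
  obtain ⟨r, hr, s, hs, rfl⟩ := ho
  have h1 := hfT i r hr
  have h2 := hc ⟨(i, r.1), by rw [Prog.law, PMF.support_map]; exact ⟨r, hr, rfl⟩⟩ s hs
  simp only at h2 ⊢; omega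

theorem PolyTime.pair (hf : PolyTime σ f x) (hg : PolyTime σ g x) :
    PolyTime σ (.pair f g) x := by
  obtain ⟨T, hT, hfT⟩ := hf.bound
  obtain ⟨T', hT', hgT⟩ := hg.bound
  refine .of_le (((PolyBdd.const 1).add hT).add hT') fun i out ho => ?_
  simp only [Prog.run, PMF.mem_support_bind_iff, PMF.support_map] at ho
  obtain ⟨r, hr, s, hs, rfl⟩ := ho
  have h1 := hfT i r hr
  have h2 := hgT i s hs
  simp only; omega

/-- A loop takes polynomial time if its body does on the states `s` that satisfy an invariant. -/
theorem PolyTime.iter {k : I → ℕ} {A : Type} {Inv : I → ℕ → A → Prop} {enc : I → A → Data}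
    {a₀ : I → A} (hk : PolyBdd σ k) (h0 : ∀ i, Inv i 0 (a₀ i)) (hx : Small σ fun i => enc i (a₀ i))
    (hstep : ∀ i j a, Inv i j a → ∀ d ∈ (f.law (enc i a)).support, ∃ a', Inv i (j + 1) a' ∧
      d = enc i a')
    (hf : PolyTime (fun p : {p : I × ℕ × A // p.2.1 < k p.1 ∧ Inv p.1 p.2.1 p.2.2} => σ p.1.1) f
      (fun p => enc p.1.1 p.1.2.2)) :
    PolyTime σ (.iter f) (fun i => .pair (.nat (k i)) (enc i (a₀ i))) := by
  obtain ⟨c, hc⟩ := hf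
  have key : ∀ i m j a, Inv i j a → j + m ≤ k i → ∀ out ∈ (iterRun f.run m (enc i a)).support,
      out.2 ≤ m * (σ i + 2) ^ c := by
    intro i m
    induction m with
    | zero =>
      intro j a ha _ out ho
      simp only [iterRun, PMF.support_pure, Set.mem_singleton_iff] at ho
      subst ho; simp
    | succ m ih =>
      intro j a ha hj out ho
      simp only [iterRun, PMF.mem_support_bind_iff, PMF.support_map] at ho
      obtain ⟨r, hr, s, hs, rfl⟩ := ho
      have h1 := hc ⟨(i, j, a), by simp; omega, ha⟩ r hr
      obtain ⟨a', ha', he⟩ := hstep i j a ha r.1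
        (by rw [Prog.law, PMF.support_map]; exact ⟨r, hr, rfl⟩)
      rw [he] at hs
      have h2 := ih (j + 1) a' ha' (by omega) s hs
      simp only at h1 ⊢
      rw [Nat.succ_mul]; omega
  have hP : PolyBdd σ fun i => (σ i + 2) ^ c := (PolyBdd.param.add (PolyBdd.const 2)).pow c
  refine .of_le (((PolyBdd.const 1).add ((Small.nat hk).pair hx)).add (hk.mul hP))
    fun i out ho => ?_
  simp only [Prog.run, Data.nat, PMF.support_map, Int.toNat_natCast] at ho
  obtain ⟨s, hs, rfl⟩ := ho
  have := key i (k i) 0 _ (h0 i) (by omega) s hs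
  simp only [Data.nat]; omega

end PolyTime

/-! ### The sampling program -/

/-- The basis label denoted by a value; `0` if there is none. -/
noncomputable def toLabel (N : ℕ) [NeZero N] : Data → Fin N
  | .int z => if 0 ≤ z ∧ z + 1 ≤ N then Fin.ofNat N z.toNat else 0
  | .pair _ _ => 0

namespace Prog

/-- On `(d, N)`: the basis label denoted by `d`. -/
def labelProg : Prog :=
  .ite (.comp (.op .isInt) (var 0))
    (.ite (leq (cst 0) (var 0)) (.ite (leq (plus (var 0) (cst 1)) (.op .snd)) (var 0) (cst 0))
      (cst 0)) (cst 0)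

/-- Append a random bit. -/
def flip : Prog := plus (.op .id) (plus (.op .id) .coin)

/-- Environment: the samples so far, `N, n`, the description, the precision. -/
def samplePair (S : Prog) : Prog :=
  .pair (.comp labelProg.det (.pair (.comp S (Prog.pair (var 3) (var 4)).det) (var 1).det))
    (.comp (.iter flip) (Prog.pair (var 2) (cst 0)).det)

/-- Put a further sample in front of the list of samples. -/
def sampleStep (S : Prog) : Prog := .pair (.pair (samplePair S) (.op .fst)) (.op .snd)

end Prog

theorem ev_labelProg (N : ℕ) [NeZero N] (d : Data) :
    Prog.labelProg.ev (.pair d (.nat N)) = .nat (toLabel N d) := by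
  match d with
  | .pair a b => simp [Prog.labelProg, Prog.ev, Prog.var, Op.apply, Data.nat, toLabel]
  | .int z =>
    simp only [Prog.labelProg, Prog.ev, Prog.var, Op.apply, Data.nat, toLabel, Prog.bin]
    by_cases h0 : 0 ≤ z
    · by_cases h1 : z + 1 ≤ N
      · have : z.toNat < N := by omega
        simp [h0, h1, Nat.mod_eq_of_lt this]
      · simp [h0, h1]
    · simp [h0]

/-- A uniform number of `m + 1` bits consists of a leading random bit and `m` uniform bits. -/
theorem uniform_two_pow_succ (m : ℕ) : PMF.uniformOfFintype (Fin (2 ^ (m + 1))) =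
    (PMF.uniformOfFintype Bool).bind fun b => (PMF.uniformOfFintype (Fin (2 ^ m))).map
      fun j : Fin (2 ^ m) => Fin.ofNat (2 ^ (m + 1)) (2 ^ m * (if b then 1 else 0) + (j : ℕ)) := by
  ext k
  rw [PMF.uniformOfFintype_apply, PMF.bind_apply, tsum_fintype]
  simp only [PMF.uniformOfFintype_apply, PMF.map_apply, tsum_fintype]
  have h2 : (2 : ℕ) ^ (m + 1) = 2 ^ m + 2 ^ m := by rw [pow_succ]; ring
  have hval : ∀ (b : Bool) (j : Fin (2 ^ m)),
      (k = Fin.ofNat (2 ^ (m + 1)) (2 ^ m * (if b then 1 else 0) + j)) ↔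
      (k : ℕ) = 2 ^ m * (if b then 1 else 0) + j := by
    intro b j
    rw [Fin.ext_iff, Fin.val_ofNat, Nat.mod_eq_of_lt]
    have := j.2
    cases b <;> simp <;> omega
  have hsum : ∀ b : Bool, ∑ j : Fin (2 ^ m),
      (if k = Fin.ofNat (2 ^ (m + 1)) (2 ^ m * (if b then 1 else 0) + j) then
        ((Fintype.card (Fin (2 ^ m)) : ENNReal))⁻¹ else 0) =
      if (b = true ↔ 2 ^ m ≤ (k : ℕ)) then ((2 : ENNReal) ^ m)⁻¹ else 0 := by
    intro b
    simp_rw [hval]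
    have hk := k.2
    by_cases hb : (b = true ↔ 2 ^ m ≤ (k : ℕ))
    · rw [if_pos hb]
      have hlt : (k : ℕ) - 2 ^ m * (if b then 1 else 0) < 2 ^ m := by
        cases b <;> simp at hb ⊢ <;> omega
      rw [Finset.sum_eq_single ⟨_, hlt⟩]
      · rw [if_pos (by cases b <;> simp at hb ⊢; omega)]; simp
      · intro j _ hj
        rw [if_neg]
        intro h; apply hj; apply Fin.ext; simp only; omega
      · intro h; exact absurd (Finset.mem_univ _) h
    · rw [if_neg hb]
      refine Finset.sum_eq_zero fun j _ => ?_
      rw [if_neg]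
      intro h
      apply hb
      have := j.2
      cases b <;> simp at h ⊢ <;> omega
  simp_rw [hsum]
  rw [Fintype.sum_bool]
  have e : ((Fintype.card (Fin (2 ^ (m + 1))) : ENNReal))⁻¹ = 2⁻¹ * ((2 : ENNReal) ^ m)⁻¹ := by
    rw [Fintype.card_fin, ← ENNReal.mul_inv (by simp) (by simp)]
    push_cast; rw [pow_succ, mul_comm]
  rw [e]
  by_cases h : 2 ^ m ≤ (k : ℕ) <;> simp [h]

theorem law_flip (r : ℕ) : Prog.flip.law (.nat r) =
    (PMF.uniformOfFintype Bool).map fun b => .nat (2 * r + if b then 1 else 0) := by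
  simp only [Prog.flip, Prog.plus, Prog.bin, Prog.law_comp, Prog.law_pair, Prog.law_op,
    Prog.law_coin, PMF.pure_bind, PMF.map_comp, PMF.bind_map, Function.comp_def, PMF.map_bind,
    PMF.pure_map, Op.apply]
  rw [PMF.bind_bind]
  conv_rhs => rw [← PMF.bind_pure_comp]
  congr 1
  funext b
  simp only [Data.nat, Op.apply, PMF.pure_bind, Function.comp_apply, Prog.law_op]
  congr 2
  cases b <;> simp <;> ring

theorem iterLaw_flip (m r : ℕ) : iterLaw Prog.flip.law m (.nat r) =
    (PMF.uniformOfFintype (Fin (2 ^ m))).map fun j : Fin (2 ^ m) => .nat (2 ^ m * r + (j : ℕ)) := by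
  induction m generalizing r with
  | zero =>
    have : PMF.uniformOfFintype (Fin (2 ^ 0)) = PMF.pure 0 := by
      ext k
      have : k = 0 := Fin.ext (by have := k.2; simp at this; simp)
      subst this; simp
    rw [iterLaw, this, PMF.pure_map]; simp
  | succ m ih =>
    rw [iterLaw, law_flip, uniform_two_pow_succ, PMF.bind_map, PMF.map_bind]
    congr 1
    funext b
    rw [Function.comp_apply, ih, PMF.map_comp]
    congr 1
    funext j
    have := j.2
    have h2 : (2 : ℕ) ^ (m + 1) = 2 ^ m * 2 := pow_succ _ _
    rw [Function.comp_apply, Fin.val_ofNat, Nat.mod_eq_of_lt]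
    · congr 1; rw [h2]; ring
    · cases b <;> simp <;> omega

/-- The law of one sample: a sanitized output of the sampler with law `p`, and a uniform label. -/
noncomputable def sampleLaw (n : ℕ) (p : PMF Data) : PMF (Fin (2 ^ n) × Fin (2 ^ n)) :=
  (p.map (toLabel (2 ^ n))).bind fun x =>
    (PMF.uniformOfFintype (Fin (2 ^ n))).map fun r => (x, r)

theorem sampleLaw_apply (n : ℕ) (p : PMF Data) (x r : Fin (2 ^ n)) :
    (sampleLaw n p (x, r)).toReal = (p.map (toLabel (2 ^ n)) x).toReal * (1 / 2 ^ n) := by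
  have h : ∀ y, ((PMF.uniformOfFintype (Fin (2 ^ n))).map fun r => (y, r)) (x, r) =
      if x = y then ((2 : ENNReal) ^ n)⁻¹ else 0 := by
    intro y
    rw [PMF.map_apply (fun r => (y, r)), tsum_fintype]
    split_ifs with hy
    · subst hy
      rw [Finset.sum_eq_single r]
      · simp
      · intro b _ hb; rw [if_neg]; simpa using hb.symm
      · intro h; exact absurd (Finset.mem_univ _) h
    · refine Finset.sum_eq_zero fun b _ => if_neg fun h => hy (Prod.mk.inj h).1
  rw [sampleLaw, PMF.bind_apply, tsum_fintype, Finset.sum_eq_single x, h, if_pos rfl]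
  · simp
  · intro y _ hy
    rw [h, if_neg (Ne.symm hy), mul_zero]
  · intro h; exact absurd (Finset.mem_univ _) h

/-- Labels as natural numbers. -/
def valPair {N : ℕ} (p : Fin N × Fin N) : ℕ × ℕ := (p.1, p.2)

theorem law_samplePair (S : Prog) (n k : ℕ) (inst l rest : Data) :
    (Prog.samplePair S).law (.pair l (.pair (.nat (2 ^ n)) (.pair (.nat n) (.pair inst
      (.pair (.nat k) rest))))) =
    (sampleLaw n (S.law (.pair inst (.nat k)))).map fun p => sampleData (valPair p) := by
  have h2 : (Data.nat (2 ^ n)) = .nat (2 ^ n : ℕ) := rfl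
  simp only [Prog.samplePair, Prog.law_pair, Prog.law_comp, Prog.law_det, PMF.pure_bind, Prog.ev,
    Prog.var, Op.apply, PMF.pure_map, PMF.bind_bind, sampleLaw, PMF.map_bind, PMF.bind_map,
    PMF.map_comp, Function.comp_def]
  congr 1
  funext d
  rw [ev_labelProg]
  have : (Data.int 0) = .nat 0 := rfl
  rw [this, Prog.law_iter, iterLaw_flip]
  simp [PMF.map_comp, Function.comp_def, sampleData, valPair]

theorem law_sampleStep (S : Prog) (n k : ℕ) (inst l rest : Data) :
    (Prog.sampleStep S).law (.pair l (.pair (.nat (2 ^ n)) (.pair (.nat n) (.pair inst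
      (.pair (.nat k) rest))))) =
    (sampleLaw n (S.law (.pair inst (.nat k)))).map fun p =>
      .pair (.pair (sampleData (valPair p)) l)
        (.pair (.nat (2 ^ n)) (.pair (.nat n) (.pair inst (.pair (.nat k) rest)))) := by
  rw [Prog.sampleStep, Prog.law_pair, Prog.law_pair, law_samplePair]
  simp only [Prog.law_op, Op.apply, PMF.pure_map, PMF.bind_map, Function.comp_def]
  simp only [PMF.bind_bind, PMF.pure_bind]
  exact PMF.bind_pure_comp _ _

/-- The sample at the end of the list may as well be drawn first. -/
theorem iidList_succ_comm {α : Type} (D : PMF α) (m : ℕ) {β : Type} (g : List α → β) :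
    D.bind (fun a => (iidList D m).map fun l => g (l ++ [a])) = (iidList D (m + 1)).map g := by
  induction m generalizing β with
  | zero =>
    simp only [iidList, PMF.pure_map, PMF.pure_bind, PMF.map_comp, List.nil_append]
    exact PMF.bind_pure_comp _ _
  | succ m ih =>
    have h : iidList D (m + 1) = D.bind fun a => (iidList D m).map fun l => l ++ [a] :=
      ((ih fun l => l).trans (PMF.map_id _)).symm
    conv_rhs => rw [iidList, h]
    simp only [iidList, PMF.map_bind, PMF.bind_bind, PMF.bind_map, PMF.map_comp, Function.comp_def,
      List.cons_append]

/-- The list of samples drawn by the sampling loop. -/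
theorem iterLaw_cons {α : Type} (F : Data → PMF Data) (D : PMF α) (enc : List α → Data)
    (h : ∀ l, F (enc l) = D.map fun a => enc (a :: l)) (m : ℕ) (l : List α) :
    iterLaw F m (enc l) = (iidList D m).map fun l' => enc (l' ++ l) := by
  induction m generalizing l with
  | zero => simp [iterLaw, iidList, PMF.pure_map]
  | succ m ih =>
    rw [iterLaw, h, PMF.bind_map, ← iidList_succ_comm]
    congr 1
    funext a
    rw [Function.comp_apply, ih]
    simp

/-! ### The simulation program -/

/-- An input of the simulation algorithm: the number `n` of qubits and the description `desc` of the
state, the answers `qv` of amplitude queries, the sparseness `t`, the accuracy `E` and the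
confidence `L`. -/
structure Task where
  n : ℕ
  desc : Data
  qv : ℕ → GaussianInt × ℕ
  t : ℕ
  E : ℕ
  L : ℕ

namespace Task

/-- The data that name the state. -/
def inst (T : Task) : Data := .pair (.nat T.n) T.desc
/-- The value that the simulation program receives. -/
def input (T : Task) : Data := .pair T.inst (.pair (.nat T.t) (.pair (.nat T.E) (.nat T.L)))
/-- The accuracy parameter; it is about `t / ε`. -/
def W (T : Task) : ℕ := T.t * (T.E + 1)
/-- The number of samples, which makes each estimate accurate up to `1 / (16 W)` except with
probability `2 exp (-(n + L + 3))`. -/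
def K (T : Task) : ℕ := 2 ^ 14 * (T.W * T.W) * (T.n + T.L + 3)
/-- The size parameter in which running times are polynomial. -/
def size (T : Task) : ℕ := T.n + T.t + T.E + T.L
/-- The context of the deterministic part, for given samples. -/
def ctx (T : Task) (l : List (ℕ × ℕ)) : Ctx := ⟨T.n, T.inst, T.qv, T.W, T.K, l⟩
/-- The precision of amplitude queries and of sampling. -/
def k (T : Task) : ℕ := T.n + T.W + 8
/-- The input of the sampling loop without the number of rounds, for given earlier samples. -/
def state (T : Task) (l : List (ℕ × ℕ)) : Data := (T.ctx l).env
/-- The law of one sample if `S` is the sampler. -/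
noncomputable def law (T : Task) (S : Prog) : PMF (Fin (2 ^ T.n) × Fin (2 ^ T.n)) :=
  sampleLaw T.n (S.law (.pair T.inst (.nat T.k)))
/-- The output of the algorithm, for given samples. -/
def output (T : Task) (s : ℤ) (l : List (Fin (2 ^ T.n) × Fin (2 ^ T.n))) : Data :=
  .list (outputList (T.ctx (l.map valPair)) s (treeList (T.ctx (l.map valPair)) s T.n))

/-- Samples that denote pairs of basis labels. -/
def Valid (T : Task) (l : List (ℕ × ℕ)) : Prop := ∀ p ∈ l, p.1 < 2 ^ T.n ∧ p.2 < 2 ^ T.n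

end Task

namespace Prog

/-- Compute the number of samples and the parameters. -/
def preProg : Prog :=
  .letin (.comp twoPow (.pair (fst (var 0)) (.op .id))) <|
  .letin (.comp gpow (.args [.pair (cst 1) (cst (-1)), fst (var 1)])) <|
  .letin (times (var 3) (plus (var 4) (cst 1))) <|
  .letin (times (times (cst (2 ^ 14)) (times (var 0) (var 0)))
    (plus (plus (fst (var 3)) (tl 6)) (cst 3))) <|
  .pair (var 0) (.pair (cst 0) (.args [var 3, fst (var 4), var 4,
    plus (plus (fst (var 4)) (var 1)) (cst 8), times (cst 4096) (var 1), times (cst 64) (var 1),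
    var 0, times (cst 2) (var 1), .pair (var 2) (var 3)]))

/-- The simulation algorithm for the sign `s` of the transform, with the sampler `S` and the
amplitude oracle `Q`. -/
def simProg (S Q : Prog) (s : ℤ) : Prog :=
  .comp (postProg Q s).det (.comp (.iter (sampleStep S)) preProg.det)

end Prog

section

variable {I : Type} {T : I → Task}

theorem polyBdd_n : PolyBdd (fun i => (T i).size) fun i => (T i).n :=
  PolyBdd.param.mono fun i => by simp only [Task.size]; omega

theorem polyBdd_t : PolyBdd (fun i => (T i).size) fun i => (T i).t :=
  PolyBdd.param.mono fun i => by simp only [Task.size]; omega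

theorem polyBdd_E : PolyBdd (fun i => (T i).size) fun i => (T i).E :=
  PolyBdd.param.mono fun i => by simp only [Task.size]; omega

theorem polyBdd_L : PolyBdd (fun i => (T i).size) fun i => (T i).L :=
  PolyBdd.param.mono fun i => by simp only [Task.size]; omega

theorem polyBdd_W : PolyBdd (fun i => (T i).size) fun i => (T i).W :=
  polyBdd_t.mul (polyBdd_E.add (.const 1))

theorem polyBdd_K : PolyBdd (fun i => (T i).size) fun i => (T i).K :=
  ((PolyBdd.const _).mul (polyBdd_W.mul polyBdd_W)).mul ((polyBdd_n.add polyBdd_L).add (.const 3))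

theorem runs_preProg (hinst : Small (fun i => (T i).size) fun i => (T i).inst) :
    Runs (fun i => (T i).size) .preProg (fun i => (T i).input)
      (fun i => .pair (.nat (T i).K) ((T i).state [])) := by
  have hs : Small (fun i => (T i).size) fun i => (T i).input :=
    hinst.pair ((Small.nat polyBdd_t).pair ((Small.nat polyBdd_E).pair (Small.nat polyBdd_L)))
  have h1 : Runs (fun i => (T i).size) (.pair (.fst (.var 0)) (.op .id)) (fun i => (T i).input)
      (fun i => .pair (.nat (T i).n) (T i).input) :=
    Runs.straight' hs rfl fun i => by
      simp [Prog.ev, Op.apply, Prog.var, Task.input, Task.inst]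
  have h2 := h1.comp (runs_twoPow polyBdd_n hs)
  refine Runs.letin h2 ?_
  have s2 := h2.small_out.pair hs
  have h3 : Runs (fun i => (T i).size)
      (.args [.pair (.cst 1) (.cst (-1)), .fst (.var 1)]) _
      (fun i => .list [gaussData ⟨1, -1⟩, .nat (T i).n]) :=
    Runs.straight' s2 rfl fun i => by
      simp [Prog.ev, Op.apply, Prog.var, Prog.args, Data.list, gaussData, Task.input, Task.inst]
  have h4 := h3.comp (runs_gpow (Small.const _) polyBdd_n)
  refine Runs.letin h4 ?_
  have s4 := h4.small_out.pair s2
  have h5 : Runs (fun i => (T i).size) (.times (.var 3) (.plus (.var 4) (.cst 1))) _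
      (fun i => .nat (T i).W) :=
    Runs.straight' s4 rfl fun i => by
      simp [Prog.ev, Op.apply, Prog.var, Prog.bin, Task.input, Task.W, Data.nat]
  refine Runs.letin h5 ?_
  have s5 := h5.small_out.pair s4
  have h6 : Runs (fun i => (T i).size) (.times (.times (.cst (2 ^ 14)) (.times (.var 0) (.var 0)))
      (.plus (.plus (.fst (.var 3)) (.tl 6)) (.cst 3))) _ (fun i => .nat (T i).K) :=
    Runs.straight' s5 rfl fun i => by
      simp [Prog.ev, Op.apply, Prog.var, Prog.tl, Prog.bin, Task.input, Task.inst, Task.K, Data.nat]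
  refine Runs.letin h6 ?_
  have s6 := h6.small_out.pair s5
  refine Runs.straight' s6 rfl fun i => ?_
  simp [Prog.ev, Op.apply, Prog.var, Prog.bin, Prog.args, Task.input, Task.inst, Task.state,
    Task.ctx, Ctx.env, Ctx.params, Data.list, Data.nat, Ctx.k, Ctx.kap, Ctx.B, Ctx.cap, codeData,
    flatAmp]

end

theorem law_sampling (T : Task) (S : Prog) :
    (Prog.iter (.sampleStep S)).law (.pair (.nat T.K) (T.state [])) =
      (iidList (T.law S) T.K).map fun l => T.state (l.map valPair) := by
  rw [Prog.law_iter]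
  have := iterLaw_cons (Prog.sampleStep S).law (T.law S) (fun l => T.state (l.map valPair))
    (fun l => law_sampleStep S T.n T.k T.inst _ _) T.K []
  simpa using this

/-- The output law of the algorithm: draw independent samples and evaluate `Task.output`. -/
theorem law_simProg {Q : Prog} {V : Ctx → Prop} (hV : Admissible Q V) (T : Task) (S : Prog) (s : ℤ)
    (hT : ∀ l, l.length = T.K → T.Valid l → V (T.ctx l))
    (hpre : Prog.preProg.ev T.input = .pair (.nat T.K) (T.state [])) :
    (Prog.simProg S Q s).law T.input = (iidList (T.law S) T.K).map (T.output s) := by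
  rw [Prog.simProg, Prog.law_comp, Prog.law_comp, Prog.law_det, PMF.pure_bind, hpre, law_sampling,
    PMF.bind_map, ← PMF.bind_pure_comp]
  ext d
  rw [PMF.bind_apply, PMF.bind_apply]
  refine tsum_congr fun l => ?_
  by_cases hl : l ∈ (iidList (T.law S) T.K).support
  · rw [Function.comp_apply, Prog.law_det, Function.comp_apply]
    have hv : V (T.ctx (l.map valPair)) := hT _
      (by rw [List.length_map]; exact length_of_mem_support_iidList hl)
      fun p hp => by
        obtain ⟨a, -, rfl⟩ := List.mem_map.mp hp
        exact ⟨a.1.2, a.2.2⟩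
    have := (hV.runs_postProg (I := Unit) (τ := fun _ => (T.ctx (l.map valPair)).sz)
      (c := fun _ => ⟨_, hv⟩) (s := s) PolyBdd.param).1 ()
    rw [Task.state, this]
    rfl
  · rw [(PMF.apply_eq_zero_iff _ _).2 hl, zero_mul, zero_mul]

section

variable {I J : Type} {σ : I → ℕ} {x y : I → Data} {f g : Prog}

/-- To bound the time of a composition, it suffices to describe the possible intermediate results
as a family `out` over some index type. -/
theorem PolyTime.comp_of {ρ : J → I} {out : J → Data} (hf : PolyTime σ f x)
    (hg : PolyTime (fun j => σ (ρ j)) g out)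
    (h : ∀ i, ∀ d ∈ (f.law (x i)).support, ∃ j, ρ j = i ∧ out j = d) :
    PolyTime σ (.comp g f) x := by
  refine hf.comp ?_
  obtain ⟨c, hc⟩ := hg
  refine ⟨c, fun p r hr => ?_⟩
  obtain ⟨j, hj, hd⟩ := h p.1.1 p.1.2 p.2
  have := hc j r (by rw [hd]; exact hr)
  simp only [hj] at this
  exact this

theorem PolyTime.comp_det (hf : Runs σ f x y) (hg : PolyTime σ g y) :
    PolyTime σ (.comp g f.det) x :=
  hf.polyTime_det.comp_of (ρ := fun i => i) hg fun i d hd => ⟨i, rfl, by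
    rw [Prog.law_det, PMF.support_pure, Set.mem_singleton_iff] at hd
    rw [hd, hf.1]⟩

theorem PolyTime.loopFree (hx : Small σ x) (h : f.loopFree = true) : PolyTime σ f.det x :=
  (Runs.straight hx h).polyTime_det

theorem PolyTime.comp_loopFree (hf : PolyTime σ f x) (h : g.loopFree = true) :
    PolyTime σ (.comp g.det f) x :=
  hf.comp (PolyTime.loopFree hf.small_out h)

end

section

variable {I : Type} {σ : I → ℕ}

theorem polyTime_flip {m : I → ℕ} (hm : PolyBdd σ m) :
    PolyTime σ (.iter .flip) (fun i => .pair (.nat (m i)) (.nat 0)) := by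
  refine PolyTime.iter (Inv := fun _ j r => r < 2 ^ j) (enc := fun _ r => .nat r)
    (a₀ := fun _ => 0) hm (fun i => by simp) (Small.const _) (fun i j r hr d hd => ?_) ?_
  · rw [law_flip, PMF.support_map] at hd
    obtain ⟨b, -, rfl⟩ := hd
    refine ⟨_, ?_, rfl⟩
    rw [pow_succ]
    cases b <;> simp <;> omega
  · have hs : Small (fun p : {p : I × ℕ × ℕ // p.2.1 < m p.1 ∧ p.2.2 < 2 ^ p.2.1} => σ p.1.1)
        (fun p => Data.nat p.1.2.2) :=
      Small.int_of_lt_two_pow (hm.reindex _) fun p => by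
        have h1 := p.2.2
        have h2 := Nat.pow_le_pow_right (show 0 < 2 by norm_num) p.2.1.le
        simp only [Int.natAbs_natCast]; omega
    have h1 := ((PolyTime.op (o := .id) hs).pair (PolyTime.coin hs)).comp_loopFree
      (g := .op .add) rfl
    exact ((PolyTime.op (o := .id) hs).pair h1).comp_loopFree (g := .op .add) rfl

end

section

variable {I J : Type} {T : I → Task} {ρ : J → I}

theorem small_state (hinst : Small (fun i => (T i).size) fun i => (T i).inst) :
    Small (fun p : {p : I × List (ℕ × ℕ) // p.2.length ≤ (T p.1).K ∧ (T p.1).Valid p.2} =>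
      (T p.1.1).size) (fun p => (T p.1.1).state p.1.2) := by
  have h0 : Small (fun i => (T i).size) (fun i => .list ((T i).ctx []).params) :=
    (runs_preProg hinst).small_out.snd.snd
  refine Small.pair (Small.list ((polyBdd_K.reindex _).mono fun p => p.2.1) ?_)
    (h0.reindex
      fun p : {p : I × List (ℕ × ℕ) // p.2.length ≤ (T p.1).K ∧ (T p.1).Valid p.2} => p.1.1)
  let J := {p : {p : I × List (ℕ × ℕ) // p.2.length ≤ (T p.1).K ∧ (T p.1).Valid p.2} × (ℕ × ℕ) //
    p.2 ∈ p.1.1.2}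
  have hn' := (polyBdd_n (T := T)).reindex fun p : J => p.1.1.1.1
  have h : ∀ p : J, p.1.2.1 < 2 ^ (T p.1.1.1.1).n ∧ p.1.2.2 < 2 ^ (T p.1.1.1.1).n :=
    fun p => p.1.1.2.2 _ p.2
  exact (Small.int_of_lt_two_pow hn' fun p => by simpa using (h p).1.le).pair
    (Small.int_of_lt_two_pow hn' fun p => by simpa using (h p).2.le)

theorem polyTime_sampling {S : Prog} (hinst : Small (fun i => (T i).size) fun i => (T i).inst)
    (hS : PolyTime (fun i => (T i).size) S fun i => .pair (T i).inst (.nat (T i).k)) :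
    PolyTime (fun i => (T i).size) (.iter (.sampleStep S))
      (fun i => .pair (.nat (T i).K) ((T i).state [])) := by
  have hp := (runs_preProg hinst).small_out
  refine PolyTime.iter (A := List (ℕ × ℕ))
    (Inv := fun i j l => l.length = j ∧ (T i).Valid l) (enc := fun i l => (T i).state l)
    (a₀ := fun _ => []) polyBdd_K (fun i => ⟨rfl, by simp [Task.Valid]⟩) hp.snd
    (fun i j l hl d hd => ?_) ?_
  · have := law_sampleStep S (T i).n (T i).k (T i).inst (.list (l.map sampleData))
      (.list [.nat ((T i).ctx []).kap, .nat ((T i).ctx []).B, .nat (T i).K,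
        .nat ((T i).ctx []).cap, codeData (flatAmp (T i).n)])
    have hd' := hd
    change d ∈ ((Prog.sampleStep S).law (.pair _ (.pair (.nat (2 ^ (T i).n)) (.pair (.nat (T i).n)
      (.pair (T i).inst (.pair (.nat (T i).k) _)))))).support at hd'
    rw [law_sampleStep, PMF.support_map] at hd'
    obtain ⟨p, -, rfl⟩ := hd'
    refine ⟨valPair p :: l, ⟨by simp [hl.1], ?_⟩, rfl⟩
    intro q hq
    rcases List.mem_cons.mp hq with rfl | hq
    · exact ⟨p.1.2, p.2.2⟩
    · exact hl.2 q hq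
  · let J := {p : I × ℕ × List (ℕ × ℕ) // p.2.1 < (T p.1).K ∧
      (p.2.2.length = p.2.1 ∧ (T p.1).Valid p.2.2)}
    have hs : Small (fun p : J => (T p.1.1).size) (fun p => (T p.1.1).state p.1.2.2) :=
      (small_state hinst).reindex fun p : J =>
        (⟨(p.1.1, p.1.2.2), p.2.2.1.trans_le p.2.1.le, p.2.2.2⟩ :
          {p : I × List (ℕ × ℕ) // p.2.length ≤ (T p.1).K ∧ (T p.1).Valid p.2})
    have h1 : Runs (fun p : J => (T p.1.1).size) (.pair (.var 3) (.var 4)) _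
        (fun p => .pair (T p.1.1).inst (.nat (T p.1.1).k)) :=
      Runs.straight' hs rfl fun p => by
        simp [Prog.ev, Op.apply, Prog.var, Task.state, Ctx.env, Ctx.params, Data.list, Task.ctx,
          Ctx.k, Task.k]
    have h2 := PolyTime.comp_det h1 (hS.reindex fun p : J => p.1.1)
    have h3 := (h2.pair (PolyTime.loopFree (f := .var 1) hs rfl)).comp_loopFree
      (g := .labelProg) rfl
    have h4 : Runs (fun p : J => (T p.1.1).size) (.pair (.var 2) (.cst 0)) _
        (fun p => .pair (.nat (T p.1.1).n) (.nat 0)) :=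
      Runs.straight' hs rfl fun p => by
        simp [Prog.ev, Op.apply, Prog.var, Task.state, Ctx.env, Ctx.params, Data.list, Task.ctx,
          Data.nat]
    have h5 := PolyTime.comp_det h4 (polyTime_flip (polyBdd_n.reindex fun p : J => p.1.1))
    exact ((h3.pair h5).pair (PolyTime.op hs)).pair (PolyTime.op hs)

theorem polyTime_simProg {S Q : Prog} {V : Ctx → Prop} (hV : Admissible Q V) (s : ℤ)
    (hT : ∀ i l, l.length = (T i).K → (T i).Valid l → V ((T i).ctx l))
    (hinst : Small (fun i => (T i).size) fun i => (T i).inst)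
    (hS : PolyTime (fun i => (T i).size) S fun i => .pair (T i).inst (.nat (T i).k)) :
    PolyTime (fun i => (T i).size) (.simProg S Q s) (fun i => (T i).input) := by
  have h1 := PolyTime.comp_det (runs_preProg hinst) (polyTime_sampling hinst hS)
  let J := {p : I × List (ℕ × ℕ) // p.2.length = (T p.1).K ∧ (T p.1).Valid p.2}
  have h2 := (hV.runs_postProg (s := s) (τ := fun p : J => (T p.1.1).size)
    (c := fun p => ⟨(T p.1.1).ctx p.1.2, hT _ _ p.2.1 p.2.2⟩)
    (((polyBdd_n.add polyBdd_W).add polyBdd_K).reindex fun p : J => p.1.1)).polyTime_det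
  refine h1.comp_of (ρ := fun p : J => p.1.1) h2 fun i d hd => ?_
  rw [Prog.law_comp, Prog.law_det, PMF.pure_bind, (runs_preProg hinst).1, law_sampling,
    PMF.support_map] at hd
  obtain ⟨l, hl, rfl⟩ := hd
  refine ⟨⟨(i, l.map valPair), ?_, fun p hp => ?_⟩, rfl, rfl⟩
  · rw [List.length_map]; exact length_of_mem_support_iidList hl
  · obtain ⟨a, -, rfl⟩ := List.mem_map.mp hp
    exact ⟨a.1.2, a.2.2⟩

end

/-! ### Accuracy of the estimators -/

open scoped ComplexConjugate

/-- The complex number denoted by a Gaussian integer and a denominator. -/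
noncomputable def codeVal (a : GaussianInt × ℕ) : ℂ := (a.1 : ℂ) / (a.2 : ℂ)

/-- Rounding an integer quotient; both quotients vanish for `d = 0`. -/
theorem abs_ediv_sub_le (x : ℤ) {d : ℤ} (hd : 0 ≤ d) : |((x / d : ℤ) : ℝ) - (x : ℝ) / d| ≤ 1 := by
  rcases hd.eq_or_lt with rfl | hd
  · simp
  · have h1 := Int.emod_add_mul_ediv x d
    have h2 := Int.emod_nonneg x hd.ne'
    have h3 := Int.emod_lt_of_pos x hd
    have hd' : (0 : ℝ) < d := by exact_mod_cast hd
    have h4 : ((x / d : ℤ) : ℝ) - (x : ℝ) / d = -((x % d : ℤ) : ℝ) / d := by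
      have : (x : ℝ) = ((x % d : ℤ) : ℝ) + d * ((x / d : ℤ) : ℝ) := by exact_mod_cast h1.symm
      field_simp
      linarith
    rw [h4, abs_div, abs_neg, abs_of_pos hd', div_le_one hd']
    rw [abs_of_nonneg (by exact_mod_cast h2)]
    exact_mod_cast h3.le

theorem abs_estVal_sub_le (c : Ctx) (hW : 1 ≤ c.W) {α β : GaussianInt × ℕ} (hα : 0 < α.2)
    (hβ : 0 < β.2) (z : ℤ) {Z : ℕ} (hZ : 0 < Z) :
    |(estVal c α β z Z : ℝ) / c.B - overlapRatio (codeVal α) (codeVal β) (cis (z / Z))| ≤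
      1 / c.B + 130 / c.kap := by
  have hB : (0 : ℝ) < c.B := by simp only [Ctx.B]; positivity
  have hk : 64 ≤ c.kap := by simp only [Ctx.kap]; omega
  set e := cisNum c.kap z Z with he
  have hD : (0 : ℝ) < cisDen c.kap Z := by exact_mod_cast cisDen_pos (by omega) hZ
  set c' : ℂ := (e : ℂ) / (cisDen c.kap Z : ℂ) with hc'
  have h1 : |overlapRatio (codeVal α) (codeVal β) c' -
      overlapRatio (codeVal α) (codeVal β) (cis (z / Z))| ≤ 130 / c.kap := by
    rw [overlapRatio_sub]
    exact (abs_overlapRatio_le _ _ _).trans (norm_cisNum_div_sub_cis_le hk hZ z)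
  set a : GaussianInt := ⟨α.1.re * β.2, α.1.im * β.2⟩ with ha
  set b : GaussianInt := ⟨β.1.re * α.2, β.1.im * α.2⟩ with hb
  set num : ℤ := 2 * ((a.re * b.re + a.im * b.im) * e.re - (a.re * b.im - a.im * b.re) * e.im)
    with hnum
  set den : ℤ := (a.re * a.re + a.im * a.im + (b.re * b.re + b.im * b.im)) *
    cisDen c.kap Z with hden
  have hest : estVal c α β z Z = (c.B * num) / den := rfl
  have hα' : (0 : ℝ) < α.2 := by exact_mod_cast hα
  have hβ' : (0 : ℝ) < β.2 := by exact_mod_cast hβ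
  have hratio : overlapRatio (codeVal α) (codeVal β) c' = (num : ℝ) / den := by
    have hm : (0 : ℝ) < (α.2 * β.2) ^ 2 := by positivity
    have e1 : ‖codeVal α‖ ^ 2 + ‖codeVal β‖ ^ 2 =
        ((a.re * a.re + a.im * a.im + (b.re * b.re + b.im * b.im) : ℤ) : ℝ) / (α.2 * β.2) ^ 2 := by
      rw [codeVal, codeVal, norm_div, norm_div, div_pow, div_pow, Complex.norm_natCast,
        Complex.norm_natCast, ← Complex.normSq_eq_norm_sq, ← Complex.normSq_eq_norm_sq,
        Complex.normSq_apply, Complex.normSq_apply, ha, hb]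
      simp only [← GaussianInt.intCast_re, ← GaussianInt.intCast_im]
      push_cast
      field_simp
    have e2 : 2 * (conj (codeVal α) * codeVal β * c').re =
        (num : ℝ) / cisDen c.kap Z / (α.2 * β.2) ^ 2 := by
      have e3 : conj (codeVal α) * codeVal β * c' = (conj (α.1 : ℂ) * (β.1 : ℂ) * (e : ℂ)) /
          ((α.2 * β.2 * cisDen c.kap Z : ℝ) : ℂ) := by
        rw [codeVal, codeVal, hc', map_div₀, Complex.conj_natCast, div_mul_div_comm,
          div_mul_div_comm]
        push_cast; rfl
      rw [e3, Complex.div_ofReal_re]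
      simp only [Complex.mul_re, Complex.mul_im, Complex.conj_re, Complex.conj_im, hnum, ha, hb,
        ← GaussianInt.intCast_re, ← GaussianInt.intCast_im]
      push_cast
      field_simp
      ring
    rw [overlapRatio, e1, e2, div_div_div_cancel_right₀ hm.ne', hden, div_div]
    push_cast
    rw [mul_comm (cisDen c.kap Z : ℝ)]
  have hden0 : 0 ≤ den := by
    rw [hden]
    refine mul_nonneg ?_ (by positivity)
    exact add_nonneg (add_nonneg (mul_self_nonneg _) (mul_self_nonneg _))
      (add_nonneg (mul_self_nonneg _) (mul_self_nonneg _))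
  have h2 : |(estVal c α β z Z : ℝ) / c.B - overlapRatio (codeVal α) (codeVal β) c'| ≤ 1 / c.B := by
    have h3 := abs_ediv_sub_le (c.B * num) hden0
    rw [← hest] at h3
    rw [hratio]
    have e4 : (estVal c α β z Z : ℝ) / c.B - (num : ℝ) / den =
        ((estVal c α β z Z : ℝ) - ((c.B * num : ℤ) : ℝ) / den) / c.B := by
      push_cast; field_simp
    rw [e4, abs_div, abs_of_pos hB]
    gcongr
  calc _ ≤ _ := abs_sub_le _ (overlapRatio (codeVal α) (codeVal β) c') _
    _ ≤ _ := add_le_add h2 h1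

theorem abs_estVal_le (c : Ctx) (hW : 1 ≤ c.W) {α β : GaussianInt × ℕ} (hα : 0 < α.2)
    (hβ : 0 < β.2) (z : ℤ) {Z : ℕ} (hZ : 0 < Z) : |(estVal c α β z Z : ℝ) / c.B| ≤ 2 := by
  have h1 := abs_estVal_sub_le c hW hα hβ z hZ
  have h2 := abs_overlapRatio_le (codeVal α) (codeVal β) (cis (z / Z))
  rw [norm_cis] at h2
  have hW' : (1 : ℝ) ≤ c.W := by exact_mod_cast hW
  have h3 : (1 : ℝ) / c.B + 130 / c.kap ≤ 1 := by
    simp only [Ctx.B, Ctx.kap]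
    push_cast
    rw [div_add_div _ _ (by positivity) (by positivity), div_le_one (by positivity)]
    nlinarith
  have h4 := abs_sub_abs_le_abs_sub ((estVal c α β z Z : ℝ) / c.B)
    (overlapRatio (codeVal α) (codeVal β) (cis (z / Z)))
  linarith

theorem cis_one_eighth : cis (1 / 8) = (Real.sqrt 2 / 2 : ℝ) * (1 + Complex.I) := by
  rw [cis, show (2 * Real.pi * (1 / 8) : ℝ) = Real.pi / 4 by ring, Complex.exp_mul_I,
    ← Complex.ofReal_cos, ← Complex.ofReal_sin, Real.cos_pi_div_four, Real.sin_pi_div_four]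
  ring

theorem cis_neg_one_fourth : cis (-(1 / 4)) = -Complex.I := by
  rw [cis, show (2 * Real.pi * (-(1 / 4)) : ℝ) = -(Real.pi / 2) by ring, Complex.exp_mul_I,
    ← Complex.ofReal_cos, ← Complex.ofReal_sin, Real.cos_neg, Real.sin_neg, Real.cos_pi_div_two,
    Real.sin_pi_div_two]
  simp

/-- The phase of `flatAmp` is a multiple of `π / 4`, which is why phases in `ampTerm` are taken in
units of `1 / (8 · 2 ^ n)` of a full turn. -/
theorem conj_codeVal_flatAmp (n : ℕ) :
    conj (codeVal (flatAmp n)) = (1 / Real.sqrt (2 ^ n : ℕ) : ℝ) * cis (n / 8) := by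
  have h1 : conj (codeVal (flatAmp n)) = ((1 + Complex.I) / 2) ^ n := by
    rw [codeVal, flatAmp]
    simp only [map_div₀, Complex.conj_natCast, map_pow]
    rw [div_pow, GaussianInt.toComplex_def']
    push_cast
    simp
  have h2 : (1 + Complex.I) / 2 = (1 / Real.sqrt 2 : ℝ) * cis (1 / 8) := by
    rw [cis_one_eighth, ← mul_assoc, ← Complex.ofReal_mul]
    have : 1 / Real.sqrt 2 * (Real.sqrt 2 / 2) = 1 / 2 := by
      have := Real.sqrt_ne_zero'.mpr (show (0 : ℝ) < 2 by norm_num)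
      field_simp
    rw [this]; push_cast; ring
  have h3 : ∀ m : ℕ, cis (1 / 8) ^ m = cis (m / 8) := by
    intro m
    induction m with
    | zero => simp [cis_zero]
    | succ m ih =>
      have : ((m + 1 : ℕ) : ℝ) / 8 = m / 8 + 1 / 8 := by push_cast; ring
      rw [pow_succ, this, cis_add, ih]
  rw [h1, h2, mul_pow, h3, ← Complex.ofReal_pow]
  congr 2
  rw [div_pow, one_pow]
  push_cast
  rw [Real.sqrt_eq_rpow, Real.sqrt_eq_rpow, ← Real.rpow_natCast, ← Real.rpow_mul (by norm_num),
    ← Real.rpow_natCast, ← Real.rpow_mul (by norm_num), mul_comm]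

theorem norm_sq_codeVal_flatAmp (n : ℕ) : ‖codeVal (flatAmp n)‖ ^ 2 = 1 / (2 ^ n : ℕ) := by
  rw [← Complex.norm_conj, conj_codeVal_flatAmp, norm_mul, norm_cis, mul_one, Complex.norm_real,
    Real.norm_eq_abs, sq_abs, div_pow, Real.sq_sqrt (by positivity), one_pow]

open scoped ComplexConjugate

/-- The task has a nonzero accuracy parameter, and the sampler `S` and the amplitude answers of the
task describe the normalized state `ψ` to the precision `T.k`. -/
structure Accurate (T : Task) (S : Prog) (ψ : Fin (2 ^ T.n) → ℂ) : Prop where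
  pos : 1 ≤ T.W
  norm : ∑ x, ‖ψ x‖ ^ 2 = 1
  sample : ∑ x : Fin (2 ^ T.n), |(S.law (.pair T.inst (.nat T.k)) (.nat x)).toReal - ‖ψ x‖ ^ 2| ≤
    (1 / 2) ^ T.k
  den : ∀ x : Fin (2 ^ T.n), 0 < (T.qv x).2
  query : ∀ x : Fin (2 ^ T.n), ‖codeVal (T.qv x) - ψ x‖ ≤ (1 / 2) ^ T.k

/-- Sanitizing the outputs of a sampler at most doubles its error. -/
theorem sum_abs_map_toLabel_sub_le {N : ℕ} [NeZero N] (p : PMF Data) (w : Fin N → ℝ)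
    (hw : ∑ x, w x = 1) {η : ℝ} (h : ∑ x : Fin N, |(p (.nat x)).toReal - w x| ≤ η) :
    ∑ x : Fin N, |(p.map (toLabel N) x).toReal - w x| ≤ 2 * η := by
  have hle : ∀ x : Fin N, (p (.nat x)).toReal ≤ (p.map (toLabel N) x).toReal := by
    intro x
    refine ENNReal.toReal_mono ((p.map (toLabel N)).apply_ne_top x) ?_
    rw [PMF.map_apply]
    refine le_trans (le_of_eq ?_) (ENNReal.le_tsum (Data.nat x))
    rw [if_pos]
    have : (0 : ℤ) ≤ (x : ℕ) ∧ ((x : ℕ) : ℤ) + 1 ≤ N := ⟨by omega, by have := x.2; omega⟩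
    simp only [Data.nat, toLabel]
    rw [if_pos this]
    simp
  have h1 : ∑ x : Fin N, |(p.map (toLabel N) x).toReal - (p (.nat x)).toReal| ≤ η := by
    calc _ = ∑ x : Fin N, (w x - (p (.nat x)).toReal) := by
          simp_rw [fun x : Fin N => abs_of_nonneg (sub_nonneg.mpr (hle x))]
          rw [Finset.sum_sub_distrib, Finset.sum_sub_distrib, sum_toReal_eq_one, hw]
      _ ≤ ∑ x : Fin N, |(p (.nat x)).toReal - w x| := Finset.sum_le_sum fun x _ => by
          rw [abs_sub_comm]; exact le_abs_self _
      _ ≤ η := h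
  calc _ ≤ ∑ x : Fin N, (|(p.map (toLabel N) x).toReal - (p (.nat x)).toReal| +
          |(p (.nat x)).toReal - w x|) := Finset.sum_le_sum fun x _ => abs_sub_le _ _ _
    _ ≤ 2 * η := by rw [Finset.sum_add_distrib]; linarith

namespace Accurate

variable {T : Task} {S : Prog} {ψ : Fin (2 ^ T.n) → ℂ} (hA : Accurate T S ψ)

include hA

theorem norm_le_one (x : Fin (2 ^ T.n)) : ‖ψ x‖ ≤ 1 := by
  have := Finset.single_le_sum (f := fun x => ‖ψ x‖ ^ 2) (fun _ _ => by positivity)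
    (Finset.mem_univ x)
  rw [hA.norm] at this
  exact (sq_le_one_iff₀ (norm_nonneg _)).mp this

/-- The precision is high enough for errors that add up over all `2 ^ n` basis labels. -/
theorem two_pow_mul_le : ((2 ^ T.n : ℕ) : ℝ) * (1 / 2) ^ T.k ≤ 1 / (256 * T.W) := by
  have hW : (0 : ℝ) < T.W := by exact_mod_cast hA.pos
  have h1 : (T.W : ℝ) ≤ 2 ^ T.W := by exact_mod_cast Nat.lt_two_pow_self.le
  rw [Task.k, pow_add, pow_add]
  push_cast
  rw [← mul_assoc, ← mul_assoc, ← mul_pow]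
  norm_num
  rw [one_div, inv_pow]
  exact inv_anti₀ hW h1

theorem eta_le : (1 / 2 : ℝ) ^ T.k ≤ 1 / (256 * T.W) := by
  refine le_trans ?_ hA.two_pow_mul_le
  have : (1 : ℝ) ≤ (2 ^ T.n : ℕ) := by exact_mod_cast Nat.one_le_two_pow
  exact le_mul_of_one_le_left (by positivity) this

/-- Replacing the law of the sampler by `‖ψ x‖²` and the estimator `h` by the ideal one changes the
mean little. -/
theorem abs_sum_map_sub_le (g g' : Fin (2 ^ T.n) → ℝ) {ε : ℝ} (hg : ∀ x, |g x| ≤ 2)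
    (hgg : ∀ x, |g x - g' x| ≤ ε) :
    |∑ x, (((S.law (.pair T.inst (.nat T.k))).map (toLabel (2 ^ T.n))) x).toReal * g x -
      ∑ x, ‖ψ x‖ ^ 2 * g' x| ≤ 4 * (1 / 2) ^ T.k + ε := by
  have h1 := sum_abs_map_toLabel_sub_le _ _ hA.norm hA.sample
  set D := (S.law (.pair T.inst (.nat T.k))).map (toLabel (2 ^ T.n)) with hD
  have e : ∑ x, (D x).toReal * g x - ∑ x, ‖ψ x‖ ^ 2 * g' x =
      ∑ x, (((D x).toReal - ‖ψ x‖ ^ 2) * g x + ‖ψ x‖ ^ 2 * (g x - g' x)) := by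
    rw [← Finset.sum_sub_distrib]
    exact Finset.sum_congr rfl fun x _ => by ring
  rw [e]
  calc _ ≤ ∑ x, (|(D x).toReal - ‖ψ x‖ ^ 2| * 2 + ‖ψ x‖ ^ 2 * ε) := by
        refine (Finset.abs_sum_le_sum_abs _ _).trans (Finset.sum_le_sum fun x _ => ?_)
        refine (abs_add_le _ _).trans ?_
        rw [abs_mul, abs_mul, abs_of_nonneg (by positivity : 0 ≤ ‖ψ x‖ ^ 2)]
        gcongr
        · exact hg x
        · exact hgg x
    _ = (∑ x, |(D x).toReal - ‖ψ x‖ ^ 2|) * 2 + ε := by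
        rw [Finset.sum_add_distrib, ← Finset.sum_mul, ← Finset.sum_mul, hA.norm, one_mul]
    _ ≤ _ := by linarith

/-- The error of one estimator that is due to rounding and to the approximation of `exp`. -/
theorem disc_le (l : List (ℕ × ℕ)) :
    (1 : ℝ) / (T.ctx l).B + 130 / (T.ctx l).kap ≤ 194 / (4096 * T.W) := by
  have hW : (0 : ℝ) < T.W := by exact_mod_cast hA.pos
  simp only [Ctx.B, Ctx.kap, Task.ctx]
  push_cast
  apply le_of_eq
  field_simp
  norm_num

/-- The mean of the weight estimator is close to the weight of the residue class. -/
theorem abs_mean_weightTerm_sub_le {s : ℤ} (hs : IsUnit s) {M Q : ℕ} (hMQ : M * Q = 2 ^ T.n)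
    (a : ℕ) (l : List (ℕ × ℕ)) :
    |mean (T.law S) (fun p => (weightTerm (T.ctx l) s a Q (valPair p) : ℝ) / (T.ctx l).B) -
      residueWeight s ψ M a| ≤ 1 / (8 * T.W) := by
  have hW : (0 : ℝ) < T.W := by exact_mod_cast hA.pos
  have hN : (0 : ℝ) < (2 ^ T.n : ℕ) := by positivity
  set c := T.ctx l with hc
  set ψ' : Fin (2 ^ T.n) → ℂ := fun x => codeVal (T.qv x) with hψ'
  have hterm : ∀ x r : Fin (2 ^ T.n), |(weightTerm c s a Q (valPair (x, r)) : ℝ) / c.B| ≤ 2 ∧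
      |(weightTerm c s a Q (valPair (x, r)) : ℝ) / c.B - overlapRatio (ψ' x)
        (ψ' (x + Fin.ofNat _ (r * Q))) (cis ((s * a * ((r : ℕ) * Q) : ℝ) / (2 ^ T.n : ℕ)))| ≤
        194 / (4096 * T.W) := by
    intro x r
    have hv : ((x + Fin.ofNat (2 ^ T.n) (r * Q) : Fin (2 ^ T.n)) : ℕ) =
        ((x : ℕ) + r * Q) % 2 ^ T.n := by
      rw [Fin.val_add, Fin.val_ofNat, Nat.add_mod_mod]
    have h1 : 0 < (c.qv (((x : ℕ) + r * Q) % 2 ^ T.n)).2 := by rw [← hv]; exact hA.den _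
    refine ⟨abs_estVal_le c hA.pos (hA.den x) h1 _ (by positivity), ?_⟩
    have h2 := (abs_estVal_sub_le c hA.pos (hA.den x) h1 (s * a * ((r : ℕ) * Q : ℕ))
      (Z := 2 ^ T.n) (by positivity)).trans (hA.disc_le l)
    rw [hψ']
    simp only [hv]
    push_cast at h2 ⊢
    exact h2
  have hmean : mean (T.law S) (fun p => (weightTerm c s a Q (valPair p) : ℝ) / c.B) =
      (1 / (2 ^ T.n : ℕ)) * ∑ r, ∑ x,
        (((S.law (.pair T.inst (.nat T.k))).map (toLabel (2 ^ T.n))) x).toReal *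
          ((weightTerm c s a Q (valPair (x, r)) : ℝ) / c.B) := by
    rw [mean, Fintype.sum_prod_type, Finset.sum_comm, Finset.mul_sum]
    refine Finset.sum_congr rfl fun r _ => ?_
    rw [Finset.mul_sum]
    refine Finset.sum_congr rfl fun x _ => ?_
    rw [Task.law, sampleLaw_apply]
    push_cast; ring
  have h1 : |(1 / (2 ^ T.n : ℕ)) * ∑ r, ∑ x,
        (((S.law (.pair T.inst (.nat T.k))).map (toLabel (2 ^ T.n))) x).toReal *
          ((weightTerm c s a Q (valPair (x, r)) : ℝ) / c.B) -
      (1 / (2 ^ T.n : ℕ) : ℝ) * ∑ r : Fin (2 ^ T.n), ∑ x : Fin (2 ^ T.n), ‖ψ x‖ ^ 2 *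
        overlapRatio (ψ' x) (ψ' (x + Fin.ofNat _ (r * Q)))
          (cis ((s * a * ((r : ℕ) * Q) : ℝ) / (2 ^ T.n : ℕ)))| ≤
      4 * (1 / 2) ^ T.k + 194 / (4096 * T.W) := by
    rw [← mul_sub, ← Finset.sum_sub_distrib, abs_mul, abs_of_pos (by positivity)]
    calc _ ≤ 1 / ((2 ^ T.n : ℕ) : ℝ) * ∑ r : Fin (2 ^ T.n),
          (4 * (1 / 2) ^ T.k + 194 / (4096 * T.W) : ℝ) := by
          gcongr
          refine (Finset.abs_sum_le_sum_abs _ _).trans (Finset.sum_le_sum fun r _ => ?_)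
          exact hA.abs_sum_map_sub_le _ _ (fun x => (hterm x r).1) (fun x => (hterm x r).2)
      _ = _ := by
          rw [Finset.sum_const, Finset.card_univ, Fintype.card_fin, nsmul_eq_mul, ← mul_assoc,
            one_div_mul_cancel hN.ne', one_mul]
  have h2 := abs_mean_overlapRatio_sub_residueWeight_le hs ψ ψ' hA.norm_le_one hA.query
    (pow_le_one₀ (by norm_num) (by norm_num)) hMQ a
  have h3 := hA.eta_le
  have h4 := hA.two_pow_mul_le
  rw [hmean]
  refine (abs_sub_le _ _ _).trans ((add_le_add h1 h2).trans ?_)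
  have h5 : (4 * (1 / (256 * T.W)) + 194 / (4096 * T.W) + 6 * (1 / (256 * T.W)) : ℝ) ≤
      1 / (8 * T.W) := by
    have e : (4 * (1 / (256 * T.W)) + 194 / (4096 * T.W) + 6 * (1 / (256 * T.W)) : ℝ) =
        (354 / 4096) * (1 / T.W) := by field_simp; norm_num
    have e' : (1 / (8 * T.W) : ℝ) = (1 / 8) * (1 / T.W) := by field_simp
    rw [e, e']
    exact mul_le_mul_of_nonneg_right (by norm_num) (by positivity)
  linarith

/-- The mean of the amplitude estimator, which uses both a sampled and a uniform label, is close to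
twice the real or the imaginary part of the Fourier coefficient. -/
theorem abs_mean_ampTerm_sub_le {s : ℤ} (y : Fin (2 ^ T.n)) (off : ℕ) (l : List (ℕ × ℕ)) :
    |mean (T.law S) (fun p => (ampTerm (T.ctx l) s y off p.1 + ampTerm (T.ctx l) s y off p.2 : ℝ) /
        (T.ctx l).B) - 2 * (cis (-(off / 8)) * fourier s ψ y).re| ≤ 1 / (6 * T.W) := by
  have hW : (0 : ℝ) < T.W := by exact_mod_cast hA.pos
  have hN : (0 : ℝ) < (2 ^ T.n : ℕ) := by positivity
  set c := T.ctx l with hc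
  set ψ' : Fin (2 ^ T.n) → ℂ := fun x => codeVal (T.qv x) with hψ'
  set ph : Fin (2 ^ T.n) → ℂ := fun x =>
    cis (((8 * s * (x : ℕ) * (y : ℕ) - T.n * 2 ^ T.n - off * 2 ^ T.n : ℤ) : ℝ) /
      (8 * 2 ^ T.n : ℕ)) with hph
  set D := (S.law (.pair T.inst (.nat T.k))).map (toLabel (2 ^ T.n)) with hD
  set α := codeVal (flatAmp T.n) with hα
  set g : Fin (2 ^ T.n) → ℝ := fun x => (ampTerm c s y off x : ℝ) / c.B with hg
  have hterm : ∀ x : Fin (2 ^ T.n), |g x| ≤ 2 ∧ |g x - overlapRatio α (ψ' x) (ph x)| ≤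
      194 / (4096 * T.W) := by
    intro x
    have h0 : 0 < (flatAmp T.n).2 := by simp [flatAmp]
    refine ⟨abs_estVal_le c hA.pos h0 (hA.den x) _ (by positivity), ?_⟩
    have h2 := (abs_estVal_sub_le c hA.pos h0 (hA.den x)
      (8 * s * (x : ℕ) * (y : ℕ) - T.n * 2 ^ T.n - off * 2 ^ T.n)
      (Z := 8 * 2 ^ T.n) (by positivity)).trans (hA.disc_le l)
    simp only [hg, ampTerm, hph]
    exact h2
  have hmean : mean (T.law S) (fun p => (ampTerm c s y off p.1 + ampTerm c s y off p.2 : ℝ) / c.B) =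
      ∑ x, (D x).toReal * g x + ∑ x, 1 / ((2 ^ T.n : ℕ) : ℝ) * g x := by
    have h1 : ∀ p, (T.law S p).toReal = (D p.1).toReal * (1 / ((2 ^ T.n : ℕ) : ℝ)) := by
      rintro ⟨x, r⟩
      rw [Task.law, sampleLaw_apply]
      push_cast; rfl
    have hD1 : ∑ x, (D x).toReal = 1 := sum_toReal_eq_one D
    simp only [mean, h1, add_div, mul_add, Finset.sum_add_distrib]
    rw [Fintype.sum_prod_type, Fintype.sum_prod_type]
    congr 1
    · refine Finset.sum_congr rfl fun x _ => ?_
      simp only [Finset.sum_const, Finset.card_univ, Fintype.card_fin, nsmul_eq_mul]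
      rw [mul_one_div, ← mul_assoc, mul_div_cancel₀ _ hN.ne']
    · simp only [mul_assoc]
      simp_rw [← Finset.mul_sum]
      rw [← Finset.sum_mul, hD1, one_mul]
  have h1 := hA.abs_sum_map_sub_le g (fun x => overlapRatio α (ψ' x) (ph x))
    (fun x => (hterm x).1) (fun x => (hterm x).2)
  have h2 : |∑ x, 1 / ((2 ^ T.n : ℕ) : ℝ) * g x -
      ∑ x, 1 / ((2 ^ T.n : ℕ) : ℝ) * overlapRatio α (ψ' x) (ph x)| ≤ 194 / (4096 * T.W) := by
    rw [← Finset.mul_sum, ← Finset.mul_sum, ← mul_sub, ← Finset.sum_sub_distrib, abs_mul,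
      abs_of_pos (by positivity)]
    calc _ ≤ 1 / ((2 ^ T.n : ℕ) : ℝ) * ∑ x : Fin (2 ^ T.n), (194 / (4096 * T.W) : ℝ) := by
          gcongr
          refine (Finset.abs_sum_le_sum_abs _ _).trans (Finset.sum_le_sum fun x _ => ?_)
          exact (hterm x).2
      _ = _ := by
          rw [Finset.sum_const, Finset.card_univ, Fintype.card_fin, nsmul_eq_mul, ← mul_assoc,
            one_div_mul_cancel hN.ne', one_mul]
  have h3 := abs_sum_overlapRatio_sub_le ψ ψ' hA.norm_le_one hA.query
    (pow_le_one₀ (by norm_num) (by norm_num)) α (norm_sq_codeVal_flatAmp T.n) ph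
    (fun x => (norm_cis _).le)
  have h4 : ∑ x, conj α * ψ x * ph x = cis (-(off / 8)) * fourier s ψ y := by
    rw [fourier, ← mul_assoc, Finset.mul_sum]
    refine Finset.sum_congr rfl fun x _ => ?_
    have e : ((8 * s * (x : ℕ) * (y : ℕ) - T.n * 2 ^ T.n - off * 2 ^ T.n : ℤ) : ℝ) /
          (8 * 2 ^ T.n : ℕ) =
        (s * ((x : ℕ) * (y : ℕ)) : ℝ) / (2 ^ T.n : ℕ) + (-(T.n / 8 : ℝ) + -(off / 8)) := by
      push_cast; field_simp; ring
    have e2 : cis (T.n / 8 : ℝ) * cis (-(T.n / 8 : ℝ)) = 1 := by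
      rw [← cis_add, add_neg_cancel, cis_zero]
    simp only [hph]
    rw [e, cis_add, cis_add, hα, conj_codeVal_flatAmp]
    linear_combination ((1 / Real.sqrt (2 ^ T.n : ℕ) : ℝ) : ℂ) * ψ x *
      cis ((s * ((x : ℕ) * (y : ℕ)) : ℝ) / (2 ^ T.n : ℕ)) * cis (-(off / 8)) * e2
  rw [h4] at h3
  have h5 := hA.eta_le
  have h6 := hA.two_pow_mul_le
  have h7 : ∑ x : Fin (2 ^ T.n), (‖ψ x‖ ^ 2 + 1 / ((2 ^ T.n : ℕ) : ℝ)) *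
        overlapRatio α (ψ' x) (ph x) =
      ∑ x, ‖ψ x‖ ^ 2 * overlapRatio α (ψ' x) (ph x) +
      ∑ x, 1 / ((2 ^ T.n : ℕ) : ℝ) * overlapRatio α (ψ' x) (ph x) := by
    rw [← Finset.sum_add_distrib]
    exact Finset.sum_congr rfl fun x _ => by ring
  rw [h7] at h3
  rw [hmean]
  have h8 : (4 * (1 / (256 * T.W)) + 2 * (194 / (4096 * T.W)) + 12 * (1 / (256 * T.W)) : ℝ) ≤
      1 / (6 * T.W) := by
    have e : (4 * (1 / (256 * T.W)) + 2 * (194 / (4096 * T.W)) + 12 * (1 / (256 * T.W)) : ℝ) =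
        (644 / 4096) * (1 / T.W) := by field_simp; norm_num
    have e' : (1 / (6 * T.W) : ℝ) = (1 / 6) * (1 / T.W) := by field_simp
    rw [e, e']
    exact mul_le_mul_of_nonneg_right (by norm_num) (by positivity)
  have h1' := abs_le.mp h1
  have h2' := abs_le.mp h2
  have h3' := abs_le.mp h3
  rw [abs_le]
  constructor <;> linarith

end Accurate

/-! ### Concentration of all estimates -/

/-- Samples for which all estimates that the algorithm may use are accurate. -/
def Task.Good (T : Task) (s : ℤ) (ψ : Fin (2 ^ T.n) → ℂ)
    (l : List (Fin (2 ^ T.n) × Fin (2 ^ T.n))) : Prop :=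
  (∀ m ≤ T.n, ∀ a < 2 ^ m,
    |(weightSum (T.ctx (l.map valPair)) s a (2 ^ (T.n - m)) : ℝ) / (T.K * (64 * T.W)) -
      residueWeight s ψ (2 ^ m) a| ≤ 1 / (4 * T.W)) ∧
  ∀ y : Fin (2 ^ T.n),
    |(ampSum (T.ctx (l.map valPair)) s y 0 : ℝ) / (2 * T.K * (64 * T.W)) - (fourier s ψ y).re| ≤
      1 / (6 * T.W) ∧
    |(ampSum (T.ctx (l.map valPair)) s y 2 : ℝ) / (2 * T.K * (64 * T.W)) - (fourier s ψ y).im| ≤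
      1 / (6 * T.W)

namespace Accurate

variable {T : Task} {S : Prog} {ψ : Fin (2 ^ T.n) → ℂ} (hA : Accurate T S ψ)

include hA

theorem K_pos : 0 < T.K := by
  have := hA.pos
  rw [Task.K]; positivity

/-- Hoeffding's inequality for the number `K` of samples of the algorithm. -/
theorem deviation_le (h : Fin (2 ^ T.n) × Fin (2 ^ T.n) → ℝ) (M : ℝ) (hM : 0 < M)
    (hh : ∀ p, |h p| ≤ M) :
    (iidList (T.law S) T.K).toOuterMeasure {l | T.K * (M / (32 * T.W)) ≤
      |(l.map h).sum - T.K * mean (T.law S) h|} ≤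
      ENNReal.ofReal (2 * Real.exp (-((T.n + T.L + 3 : ℕ) : ℝ))) := by
  have hW : (1 : ℝ) ≤ T.W := by exact_mod_cast hA.pos
  refine (iidList_deviation_le (T.law S) h M (M / (32 * T.W)) hM hh (by positivity) ?_ T.K).trans ?_
  · rw [div_le_iff₀ (by positivity)]; nlinarith
  · refine ENNReal.ofReal_le_ofReal (le_of_eq ?_)
    congr 3
    rw [Task.K]
    push_cast
    field_simp
    norm_num

/-- The estimates of the weight are accurate unless the samples deviate from the mean. -/
theorem weight_of_deviation {s : ℤ} (hs : IsUnit s) {m : ℕ} (hm : m ≤ T.n) (a : ℕ)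
    {l : List (Fin (2 ^ T.n) × Fin (2 ^ T.n))}
    (h : ¬ T.K * ((2 : ℝ) / (32 * T.W)) ≤
      |(l.map fun p => (weightTerm (T.ctx []) s a (2 ^ (T.n - m)) (valPair p) : ℝ) /
        (T.ctx []).B).sum - T.K * mean (T.law S) fun p =>
          (weightTerm (T.ctx []) s a (2 ^ (T.n - m)) (valPair p) : ℝ) / (T.ctx []).B|) :
    |(weightSum (T.ctx (l.map valPair)) s a (2 ^ (T.n - m)) : ℝ) / (T.K * (64 * T.W)) -
      residueWeight s ψ (2 ^ m) a| ≤ 1 / (4 * T.W) := by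
  have hW : (0 : ℝ) < T.W := by exact_mod_cast hA.pos
  have hK : (0 : ℝ) < T.K := by exact_mod_cast hA.K_pos
  have h1 := hA.abs_mean_weightTerm_sub_le hs (M := 2 ^ m) (Q := 2 ^ (T.n - m))
    (by rw [← pow_add]; congr 1; omega) a []
  set μ := mean (T.law S) fun p =>
    (weightTerm (T.ctx []) s a (2 ^ (T.n - m)) (valPair p) : ℝ) / (T.ctx []).B with hμ
  have hsum : (l.map fun p => (weightTerm (T.ctx []) s a (2 ^ (T.n - m)) (valPair p) : ℝ) /
        (T.ctx []).B).sum =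
      (weightSum (T.ctx (l.map valPair)) s a (2 ^ (T.n - m)) : ℝ) / (64 * T.W) := by
    have hB : ((T.ctx []).B : ℝ) = 64 * T.W := by simp [Ctx.B, Task.ctx]
    rw [weightSum, hB]
    simp only [div_eq_mul_inv]
    rw [List.sum_map_mul_right, Int.cast_list_sum]
    simp [Task.ctx, List.map_map, Function.comp_def, weightTerm, estVal, Ctx.B, Ctx.kap]
  rw [hsum] at h
  push Not at h
  have h2 : |(weightSum (T.ctx (l.map valPair)) s a (2 ^ (T.n - m)) : ℝ) / (T.K * (64 * T.W)) - μ| ≤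
      2 / (32 * T.W) := by
    have e : (weightSum (T.ctx (l.map valPair)) s a (2 ^ (T.n - m)) : ℝ) / (T.K * (64 * T.W)) - μ =
        ((weightSum (T.ctx (l.map valPair)) s a (2 ^ (T.n - m)) : ℝ) / (64 * T.W) - T.K * μ) /
          T.K := by field_simp
    rw [e, abs_div, abs_of_pos hK, div_le_iff₀ hK]
    exact h.le.trans (le_of_eq (mul_comm _ _))
  refine (abs_sub_le _ μ _).trans ((add_le_add h2 h1).trans ?_)
  have e : (2 / (32 * T.W) + 1 / (8 * T.W) : ℝ) = (3 / 16) * (1 / T.W) := by field_simp; norm_num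
  have e' : (1 / (4 * T.W) : ℝ) = (1 / 4) * (1 / T.W) := by field_simp
  rw [e, e']
  exact mul_le_mul_of_nonneg_right (by norm_num) (by positivity)

/-- The estimates of the amplitude are accurate unless the samples deviate from the mean. -/
theorem amp_of_deviation {s : ℤ} (y : Fin (2 ^ T.n)) (off : ℕ)
    {l : List (Fin (2 ^ T.n) × Fin (2 ^ T.n))}
    (h : ¬ T.K * ((4 : ℝ) / (32 * T.W)) ≤
      |(l.map fun p => (ampTerm (T.ctx []) s y off p.1 + ampTerm (T.ctx []) s y off p.2 : ℝ) /
        (T.ctx []).B).sum - T.K * mean (T.law S) fun p =>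
          (ampTerm (T.ctx []) s y off p.1 + ampTerm (T.ctx []) s y off p.2 : ℝ) / (T.ctx []).B|) :
    |(ampSum (T.ctx (l.map valPair)) s y off : ℝ) / (2 * T.K * (64 * T.W)) -
      (cis (-(off / 8)) * fourier s ψ y).re| ≤ 1 / (6 * T.W) := by
  have hW : (0 : ℝ) < T.W := by exact_mod_cast hA.pos
  have hK : (0 : ℝ) < T.K := by exact_mod_cast hA.K_pos
  have h1 := hA.abs_mean_ampTerm_sub_le (s := s) y off []
  set μ := mean (T.law S) fun p =>
    (ampTerm (T.ctx []) s y off p.1 + ampTerm (T.ctx []) s y off p.2 : ℝ) / (T.ctx []).B with hμ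
  set v := (cis (-(off / 8)) * fourier s ψ y).re with hv
  have hsum : (l.map fun p =>
        (ampTerm (T.ctx []) s y off p.1 + ampTerm (T.ctx []) s y off p.2 : ℝ) /
          (T.ctx []).B).sum = (ampSum (T.ctx (l.map valPair)) s y off : ℝ) / (64 * T.W) := by
    have hB : ((T.ctx []).B : ℝ) = 64 * T.W := by simp [Ctx.B, Task.ctx]
    rw [ampSum, hB]
    simp only [div_eq_mul_inv]
    rw [List.sum_map_mul_right, Int.cast_list_sum]
    simp [Task.ctx, List.map_map, Function.comp_def, ampTerm, estVal, Ctx.B, Ctx.kap, valPair]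
  rw [hsum] at h
  push Not at h
  set w := (ampSum (T.ctx (l.map valPair)) s y off : ℝ) with hw
  have h2 : |w / (2 * T.K * (64 * T.W)) - μ / 2| ≤ 2 / (32 * T.W) := by
    have e : w / (2 * T.K * (64 * T.W)) - μ / 2 = (w / (64 * T.W) - T.K * μ) / (2 * T.K) := by
      field_simp
    rw [e, abs_div, abs_of_pos (by positivity : (0 : ℝ) < 2 * T.K), div_le_iff₀ (by positivity)]
    refine h.le.trans (le_of_eq ?_)
    field_simp
    norm_num
  have h3 : |μ / 2 - v| ≤ 1 / (12 * T.W) := by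
    have e : μ / 2 - v = (μ - 2 * v) / 2 := by ring
    rw [e, abs_div, abs_two, div_le_iff₀ (by norm_num)]
    refine h1.trans (le_of_eq ?_)
    field_simp
    norm_num
  refine (abs_sub_le _ (μ / 2) _).trans ((add_le_add h2 h3).trans ?_)
  have e : (2 / (32 * T.W) + 1 / (12 * T.W) : ℝ) = (7 / 48) * (1 / T.W) := by field_simp; norm_num
  have e' : (1 / (6 * T.W) : ℝ) = (1 / 6) * (1 / T.W) := by field_simp
  rw [e, e']
  exact mul_le_mul_of_nonneg_right (by norm_num) (by positivity)

/-- A union bound over all residue classes modulo powers of `2` and over all labels: with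
probability at least `1 - 2 ^ (-L)`, all estimates are accurate. -/
theorem one_sub_le_good {s : ℤ} (hs : IsUnit s) :
    ENNReal.ofReal (1 - (1 / 2) ^ T.L) ≤
      (iidList (T.law S) T.K).toOuterMeasure {l | T.Good s ψ l} := by
  classical
  set μ := (iidList (T.law S) T.K).toOuterMeasure with hμ
  set b := ENNReal.ofReal (2 * Real.exp (-((T.n + T.L + 3 : ℕ) : ℝ))) with hb
  let hw : ℕ → ℕ → Fin (2 ^ T.n) × Fin (2 ^ T.n) → ℝ := fun m a p =>
    (weightTerm (T.ctx []) s a (2 ^ (T.n - m)) (valPair p) : ℝ) / (T.ctx []).B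
  let ha : ℕ → Fin (2 ^ T.n) → Fin (2 ^ T.n) × Fin (2 ^ T.n) → ℝ := fun off y p =>
    (ampTerm (T.ctx []) s y off p.1 + ampTerm (T.ctx []) s y off p.2 : ℝ) / (T.ctx []).B
  let bad : (Fin (2 ^ T.n) × Fin (2 ^ T.n) → ℝ) → ℝ → Set (List (Fin (2 ^ T.n) × Fin (2 ^ T.n))) :=
    fun h M => {l | T.K * (M / (32 * T.W)) ≤ |(l.map h).sum - T.K * mean (T.law S) h|}
  have hdw : ∀ m a, μ (bad (hw m a) 2) ≤ b := by
    intro m a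
    refine hA.deviation_le _ 2 (by norm_num) fun p => ?_
    exact abs_estVal_le _ hA.pos (hA.den p.1)
      (hA.den ⟨((p.1 : ℕ) + p.2 * 2 ^ (T.n - m)) % 2 ^ T.n, Nat.mod_lt _ (by positivity)⟩) _
      (pow_pos (by norm_num) _)
  have hda : ∀ off y, μ (bad (ha off y) 4) ≤ b := by
    intro off y
    refine hA.deviation_le _ 4 (by norm_num) fun p => ?_
    have h0 : 0 < (flatAmp T.n).2 := by simp [flatAmp]
    have h1 : ∀ x : Fin (2 ^ T.n), |(ampTerm (T.ctx []) s y off x : ℝ) / (T.ctx []).B| ≤ 2 :=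
      fun x => abs_estVal_le _ hA.pos h0 (hA.den x) _
        (Nat.mul_pos (by norm_num) (pow_pos (by norm_num) _))
    simp only [ha]
    rw [add_div]
    exact (abs_add_le _ _).trans ((add_le_add (h1 p.1) (h1 p.2)).trans (by norm_num))
  let U : Set (List (Fin (2 ^ T.n) × Fin (2 ^ T.n))) :=
    (⋃ m ∈ Finset.range (T.n + 1), ⋃ a ∈ Finset.range (2 ^ m), bad (hw m a) 2) ∪
      ((⋃ y ∈ (Finset.univ : Finset (Fin (2 ^ T.n))), bad (ha 0 y) 4) ∪
        ⋃ y ∈ (Finset.univ : Finset (Fin (2 ^ T.n))), bad (ha 2 y) 4)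
  have hgood : ∀ l, l ∉ U → T.Good s ψ l := by
    intro l hl
    simp only [U, Set.mem_union, Set.mem_iUnion, not_or, not_exists, Finset.mem_range,
      Finset.mem_univ, true_implies] at hl
    obtain ⟨h1, h2, h3⟩ := hl
    refine ⟨fun m hm a ham => hA.weight_of_deviation hs hm a (h1 m (by omega) a ham), fun y => ?_⟩
    have h4 := hA.amp_of_deviation y 0 (h2 y)
    have h5 := hA.amp_of_deviation y 2 (h3 y)
    have e4 : (cis (-((0 : ℕ) / 8)) * fourier s ψ y).re = (fourier s ψ y).re := by
      simp [cis_zero]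
    have e5 : (cis (-((2 : ℕ) / 8)) * fourier s ψ y).re = (fourier s ψ y).im := by
      have : (-((2 : ℕ) / 8) : ℝ) = -(1 / 4) := by norm_num
      rw [this, cis_neg_one_fourth]; simp
    rw [e4] at h4
    rw [e5] at h5
    exact ⟨h4, h5⟩
  have hU : μ U ≤ ENNReal.ofReal ((1 / 2) ^ T.L) := by
    have h1 : μ (⋃ m ∈ Finset.range (T.n + 1), ⋃ a ∈ Finset.range (2 ^ m), bad (hw m a) 2) ≤
        (2 ^ (T.n + 1) : ℕ) * b := by
      refine (MeasureTheory.measure_biUnion_finset_le _ _).trans ?_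
      calc _ ≤ ∑ m ∈ Finset.range (T.n + 1), ((2 ^ m : ℕ) : ENNReal) * b := by
            refine Finset.sum_le_sum fun m _ => ?_
            refine (MeasureTheory.measure_biUnion_finset_le _ _).trans ?_
            refine (Finset.sum_le_sum fun a _ => hdw m a).trans (le_of_eq ?_)
            simp
        _ ≤ _ := by
            rw [← Finset.sum_mul, ← Nat.cast_sum]
            gcongr
            rw [Nat.geomSum_eq le_rfl]
            simp
    have h2 : ∀ off, μ (⋃ y ∈ (Finset.univ : Finset (Fin (2 ^ T.n))), bad (ha off y) 4) ≤
        (2 ^ T.n : ℕ) * b := by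
      intro off
      refine (MeasureTheory.measure_biUnion_finset_le _ _).trans ?_
      refine (Finset.sum_le_sum fun y _ => hda off y).trans (le_of_eq ?_)
      simp
    calc μ U ≤ (2 ^ (T.n + 1) : ℕ) * b + ((2 ^ T.n : ℕ) * b + (2 ^ T.n : ℕ) * b) :=
          (MeasureTheory.measure_union_le _ _).trans (add_le_add h1
            ((MeasureTheory.measure_union_le _ _).trans (add_le_add (h2 0) (h2 2))))
      _ = ENNReal.ofReal ((2 ^ (T.n + 2) : ℕ) * (2 * Real.exp (-((T.n + T.L + 3 : ℕ) : ℝ)))) := by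
          rw [← add_mul, ← add_mul, ENNReal.ofReal_mul (by positivity), ENNReal.ofReal_natCast,
            ← Nat.cast_add, ← Nat.cast_add]
          congr 2
          ring
      _ ≤ _ := by
          refine ENNReal.ofReal_le_ofReal ?_
          have h3 : (2 : ℝ) ^ (T.n + T.L + 3) ≤ Real.exp ((T.n + T.L + 3 : ℕ) : ℝ) := by
            rw [← mul_one ((T.n + T.L + 3 : ℕ) : ℝ), Real.exp_nat_mul]
            gcongr
            have := Real.add_one_le_exp (1 : ℝ)
            linarith
          rw [Real.exp_neg]
          calc _ ≤ ((2 ^ (T.n + 2) : ℕ) : ℝ) * (2 * ((2 : ℝ) ^ (T.n + T.L + 3))⁻¹) := by gcongr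
            _ = _ := by
                push_cast
                rw [one_div, inv_pow, pow_add _ (T.n + T.L), pow_add _ T.n, pow_add _ T.n]
                field_simp
  have h1 : (1 : ENNReal) ≤ μ {l | T.Good s ψ l} + μ U := by
    rw [← ((iidList (T.law S) T.K).toOuterMeasure_apply_eq_one_iff Set.univ).2 (Set.subset_univ _)]
    refine le_trans (MeasureTheory.measure_mono ?_) (MeasureTheory.measure_union_le _ _)
    intro l _
    by_cases hl : l ∈ U
    · exact Or.inr hl
    · exact Or.inl (hgood l hl)
  rw [ENNReal.ofReal_sub _ (by positivity), ENNReal.ofReal_one, tsub_le_iff_right]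
  exact h1.trans (by gcongr)

end Accurate

/-! ### Correctness of the search -/

theorem residueWeight_le_of_modEq {N : ℕ} (s : ℤ) (ψ : Fin N → ℂ) {M M' a a' : ℕ} (hM : M ∣ M')
    (ha : a' ≡ a [MOD M]) : residueWeight s ψ M' a' ≤ residueWeight s ψ M a := by
  refine Finset.sum_le_sum_of_subset_of_nonneg (fun y hy => ?_) fun _ _ _ => by positivity
  simp only [Finset.mem_filter, Finset.mem_univ, true_and] at hy ⊢
  exact (hy.of_dvd hM).trans ha

theorem residueWeight_one {N : ℕ} [NeZero N] {s : ℤ} (hs : IsUnit s) (ψ : Fin N → ℂ) (a : ℕ) :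
    residueWeight s ψ 1 a = ∑ x, ‖ψ x‖ ^ 2 := by
  rw [residueWeight, ← sum_norm_sq_fourier hs, Finset.filter_true_of_mem]
  exact fun y _ => Nat.modEq_one

section

variable {T : Task} {S : Prog} {ψ : Fin (2 ^ T.n) → ℂ} {s : ℤ}
  {l : List (Fin (2 ^ T.n) × Fin (2 ^ T.n))}

theorem Accurate.heavy_iff (hA : Accurate T S ψ) {q b : ℕ} :
    Heavy (T.ctx (l.map valPair)) s q b ↔ (3 : ℝ) / (4 * T.W) ≤
      (weightSum (T.ctx (l.map valPair)) s b q : ℝ) / (T.K * (64 * T.W)) := by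
  have hW : (0 : ℝ) < T.W := by exact_mod_cast hA.pos
  have hK : (0 : ℝ) < T.K := by exact_mod_cast hA.K_pos
  have e : (3 : ℝ) / (4 * T.W) = (48 * T.K) / (T.K * (64 * T.W)) := by field_simp; norm_num
  rw [e, div_le_div_iff_of_pos_right (by positivity), Heavy]
  have : (T.ctx (l.map valPair)).K = T.K := rfl
  rw [this]
  exact_mod_cast Iff.rfl

/-- For good samples, the residues that are kept have weight at least `1 / (2 W)`, so that there are
at most `2 W` of them, and no residue of weight at least `1 / W` is lost. -/
theorem Accurate.treeList_spec (hA : Accurate T S ψ) (hs : IsUnit s) (hl : T.Good s ψ l) {m : ℕ}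
    (hm : m ≤ T.n) :
    (treeList (T.ctx (l.map valPair)) s m).length ≤ 2 * T.W ∧
      ∀ a < 2 ^ m, 1 / (T.W : ℝ) ≤ residueWeight s ψ (2 ^ m) a →
        a ∈ treeList (T.ctx (l.map valPair)) s m := by
  have hW : (1 : ℝ) ≤ T.W := by exact_mod_cast hA.pos
  set c := T.ctx (l.map valPair) with hc
  have e1 : (3 / (4 * T.W) : ℝ) = 1 / T.W - 1 / (4 * T.W) := by field_simp; norm_num
  have e2 : (1 / (2 * T.W) : ℝ) = 3 / (4 * T.W) - 1 / (4 * T.W) := by field_simp; norm_num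
  have hlen : ∀ m, (∀ a ∈ treeList c s m, 1 / (2 * T.W : ℝ) ≤ residueWeight s ψ (2 ^ m) a) →
      (treeList c s m).length ≤ 2 * T.W := by
    intro m h
    have h1 := sum_residueWeight_le hs ψ (2 ^ m) (treeList c s m).toFinset
      (fun a ha => lt_of_mem_treeList (by simpa using ha))
    rw [hA.norm] at h1
    have h2 := Finset.card_nsmul_le_sum (treeList c s m).toFinset (residueWeight s ψ (2 ^ m)) _
      fun a ha => h a (by simpa using ha)
    rw [List.toFinset_card_of_nodup (nodup_treeList c s m), nsmul_eq_mul, mul_one_div] at h2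
    have h3 := (div_le_one (by positivity)).mp (h2.trans h1)
    exact_mod_cast h3
  suffices h : (∀ a ∈ treeList c s m, 1 / (2 * T.W : ℝ) ≤ residueWeight s ψ (2 ^ m) a) ∧
      ∀ a < 2 ^ m, 1 / (T.W : ℝ) ≤ residueWeight s ψ (2 ^ m) a → a ∈ treeList c s m from
    ⟨hlen m h.1, h.2⟩
  induction m with
  | zero =>
    refine ⟨fun a _ => ?_, fun a ha _ => ?_⟩
    · rw [pow_zero, residueWeight_one hs, hA.norm, div_le_one (by positivity)]
      linarith
    · have : a = 0 := by simpa using ha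
      simp [treeList, this]
  | succ m ih =>
    obtain ⟨ih1, ih2⟩ := ih (by omega)
    have htake : (treeList c s m).take c.cap = treeList c s m :=
      List.take_of_length_le (hlen m ih1)
    have hmem : ∀ d, d ∈ treeList c s (m + 1) ↔ Heavy c s (2 ^ (T.n - (m + 1))) d ∧
        ∃ a ∈ treeList c s m, d = a ∨ d = a + 2 ^ m := by
      intro d
      rw [treeList, levelList, mem_foldl_pushBoth, htake]
      simp [hc, Task.ctx]
    refine ⟨fun a ha => ?_, fun a ha hw => ?_⟩
    · have h1 := hA.heavy_iff.mp ((hmem a).mp ha).1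
      have h2 := abs_le.mp (hl.1 (m + 1) hm a (lt_of_mem_treeList ha))
      linarith [h2.2]
    · refine (hmem a).mpr ⟨?_, a % 2 ^ m, ih2 _ (Nat.mod_lt _ (by positivity)) ?_, ?_⟩
      · have h2 := abs_le.mp (hl.1 (m + 1) hm a ha)
        refine hA.heavy_iff.mpr ?_
        linarith [h2.1]
      · refine hw.trans (residueWeight_le_of_modEq s ψ (pow_dvd_pow 2 (Nat.le_succ m)) ?_)
        exact (Nat.mod_modEq _ _).symm
      · have h1 := Nat.mod_add_div a (2 ^ m)
        have h2 : a / 2 ^ m < 2 := by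
          rw [Nat.div_lt_iff_lt_mul (by positivity), mul_comm, ← pow_succ]; exact ha
        generalize a / 2 ^ m = j at h1 h2
        interval_cases j <;> simp at h1 <;> omega

end

/-! ### Normalization by a rational reflection -/

/-- The reflection of a unit vector `u` in the real line through `v + u` is a unit vector, whose
distance to `v` is at most `√2` times that of `v / ‖v‖`. It depends rationally on the coordinates,
unlike `v / ‖v‖`. -/
theorem norm_reflection {E : Type} [NormedAddCommGroup E] [InnerProductSpace ℂ E] {u v : E}
    (hu : ‖u‖ = 1) (h : 0 ≤ (inner ℂ v u).re) :
    ‖((2 * (1 + (inner ℂ v u).re) / ‖v + u‖ ^ 2 : ℝ) : ℂ) • (v + u) - u‖ = 1 ∧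
      ‖((2 * (1 + (inner ℂ v u).re) / ‖v + u‖ ^ 2 : ℝ) : ℂ) • (v + u) - u - v‖ ≤
        Real.sqrt 2 * |1 - ‖v‖| := by
  set g := 1 + (inner ℂ v u).re with hg
  have hz : ‖v + u‖ ^ 2 = ‖v‖ ^ 2 + 2 * g - 1 := by
    rw [norm_add_sq (𝕜 := ℂ), hu, hg]
    simp only [RCLike.re_to_complex]; ring
  have hzu : (inner ℂ (v + u) u).re = g := by
    rw [inner_add_left, inner_self_eq_norm_sq_to_K, hu, hg]
    simp [add_comm]
  set Z := ‖v + u‖ ^ 2 with hZ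
  have hZpos : 0 < Z := by nlinarith [sq_nonneg ‖v‖]
  constructor
  · rw [← sq_eq_sq₀ (norm_nonneg _) (by norm_num), norm_sub_sq (𝕜 := ℂ), hu, norm_smul, mul_pow,
      ← hZ, inner_smul_left, Complex.norm_real, Real.norm_eq_abs, sq_abs, Complex.conj_ofReal,
      RCLike.re_to_complex, Complex.re_ofReal_mul, hzu]
    field_simp
    ring
  · have e : ((2 * g / Z : ℝ) : ℂ) • (v + u) - u - v = ((2 * g / Z - 1 : ℝ) : ℂ) • (v + u) := by
      push_cast; rw [sub_smul, one_smul]; abel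
    rw [e, norm_smul, Complex.norm_real, Real.norm_eq_abs]
    refine abs_le_of_sq_le_sq' ?_ (by positivity) |>.2
    rw [mul_pow, mul_pow, sq_abs, sq_abs, Real.sq_sqrt (by norm_num), ← hZ]
    have h1 : (2 * g / Z - 1) ^ 2 * Z = (1 - ‖v‖ ^ 2) ^ 2 / Z := by
      have : 2 * g = Z + (1 - ‖v‖ ^ 2) := by linarith
      rw [this]; field_simp; ring
    rw [h1, div_le_iff₀ hZpos]
    have h2 : (1 - ‖v‖ ^ 2) ^ 2 = (1 - ‖v‖) ^ 2 * (1 + ‖v‖) ^ 2 := by ring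
    rw [h2]
    have h3 : (1 + ‖v‖) ^ 2 ≤ 2 * Z := by nlinarith [sq_nonneg (1 - ‖v‖)]
    nlinarith [mul_le_mul_of_nonneg_left h3 (sq_nonneg (1 - ‖v‖))]

/-- The estimated state on the first `cap` candidates and on the label `0`. -/
noncomputable def estState (c : Ctx) (s : ℤ) (L : List ℕ) : Qubits c.n :=
  WithLp.toLp 2 fun y => if (y : ℕ) = 0 ∨ (y : ℕ) ∈ L.take c.cap then
    (ampVec c s y : ℂ) / (2 * c.K * c.B : ℕ) else 0

theorem ampSq_eq (c : Ctx) (s : ℤ) (y : ℕ) : (ampSq c s y : ℝ) = ‖(ampVec c s y : ℂ)‖ ^ 2 := by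
  rw [← Complex.normSq_eq_norm_sq, Complex.normSq_apply, ampVec, ampSq]
  simp

theorem ampSq_nonneg (c : Ctx) (s : ℤ) (y : ℕ) : 0 ≤ ampSq c s y :=
  add_nonneg (mul_self_nonneg _) (mul_self_nonneg _)

section

variable {c : Ctx} {s : ℤ} {L : List ℕ}

theorem zeroSign_mul_self : zeroSign c s * zeroSign c s = 1 := by
  unfold zeroSign; split_ifs <;> norm_num

theorem zeroSign_mul_nonneg : 0 ≤ zeroSign c s * ampSum c s 0 0 := by
  unfold zeroSign; split_ifs <;> linarith

/-- The unit vector that is reflected: plus or minus the basis vector at `0`, with the sign for which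
the real part of its inner product with the estimated state is not negative. -/
noncomputable def axisState (c : Ctx) (s : ℤ) : Qubits c.n :=
  EuclideanSpace.single 0 ((zeroSign c s : ℤ) : ℂ)

theorem norm_axisState : ‖axisState c s‖ = 1 := by
  rw [axisState, PiLp.norm_single]
  unfold zeroSign; split_ifs <;> simp

theorem estState_zero : estState c s L 0 = (ampVec c s 0 : ℂ) / (2 * c.K * c.B : ℕ) := by
  simp [estState]

theorem re_inner_axisState : (inner ℂ (estState c s L) (axisState c s)).re =
    ((zeroSign c s * ampSum c s 0 0 : ℤ) : ℝ) / (2 * c.K * c.B : ℕ) := by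
  rw [axisState, EuclideanSpace.inner_single_right, estState_zero, map_div₀, Complex.conj_natCast,
    ← Complex.ofReal_natCast, ← mul_div_assoc, Complex.div_ofReal_re]
  congr 1
  rw [← Complex.ofReal_intCast, Complex.re_ofReal_mul, Complex.conj_re, ampVec]
  simp

/-- The common denominator `(collected c s L).2` is the squared norm of the direction of the axis of
reflection, in units of `1 / (2 K B) ^ 2`. -/
theorem norm_sq_estState_add_axisState (hK : 0 < c.K) (hB : 0 < c.B) (hL : L.Nodup)
    (hlt : ∀ y ∈ L, y < 2 ^ c.n) :
    ‖estState c s L + axisState c s‖ ^ 2 = ((collected c s L).2 : ℝ) / (2 * c.K * c.B : ℕ) ^ 2 := by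
  have hD : (0 : ℝ) < (2 * c.K * c.B : ℕ) := by positivity
  set D : ℝ := ((2 * c.K * c.B : ℕ) : ℝ) with hDdef
  have hss : ((zeroSign c s : ℤ) : ℝ) * (zeroSign c s : ℤ) = 1 := by
    exact_mod_cast zeroSign_mul_self (c := c) (s := s)
  let F : ℕ → ℝ := fun y =>
    if y = 0 then ((axis c s * axis c s + ampSum c s 0 2 * ampSum c s 0 2 : ℤ) : ℝ) / D ^ 2
    else if y ∈ L.take c.cap then (ampSq c s y : ℝ) / D ^ 2 else 0
  have hF : ∀ y : Fin (2 ^ c.n), ‖(estState c s L + axisState c s) y‖ ^ 2 = F y := by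
    intro y
    by_cases hy : y = 0
    · subst hy
      have e : (estState c s L + axisState c s) 0 =
          ((⟨zeroSign c s * axis c s, ampSum c s 0 2⟩ : GaussianInt) : ℂ) / (D : ℂ) := by
        have hDc : (D : ℂ) ≠ 0 := by exact_mod_cast hD.ne'
        have h1 : ((zeroSign c s : ℤ) : ℂ) * (zeroSign c s : ℤ) = 1 := by exact_mod_cast hss
        rw [PiLp.add_apply, estState_zero, axisState, PiLp.single_apply, if_pos rfl, ampVec,
          GaussianInt.toComplex_def', GaussianInt.toComplex_def', axis]
        rw [eq_div_iff hDc, add_mul, hDdef, Complex.ofReal_natCast, div_mul_cancel₀]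
        · push_cast
          linear_combination (-(ampSum c s 0 0 : ℂ)) * h1
        · rw [hDdef] at hDc; exact_mod_cast hDc
      rw [e, norm_div, div_pow, Complex.norm_real, Real.norm_eq_abs, sq_abs,
        ← Complex.normSq_eq_norm_sq, Complex.normSq_apply]
      simp only [F, Fin.val_zero, if_true, GaussianInt.re_toComplex, GaussianInt.im_toComplex]
      push_cast
      congr 1
      linear_combination ((axis c s : ℤ) : ℝ) ^ 2 * hss
    · have hy' : (y : ℕ) ≠ 0 := fun h => hy (Fin.ext (by simpa using h))
      have e : (estState c s L + axisState c s) y = estState c s L y := by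
        rw [PiLp.add_apply, axisState, PiLp.single_apply, if_neg hy, add_zero]
      rw [e]
      simp only [F, if_neg hy', estState, hy', false_or]
      split_ifs
      · rw [norm_div, div_pow, Complex.norm_natCast, ← hDdef, ampSq_eq]
      · simp
  rw [EuclideanSpace.norm_sq_eq]
  simp_rw [hF]
  rw [Fin.sum_univ_eq_sum_range F]
  set X := (L.take c.cap).filter fun y => 1 ≤ y * ampSq c s y with hX
  have hXn : X.Nodup := (hL.sublist (List.take_sublist _ _)).filter _
  have hsplit : ∀ y, F y = (if y = 0 then
      ((axis c s * axis c s + ampSum c s 0 2 * ampSum c s 0 2 : ℤ) : ℝ) / D ^ 2 else 0) +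
      if y ∈ X.toFinset then (ampSq c s y : ℝ) / D ^ 2 else 0 := by
    intro y
    by_cases h0 : y = 0
    · have : y ∉ X.toFinset := by simp [hX, h0]
      simp [F, h0]
      intro h
      rw [h0] at this
      exact absurd (by simpa using h) this
    · simp only [F, if_neg h0, zero_add, List.mem_toFinset, hX, List.mem_filter, decide_eq_true_eq]
      by_cases h1 : y ∈ L.take c.cap
      · by_cases h2 : 1 ≤ (y : ℤ) * ampSq c s y
        · simp [h1, h2]
        · have h3 := ampSq_nonneg c s y
          have h4 : ampSq c s y = 0 := by
            by_contra hne
            have : 1 ≤ ampSq c s y := by omega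
            have hy1 : (1 : ℤ) ≤ y := by omega
            nlinarith
          simp [h4]
      · simp [h1]
  simp_rw [hsplit]
  rw [Finset.sum_add_distrib, Finset.sum_ite_eq', if_pos (by simp), Finset.sum_ite_mem,
    Finset.inter_eq_right.mpr, List.sum_toFinset _ hXn, collected, foldl_collect]
  · simp only [← hX]
    simp only [div_eq_mul_inv, List.sum_map_mul_right]
    push_cast
    rw [List.map_map, Function.comp_def]
    ring
  · intro y hy
    simp only [List.mem_toFinset, hX, List.mem_filter] at hy
    exact Finset.mem_range.mpr (hlt y (List.mem_of_mem_take hy.1))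

/-- The normalized state that the algorithm puts out: the reflection of `axisState` in the line
through the sum of `axisState` and the estimated state. -/
noncomputable def outState (c : Ctx) (s : ℤ) (L : List ℕ) : Qubits c.n :=
  ((2 * (1 + (inner ℂ (estState c s L) (axisState c s)).re) /
    ‖estState c s L + axisState c s‖ ^ 2 : ℝ) : ℂ) • (estState c s L + axisState c s) -
      axisState c s

theorem axis_pos (hK : 0 < c.K) (hB : 0 < c.B) : 0 < axis c s := by
  have := zeroSign_mul_nonneg (c := c) (s := s)
  have h : (0 : ℤ) < 2 * c.K * c.B := by positivity
  unfold axis; omega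

theorem collected_snd_pos (hK : 0 < c.K) (hB : 0 < c.B) : 0 < (collected c s L).2 := by
  have h1 : 0 < axis c s * axis c s := mul_pos (axis_pos hK hB) (axis_pos hK hB)
  have h2 := mul_self_nonneg (ampSum c s 0 2)
  have h3 : 0 ≤ (((L.take c.cap).filter fun y : ℕ => 1 ≤ y * ampSq c s y).map (ampSq c s)).sum :=
    List.sum_nonneg fun z hz => by
      obtain ⟨y, -, rfl⟩ := List.mem_map.mp hz
      exact ampSq_nonneg c s y
  rw [collected, foldl_collect]
  simp only
  omega

theorem nodup_collected_fst (hL : L.Nodup) : (collected c s L).1.Nodup := by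
  rw [collected, foldl_collect, List.append_nil]
  exact List.nodup_reverse.mpr ((hL.sublist (List.take_sublist _ _)).filter _)

/-- The output amplitudes as explicit fractions. -/
theorem outState_apply (hK : 0 < c.K) (hB : 0 < c.B) (hL : L.Nodup) (hlt : ∀ y ∈ L, y < 2 ^ c.n)
    (y : Fin (2 ^ c.n)) : outState c s L y =
      if y = 0 then (zeroAmp c s (collected c s L).2 : ℂ) / ((collected c s L).2 : ℂ)
      else if (y : ℕ) ∈ L.take c.cap then (outAmp c s y : ℂ) / ((collected c s L).2 : ℂ)
      else 0 := by
  have hD : (0 : ℝ) < (2 * c.K * c.B : ℕ) := by positivity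
  have hS : (0 : ℝ) < (collected c s L).2 := by exact_mod_cast collected_snd_pos hK hB
  have hDc : ((2 * c.K * c.B : ℕ) : ℂ) ≠ 0 := by
    rw [← Complex.ofReal_natCast]; exact_mod_cast hD.ne'
  have hSc : ((collected c s L).2 : ℂ) ≠ 0 := by
    rw [← Complex.ofReal_intCast]; exact_mod_cast hS.ne'
  have hss : ((zeroSign c s : ℤ) : ℂ) * (zeroSign c s : ℤ) = 1 := by
    exact_mod_cast zeroSign_mul_self (c := c) (s := s)
  have hsc : ((2 * (1 + (inner ℂ (estState c s L) (axisState c s)).re) /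
      ‖estState c s L + axisState c s‖ ^ 2 : ℝ) : ℂ) =
      2 * (axis c s : ℂ) * (2 * c.K * c.B : ℕ) / ((collected c s L).2 : ℂ) := by
    rw [re_inner_axisState, norm_sq_estState_add_axisState hK hB hL hlt, axis]
    have : (2 * (1 + ((zeroSign c s * ampSum c s 0 0 : ℤ) : ℝ) / (2 * c.K * c.B : ℕ)) /
        (((collected c s L).2 : ℝ) / ((2 * c.K * c.B : ℕ) : ℝ) ^ 2) : ℝ) =
        2 * ((2 * c.K * c.B + zeroSign c s * ampSum c s 0 0 : ℤ) : ℝ) * (2 * c.K * c.B : ℕ) /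
          ((collected c s L).2 : ℝ) := by
      push_cast at hD ⊢
      field_simp
    rw [this]
    push_cast
    rfl
  have hsplit : outState c s L y =
      2 * (axis c s : ℂ) * (2 * c.K * c.B : ℕ) / ((collected c s L).2 : ℂ) *
        (estState c s L y + axisState c s y) - axisState c s y := by
    rw [outState, PiLp.sub_apply, PiLp.smul_apply, PiLp.add_apply, hsc, smul_eq_mul]
  rw [hsplit]
  by_cases hy : y = 0
  · subst hy
    rw [if_pos rfl, estState_zero, axisState, PiLp.single_apply, if_pos rfl, ampVec, zeroAmp,
      GaussianInt.toComplex_def', GaussianInt.toComplex_def']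
    have hax : (axis c s : ℂ) =
        (2 * c.K * c.B : ℕ) + (zeroSign c s : ℂ) * (ampSum c s 0 0 : ℂ) := by
      rw [axis]; push_cast; ring
    generalize ((2 * c.K * c.B : ℕ) : ℂ) = D at hDc hax ⊢
    push_cast
    field_simp
    rw [hax]
    linear_combination (-2 * (D + (zeroSign c s : ℂ) * (ampSum c s 0 0 : ℂ)) *
      (ampSum c s 0 0 : ℂ)) * hss
  · have hy' : (y : ℕ) ≠ 0 := fun h => hy (Fin.ext (by simpa using h))
    rw [if_neg hy, axisState, PiLp.single_apply, if_neg hy, add_zero, sub_zero]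
    simp only [estState, hy', false_or]
    split_ifs
    · rw [ampVec, outAmp, GaussianInt.toComplex_def', GaussianInt.toComplex_def']
      generalize ((2 * c.K * c.B : ℕ) : ℂ) = D at hDc ⊢
      push_cast
      field_simp
    · simp

/-- The output list is an explicit list of the nonzero amplitudes of `outState`. -/
theorem lists_outputList (hK : 0 < c.K) (hB : 0 < c.B) (hL : L.Nodup)
    (hlt : ∀ y ∈ L, y < 2 ^ c.n) : Lists (.list (outputList c s L)) (outState c s L) := by
  have hS := collected_snd_pos (s := s) (L := L) hK hB
  have hax := axis_pos (s := s) hK hB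
  have hSc : ((collected c s L).2 : ℂ) ≠ 0 := by exact_mod_cast hS.ne'
  have hsq : ∀ g : GaussianInt, 1 ≤ g.re * g.re + g.im * g.im ↔ (g : ℂ) ≠ 0 := by
    intro g
    rw [Ne, GaussianInt.toComplex_eq_zero, ← GaussianInt.norm_eq_zero, Zsqrtd.norm_def,
      neg_one_mul, neg_mul, sub_neg_eq_add]
    have h1 := mul_self_nonneg g.re
    have h2 := mul_self_nonneg g.im
    constructor <;> intro h <;> omega
  have hout := outState_apply (s := s) hK hB hL hlt
  have hmem : ∀ y ∈ (collected c s L).1, y < 2 ^ c.n ∧ y ≠ 0 := by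
    intro y hy
    obtain ⟨h1, h2⟩ := mem_collected.mp hy
    refine ⟨hlt y (List.mem_of_mem_take h1), ?_⟩
    rintro rfl
    simp at h2
  have hamp : ∀ y, ampSq c s y ≠ 0 ↔ (outAmp c s y : ℂ) ≠ 0 := by
    intro y
    rw [← hsq, outAmp]
    have h1 := ampSq_nonneg c s y
    have h2 : 2 * axis c s * ampSum c s y 0 * (2 * axis c s * ampSum c s y 0) +
        2 * axis c s * ampSum c s y 2 * (2 * axis c s * ampSum c s y 2) =
        (2 * axis c s) * (2 * axis c s) * ampSq c s y := by rw [ampSq]; ring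
    simp only [h2]
    constructor
    · intro h
      have : 0 < ampSq c s y := by omega
      have h3 : 0 < 2 * axis c s * (2 * axis c s) * ampSq c s y := by positivity
      omega
    · rintro h h0
      rw [h0] at h; simp at h
  set z := (collected c s L).1 with hz
  set D := (collected c s L).2 with hD
  have hval : ∀ y ∈ z, ((Fin.ofNat (2 ^ c.n) y : Fin (2 ^ c.n)) : ℕ) = y := fun y hy => by
    rw [Fin.val_ofNat, Nat.mod_eq_of_lt (hmem y hy).1]
  refine ⟨(z.map (Fin.ofNat (2 ^ c.n))).reverse ++
    (if (zeroAmp c s D : ℂ) ≠ 0 then [0] else []),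
    fun x => .pair (gaussData (if x = 0 then zeroAmp c s D else outAmp c s x)) (.int D),
    ?_, fun x => ?_, fun x hx => ?_, ?_⟩
  · refine List.Nodup.append (List.nodup_reverse.mpr
      ((nodup_collected_fst hL).map_on fun y hy y' hy' h => ?_)) (by split_ifs <;> simp) ?_
    · rw [← hval y hy, h, hval y' hy']
    · intro x hx hx'
      split_ifs at hx'
      · rw [List.mem_singleton] at hx'
        subst hx'
        rw [List.mem_reverse, List.mem_map] at hx
        obtain ⟨y, hy, h⟩ := hx
        have := hval y hy
        rw [h] at this
        exact (hmem y hy).2 this.symm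
      · simp at hx'
  · rw [hout x, List.mem_append, List.mem_reverse, List.mem_map]
    by_cases hx : x = 0
    · subst hx
      rw [if_pos rfl]
      have : ¬ ∃ a ∈ z, Fin.ofNat (2 ^ c.n) a = 0 := by
        rintro ⟨y, hy, h⟩
        have := hval y hy
        rw [h] at this
        exact (hmem y hy).2 this.symm
      simp only [this, false_or, ne_eq, div_eq_zero_iff, hSc, or_false]
      split_ifs with h <;> simp [h]
    · rw [if_neg hx]
      have h0 : ¬ x ∈ (if (zeroAmp c s D : ℂ) ≠ 0 then [(0 : Fin (2 ^ c.n))] else []) := by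
        split_ifs <;> simp [hx]
      have hx' : 1 ≤ (x : ℕ) := by
        rcases Nat.eq_zero_or_pos (x : ℕ) with h | h
        · exact absurd (Fin.ext h) hx
        · exact h
      have h1 : (∃ a ∈ z, Fin.ofNat (2 ^ c.n) a = x) ↔ (x : ℕ) ∈ z := by
        constructor
        · rintro ⟨y, hy, rfl⟩; rwa [hval y hy]
        · intro h; exact ⟨x, h, Fin.ext (hval _ h)⟩
      simp only [h0, or_false, h1]
      rw [hz, mem_collected]
      have h2 := ampSq_nonneg c s x
      have h3 : (1 : ℤ) ≤ (x : ℕ) * ampSq c s x ↔ ampSq c s x ≠ 0 := by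
        constructor
        · rintro h h0; rw [h0] at h; simp at h
        · intro h
          have h4 : 1 ≤ ampSq c s x := by omega
          have h5 : (1 : ℤ) ≤ (x : ℕ) := by exact_mod_cast hx'
          nlinarith
      rw [h3, hamp]
      split_ifs with h <;> simp [h, hSc]
  · refine ⟨(if x = 0 then zeroAmp c s D else outAmp c s x).re,
      (if x = 0 then zeroAmp c s D else outAmp c s x).im, D.toNat, by omega, ?_, ?_⟩
    · simp only [gaussData, Data.nat, Int.toNat_of_nonneg hS.le]
    · have hDn : ((D.toNat : ℕ) : ℂ) = (D : ℂ) := by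
        rw [← Int.cast_natCast, Int.toNat_of_nonneg hS.le]
      rw [← GaussianInt.toComplex_def, hDn, hout x]
      by_cases h : x = 0
      · simp [h]
      · rw [if_neg h, if_neg h, if_pos]
        rw [List.mem_append, List.mem_reverse, List.mem_map] at hx
        rcases hx with ⟨y, hy, rfl⟩ | hx
        · rw [hval y hy]; exact (mem_collected.mp hy).1
        · split_ifs at hx
          · exact absurd (List.mem_singleton.mp hx) h
          · simp at hx
  · rw [outputList_eq, List.map_append, List.map_reverse, List.map_map]
    congr 2
    · congr 1
      refine List.map_congr_left fun y hy => ?_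
      have h0 : ¬ Fin.ofNat (2 ^ c.n) y = 0 := by
        intro h
        have := hval y hy
        rw [h] at this
        exact (hmem y hy).2 this.symm
      simp only [Function.comp_apply, if_neg h0, hval y hy]
      rfl
    · rw [zeroEntry, if_congr (hsq _) rfl rfl]
      split_ifs <;> simp [entryData, ← hD]

theorem sparsity_outState_le (hK : 0 < c.K) (hB : 0 < c.B) (hL : L.Nodup)
    (hlt : ∀ y ∈ L, y < 2 ^ c.n) : sparsity (outState c s L) ≤ c.cap + 1 := by
  classical
  rw [sparsity]
  have hsub : {x : Fin (2 ^ c.n) | outState c s L x ≠ 0} ⊆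
      ((insert 0 ((L.take c.cap).toFinset.image (Fin.ofNat (2 ^ c.n))) : Finset (Fin (2 ^ c.n))) :
        Set (Fin (2 ^ c.n))) := by
    intro x hx
    simp only [Set.mem_ofPred_eq, outState_apply hK hB hL hlt] at hx
    rw [Finset.mem_coe, Finset.mem_insert, Finset.mem_image]
    by_cases h : x = 0
    · exact Or.inl h
    · rw [if_neg h] at hx
      refine Or.inr ⟨x, ?_, Fin.ext (by rw [Fin.val_ofNat, Nat.mod_eq_of_lt x.2])⟩
      by_contra hc
      rw [if_neg (by simpa using hc)] at hx
      exact hx rfl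
  refine (Set.ncard_le_ncard hsub (Finset.finite_toSet _)).trans ?_
  rw [Set.ncard_coe_finset]
  refine (Finset.card_insert_le _ _).trans (Nat.add_le_add_right ?_ 1)
  refine Finset.card_image_le.trans ((List.toFinset_card_le _).trans ?_)
  rw [List.length_take]
  exact min_le_left _ _

theorem norm_outState : ‖outState c s L‖ = 1 := by
  refine (norm_reflection norm_axisState ?_).1
  rw [re_inner_axisState]
  have := zeroSign_mul_nonneg (c := c) (s := s)
  have h : (0 : ℝ) ≤ ((zeroSign c s * ampSum c s 0 0 : ℤ) : ℝ) := by exact_mod_cast this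
  positivity

/-- Normalizing costs a constant factor in the distance to a unit vector. -/
theorem norm_outState_sub_le {f : Qubits c.n} (hf : ‖f‖ = 1) :
    ‖outState c s L - f‖ ≤ (1 + Real.sqrt 2) * ‖estState c s L - f‖ := by
  have h0 : 0 ≤ (inner ℂ (estState c s L) (axisState c s)).re := by
    rw [re_inner_axisState]
    have h : (0 : ℝ) ≤ ((zeroSign c s * ampSum c s 0 0 : ℤ) : ℝ) := by
      exact_mod_cast zeroSign_mul_nonneg (c := c) (s := s)
    positivity
  have h1 := (norm_reflection norm_axisState h0).2
  have h2 : |1 - ‖estState c s L‖| ≤ ‖estState c s L - f‖ := by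
    rw [← hf, norm_sub_rev]; exact abs_norm_sub_norm_le _ _
  calc ‖outState c s L - f‖ ≤ ‖outState c s L - estState c s L‖ + ‖estState c s L - f‖ :=
        norm_sub_le_norm_sub_add_norm_sub _ _ _
    _ ≤ Real.sqrt 2 * ‖estState c s L - f‖ + ‖estState c s L - f‖ := by
        gcongr
        exact h1.trans (by gcongr)
    _ = _ := by ring

end

/-! ### Distance of the output to the final state -/

section

variable {T : Task} {S : Prog} {ψ : Fin (2 ^ T.n) → ℂ} {s : ℤ}
  {l : List (Fin (2 ^ T.n) × Fin (2 ^ T.n))}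

/-- The estimated state, for given samples. -/
noncomputable def Task.estState (T : Task) (s : ℤ) (l : List (Fin (2 ^ T.n) × Fin (2 ^ T.n))) :
    Qubits T.n :=
  SparseSim.estState (T.ctx (l.map valPair)) s (treeList (T.ctx (l.map valPair)) s T.n)

/-- The state that is put out, for given samples. -/
noncomputable def Task.outState (T : Task) (s : ℤ) (l : List (Fin (2 ^ T.n) × Fin (2 ^ T.n))) :
    Qubits T.n :=
  SparseSim.outState (T.ctx (l.map valPair)) s (treeList (T.ctx (l.map valPair)) s T.n)

/-- The error has three sources: the estimates at the kept labels, the labels in the support of the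
sparse approximation that are not kept and hence have weight at most `1 / W`, and the distance to
the sparse approximation. -/
theorem Accurate.norm_sq_estState_sub_le (hA : Accurate T S ψ) (hs : IsUnit s)
    (hl : T.Good s ψ l) {f : Qubits T.n} (hf : ∀ y, f y = fourier s ψ y) {ε : ℝ} (hε : 0 < ε)
    (ht : (T.t : ℝ) ≤ ε * T.W) (hsp : IsApproxSparse (Real.sqrt ε) T.t f) :
    ‖T.estState s l - f‖ ^ 2 ≤ 3 * ε := by
  classical
  have hW : (1 : ℝ) ≤ T.W := by exact_mod_cast hA.pos
  have ht1 : 1 ≤ T.t := by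
    have h := hA.pos
    rw [Task.W] at h
    exact Nat.pos_of_mul_pos_right h
  have ht1' : (1 : ℝ) ≤ T.t := by exact_mod_cast ht1
  set c := T.ctx (l.map valPair) with hc
  set L := treeList c s T.n with hL
  obtain ⟨hlen, hheavy⟩ := hA.treeList_spec hs hl le_rfl
  rw [← hc, ← hL] at hlen hheavy
  have htake : L.take c.cap = L := List.take_of_length_le hlen
  obtain ⟨v, hv, hfv⟩ := hsp
  set A : Finset (Fin (2 ^ T.n)) := Finset.univ.filter fun y => (y : ℕ) = 0 ∨ (y : ℕ) ∈ L with hAdef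
  set X : Finset (Fin (2 ^ T.n)) := Finset.univ.filter fun y => v y ≠ 0 with hX
  have hXcard : (X.card : ℝ) ≤ T.t := by
    have : X.card = sparsity v := by
      rw [sparsity, ← Set.ncard_coe_finset]
      congr 1
      ext y; simp [hX]
    rw [this]; exact_mod_cast hv
  have hAcard : (A.card : ℝ) ≤ 3 * T.W := by
    have h1 : A.card ≤ 2 * T.W + 1 := by
      have h2 : A.image Fin.val ⊆ insert 0 L.toFinset := by
        intro y hy
        obtain ⟨x, hx, rfl⟩ := Finset.mem_image.mp hy
        simpa [hAdef] using hx
      rw [← Finset.card_image_of_injective A Fin.val_injective]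
      refine (Finset.card_le_card h2).trans ((Finset.card_insert_le _ _).trans ?_)
      exact Nat.add_le_add_right ((List.toFinset_card_le _).trans hlen) 1
    have h3 : (A.card : ℝ) ≤ 2 * T.W + 1 := by exact_mod_cast h1
    linarith
  have happ : ∀ y : Fin (2 ^ T.n), T.estState s l y = if (y : ℕ) = 0 ∨ (y : ℕ) ∈ L then
      (ampVec c s y : ℂ) / (2 * c.K * c.B : ℕ) else 0 := by
    intro y
    conv_rhs => rw [← htake]
    rfl
  have hpt : ∀ y, ‖(T.estState s l - f) y‖ ^ 2 ≤
      ((if y ∈ A then 1 / (18 * (T.W : ℝ) ^ 2) else 0) + (if y ∈ X then 1 / (T.W : ℝ) else 0)) +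
        ‖(f - v) y‖ ^ 2 := by
    intro y
    rw [PiLp.sub_apply]
    by_cases hyA : y ∈ A
    · have hest : T.estState s l y = (ampVec c s y : ℂ) / (2 * c.K * c.B : ℕ) := by
        have : (y : ℕ) = 0 ∨ (y : ℕ) ∈ L := by simpa [hAdef] using hyA
        rw [happ, if_pos this]
      have h1 := hl.2 y
      rw [← hc, ← hf] at h1
      obtain ⟨h1, h2⟩ := h1
      have hcast : ((2 * c.K * c.B : ℕ) : ℝ) = 2 * T.K * (64 * T.W) := by
        simp [hc, Task.ctx, Ctx.B]
      have hre : (T.estState s l y - f y).re =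
          (ampSum c s y 0 : ℝ) / (2 * T.K * (64 * T.W)) - (f y).re := by
        rw [hest, Complex.sub_re, ← Complex.ofReal_natCast, hcast, Complex.div_ofReal_re, ampVec,
          GaussianInt.re_toComplex]
      have him : (T.estState s l y - f y).im =
          (ampSum c s y 2 : ℝ) / (2 * T.K * (64 * T.W)) - (f y).im := by
        rw [hest, Complex.sub_im, ← Complex.ofReal_natCast, hcast, Complex.div_ofReal_im, ampVec,
          GaussianInt.im_toComplex]
      have h3 : ‖T.estState s l y - f y‖ ^ 2 ≤ 1 / (18 * (T.W : ℝ) ^ 2) := by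
        rw [← Complex.normSq_eq_norm_sq, Complex.normSq_apply, hre, him, ← sq, ← sq]
        have e : 1 / (18 * (T.W : ℝ) ^ 2) = (1 / (6 * T.W)) ^ 2 + (1 / (6 * T.W)) ^ 2 := by
          field_simp; norm_num
        rw [e]
        exact add_le_add (sq_le_sq.mpr (h1.trans (le_abs_self _)))
          (sq_le_sq.mpr (h2.trans (le_abs_self _)))
      rw [if_pos hyA]
      refine h3.trans ?_
      have h4 : (0 : ℝ) ≤ if y ∈ X then 1 / (T.W : ℝ) else 0 := by split_ifs <;> positivity
      nlinarith [sq_nonneg ‖(f - v) y‖]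
    · have hnot : ¬ ((y : ℕ) = 0 ∨ (y : ℕ) ∈ L) := by simpa [hAdef] using hyA
      have hest : T.estState s l y = 0 := by
        rw [happ, if_neg hnot]
      rw [hest, zero_sub, norm_neg, if_neg hyA, zero_add]
      by_cases hyX : y ∈ X
      · have h1 : ‖f y‖ ^ 2 ≤ 1 / T.W := by
          by_contra hcon
          push Not at hcon
          refine hnot (Or.inr (hheavy y y.2 ?_))
          rw [residueWeight_self, ← hf]
          exact hcon.le
        rw [if_pos hyX]
        nlinarith [sq_nonneg ‖(f - v) y‖]
      · have h1 : v y = 0 := by simpa [hX] using hyX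
        rw [if_neg hyX, zero_add, PiLp.sub_apply, h1, sub_zero]
  rw [EuclideanSpace.norm_sq_eq]
  refine (Finset.sum_le_sum fun y _ => hpt y).trans ?_
  rw [Finset.sum_add_distrib, Finset.sum_add_distrib, ← EuclideanSpace.norm_sq_eq,
    Finset.sum_ite_mem, Finset.sum_ite_mem, Finset.univ_inter, Finset.univ_inter,
    Finset.sum_const, Finset.sum_const, nsmul_eq_mul, nsmul_eq_mul]
  have h1 : (A.card : ℝ) * (1 / (18 * (T.W : ℝ) ^ 2)) ≤ ε := by
    have h2 : (A.card : ℝ) * (1 / (18 * (T.W : ℝ) ^ 2)) ≤ 3 * T.W * (1 / (18 * (T.W : ℝ) ^ 2)) := by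
      gcongr
    have h3 : 3 * T.W * (1 / (18 * (T.W : ℝ) ^ 2)) = 1 / 6 * (1 / T.W) := by field_simp; norm_num
    have h4 : 1 / (T.W : ℝ) ≤ ε := by
      rw [div_le_iff₀ (by linarith)]; linarith
    linarith
  have h2 : (X.card : ℝ) * (1 / T.W) ≤ ε := by
    rw [mul_one_div, div_le_iff₀ (by linarith)]
    linarith
  have h3 : ‖f - v‖ ^ 2 ≤ ε := by
    rw [← Real.sq_sqrt hε.le]
    gcongr
  linarith

theorem Accurate.norm_outState_sub_le (hA : Accurate T S ψ) (hs : IsUnit s)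
    (hl : T.Good s ψ l) {f : Qubits T.n} (hf : ∀ y, f y = fourier s ψ y) {ε : ℝ} (hε : 0 < ε)
    (ht : (T.t : ℝ) ≤ ε * T.W) (hsp : IsApproxSparse (Real.sqrt ε) T.t f) :
    ‖T.outState s l - f‖ ≤ 6 * Real.sqrt ε := by
  have hf1 : ‖f‖ = 1 := by
    rw [← sq_eq_sq₀ (norm_nonneg _) (by norm_num), EuclideanSpace.norm_sq_eq]
    simp_rw [hf]
    rw [sum_norm_sq_fourier hs, hA.norm, one_pow]
  have h1 := hA.norm_sq_estState_sub_le hs hl hf hε ht hsp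
  have h2 : ‖T.estState s l - f‖ ≤ 2 * Real.sqrt ε := by
    refine abs_le_of_sq_le_sq' ?_ (by positivity) |>.2
    rw [mul_pow, Real.sq_sqrt hε.le]
    linarith
  have h3 : Real.sqrt 2 ≤ 2 := by
    rw [Real.sqrt_le_left (by norm_num)]; norm_num
  refine (SparseSim.norm_outState_sub_le (c := T.ctx (l.map valPair)) hf1).trans ?_
  calc _ ≤ (1 + Real.sqrt 2) * (2 * Real.sqrt ε) := by gcongr; exact h2
    _ ≤ (1 + 2) * (2 * Real.sqrt ε) := by gcongr
    _ = _ := by ring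

end

/-! ### The quantum Fourier transform -/

theorem act_mul {n : ℕ} (U V : Matrix (Fin (2 ^ n)) (Fin (2 ^ n)) ℂ) (ψ : Qubits n) :
    act (U * V) ψ = act U (act V ψ) := by
  simp [act, Matrix.mulVec_mulVec]

theorem norm_act {n : ℕ} {U : Matrix (Fin (2 ^ n)) (Fin (2 ^ n)) ℂ}
    (hU : U ∈ Matrix.unitaryGroup (Fin (2 ^ n)) ℂ) (ψ : Qubits n) : ‖act U ψ‖ = ‖ψ‖ := by
  have h : inner ℂ (act U ψ) (act U ψ) = inner ℂ ψ ψ := by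
    rw [EuclideanSpace.inner_eq_star_dotProduct, EuclideanSpace.inner_eq_star_dotProduct, act,
      Matrix.star_mulVec, dotProduct_comm, ← Matrix.dotProduct_mulVec, Matrix.mulVec_mulVec,
      ← Matrix.star_eq_conjTranspose, Matrix.mem_unitaryGroup_iff'.mp hU, Matrix.one_mulVec,
      dotProduct_comm]
  rw [← sq_eq_sq₀ (norm_nonneg _) (norm_nonneg _), ← inner_self_eq_norm_sq (𝕜 := ℂ), h,
    inner_self_eq_norm_sq]

/-- The matrix of `fourier s`. -/
noncomputable def fourierMatrix (s : ℤ) (n : ℕ) : Matrix (Fin (2 ^ n)) (Fin (2 ^ n)) ℂ :=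
  Matrix.of fun y x => (1 / Real.sqrt (2 ^ n : ℕ) : ℝ) *
    cis ((s * ((x : ℕ) * (y : ℕ)) : ℝ) / (2 ^ n : ℕ))

theorem act_fourierMatrix (s : ℤ) {n : ℕ} (ψ : Qubits n) (y : Fin (2 ^ n)) :
    act (fourierMatrix s n) ψ y = fourier s ψ y := by
  simp only [act, fourierMatrix, fourier, Matrix.mulVec, dotProduct, Matrix.of_apply]
  rw [Finset.mul_sum]
  exact Finset.sum_congr rfl fun x _ => mul_assoc _ _ _

theorem qft_eq (n : ℕ) : qft n = fourierMatrix 1 n := by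
  ext y x
  rw [qft, fourierMatrix, Matrix.of_apply, Matrix.of_apply, div_eq_mul_one_div, mul_comm, cis]
  congr 1
  · push_cast; rfl
  · congr 1; push_cast; ring

theorem inv_qft_eq (n : ℕ) : (qft n)⁻¹ = fourierMatrix (-1) n := by
  refine Matrix.inv_eq_left_inv ?_
  rw [qft_eq]
  ext y z
  have hN : ((2 ^ n : ℕ) : ℂ) ≠ 0 := by simp
  have h1 : ∀ x : Fin (2 ^ n), fourierMatrix (-1) n y x * fourierMatrix 1 n x z =
      1 / (2 ^ n : ℕ) * cis ((((z : ℕ) - (y : ℕ) : ℤ) * (x : ℕ) : ℝ) / (2 ^ n : ℕ)) := by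
    intro x
    have hsq : ((1 / Real.sqrt (2 ^ n : ℕ) : ℝ) : ℂ) * ((1 / Real.sqrt (2 ^ n : ℕ) : ℝ) : ℂ) =
        1 / (2 ^ n : ℕ) := by
      rw [← Complex.ofReal_mul, div_mul_div_comm, one_mul, Real.mul_self_sqrt (by positivity)]
      push_cast; rfl
    have e : cis ((((z : ℕ) - (y : ℕ) : ℤ) * (x : ℕ) : ℝ) / (2 ^ n : ℕ)) =
        cis (((-1 : ℤ) * ((x : ℕ) * (y : ℕ)) : ℝ) / (2 ^ n : ℕ)) *
          cis (((1 : ℤ) * ((z : ℕ) * (x : ℕ)) : ℝ) / (2 ^ n : ℕ)) := by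
      rw [← cis_add]; congr 1; push_cast; ring
    rw [fourierMatrix, fourierMatrix, Matrix.of_apply, Matrix.of_apply, e, ← hsq]
    ring
  rw [Matrix.mul_apply]
  simp_rw [h1]
  rw [← Finset.mul_sum, sum_cis]
  have h2 : (((2 ^ n : ℕ) : ℤ) ∣ (z : ℕ) - (y : ℕ)) ↔ y = z := by
    constructor
    · intro h
      have := (Int.natCast_modEq_iff.mp ((Int.modEq_iff_dvd).mpr h))
      exact Fin.ext (Nat.ModEq.eq_of_lt_of_lt this y.2 z.2)
    · rintro rfl; simp
  rw [if_congr h2 rfl rfl, Matrix.one_apply]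
  split_ifs
  · exact one_div_mul_cancel hN
  · simp

/-! ### Families of states -/

/-- The answers to amplitude queries, as functions. -/
theorem Queries.exists_answers {ι : Type} {nq : ι → ℕ} {desc : ι → Data} {ψ : ∀ i, Qubits (nq i)}
    {Q : Prog} (hQ : Queries nq desc ψ Q) :
    ∃ (c : ℕ) (qv : ι → ℕ → ℕ → GaussianInt × ℕ), ∀ i k (x : Fin (2 ^ nq i)),
      Q.ev (.pair (.pair (instanceData nq desc i) (.nat x)) (.nat k)) = codeData (qv i k x) ∧
      Q.cost (.pair (.pair (instanceData nq desc i) (.nat x)) (.nat k)) ≤ c * (nq i + k + 1) ^ c ∧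
      0 < (qv i k x).2 ∧ ‖codeVal (qv i k x) - ψ i x‖ ≤ (1 / 2) ^ k := by
  obtain ⟨c, hc⟩ := hQ
  have h : ∀ i k (x : Fin (2 ^ nq i)), ∃ g : GaussianInt × ℕ,
      Q.ev (.pair (.pair (instanceData nq desc i) (.nat x)) (.nat k)) = codeData g ∧
      Q.cost (.pair (.pair (instanceData nq desc i) (.nat x)) (.nat k)) ≤ c * (nq i + k + 1) ^ c ∧
      0 < g.2 ∧ ‖codeVal g - ψ i x‖ ≤ (1 / 2) ^ k := by
    intro i k x
    obtain ⟨y, time, z, hrun, ht, ⟨a, b, m, hm, hy, hz⟩, hzψ⟩ := hc i x k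
    obtain ⟨h1, h2⟩ := Prog.ev_cost_of_run_eq_pure hrun
    refine ⟨(⟨a, b⟩, m), by rw [h1, hy]; rfl, by rw [h2]; exact ht, hm, ?_⟩
    rw [codeVal, GaussianInt.toComplex_def', ← hz]
    exact hzψ
  choose g hg using h
  refine ⟨c, fun i k x => g i k (Fin.ofNat (2 ^ nq i) x), fun i k x => ?_⟩
  have : Fin.ofNat (2 ^ nq i) (x : ℕ) = x := Fin.ext (by rw [Fin.val_ofNat, Nat.mod_eq_of_lt x.2])
  simp only [this]
  exact hg i k x

/-- A bound of the form used in the definition of a tractable family is polynomial. -/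
theorem polyBdd_mul_pow {I : Type} {σ f : I → ℕ} (hf : PolyBdd σ f) (c : ℕ) :
    PolyBdd σ fun i => c * (f i) ^ c := (PolyBdd.const c).mul (hf.pow c)

/-- Conversely, a polynomial bound in `n + t + ⌊1 / ε⌋ + ⌈log₂ (1 / δ)⌉` is one in real
parameters. -/
theorem time_le {n t m c : ℕ} {ε δ : ℝ} (hε : 0 < ε) (hδ : 0 < δ) (hδ1 : δ < 1)
    (hm : m ≤ (n + t + ⌊1 / ε⌋₊ + ⌈Real.logb 2 (1 / δ)⌉₊ + 2) ^ c) :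
    (m : ℝ) ≤ (3 ^ c + c : ℕ) * (n + t + 1 / ε + Real.log (1 / δ) + 1) ^ (3 ^ c + c) := by
  have hlog : 0 ≤ Real.log (1 / δ) := Real.log_nonneg (by rw [le_div_iff₀ hδ]; linarith)
  have hlog2 : (1 / 2 : ℝ) ≤ Real.log 2 := by have := Real.log_two_gt_d9; linarith
  have h1 : ((⌊1 / ε⌋₊ : ℕ) : ℝ) ≤ 1 / ε := Nat.floor_le (by positivity)
  have h2 : ((⌈Real.logb 2 (1 / δ)⌉₊ : ℕ) : ℝ) ≤ 2 * Real.log (1 / δ) + 1 := by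
    have h3 : Real.logb 2 (1 / δ) ≤ 2 * Real.log (1 / δ) := by
      rw [Real.logb, div_le_iff₀ (by linarith)]
      nlinarith
    have h4 := Nat.ceil_lt_add_one (a := Real.logb 2 (1 / δ))
      (Real.logb_nonneg (by norm_num) (by rw [le_div_iff₀ hδ]; linarith))
    linarith
  have hε0 : 0 < 1 / ε := by positivity
  set X : ℝ := n + t + 1 / ε + Real.log (1 / δ) + 1 with hX
  have hn : (0 : ℝ) ≤ n := by positivity
  have ht : (0 : ℝ) ≤ t := by positivity
  have hX1 : 1 ≤ X := by linarith
  calc (m : ℝ) ≤ ((n : ℝ) + t + ⌊1 / ε⌋₊ + ⌈Real.logb 2 (1 / δ)⌉₊ + 2) ^ c := by exact_mod_cast hm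
    _ ≤ (3 * X) ^ c := by
        gcongr
        linarith
    _ = ((3 ^ c : ℕ) : ℝ) * X ^ c := by push_cast; rw [mul_pow]
    _ ≤ _ := by
        gcongr
        · exact Nat.le_add_right _ _
        · exact Nat.le_add_left _ _

/-- The simulation of the transform `fourier s` on a tractable family of normalized states. Amplitudes
are queried, and samples drawn, at the precision `2 ^ (-(n + W + 8))` with `W = t (⌊1 / ε⌋ + 1)`. -/
theorem IsCT.exists_simulation {ι : Type} {nq : ι → ℕ} {desc : ι → Data} {ψ : ∀ i, Qubits (nq i)}
    (hCT : IsCT nq desc ψ) (hψ : ∀ i, ‖ψ i‖ = 1) {s : ℤ} (hs : IsUnit s) :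
    ∃ (A : Prog) (c : ℕ), ∀ (i : ι) (t : ℕ) (ε δ : ℝ) (f : Qubits (nq i)),
      (∀ y, f y = fourier s (ψ i) y) → 0 < ε → ε ≤ 1 / 6 → 0 < δ → δ < 1 →
      IsApproxSparse (Real.sqrt ε) t f →
      (∀ out ∈ (A.run (simInput nq desc i t ε δ)).support,
        (out.2 : ℝ) ≤ c * (nq i + t + 1 / ε + Real.log (1 / δ) + 1) ^ c ∧
        ∃ φ : Qubits (nq i), Lists out.1 φ ∧ ‖φ‖ = 1 ∧ (sparsity φ : ℝ) ≤ 6 * (t / ε)) ∧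
      ENNReal.ofReal (1 - δ) ≤ (A.run (simInput nq desc i t ε δ)).toOuterMeasure
        {out | ∃ φ : Qubits (nq i), Lists out.1 φ ∧ ‖φ - f‖ ≤ 6 * Real.sqrt ε} := by
  obtain ⟨⟨cd, hdesc⟩, ⟨S, cs, hS⟩, ⟨Q, hQ⟩⟩ := hCT
  obtain ⟨cq, qv, hqv⟩ := hQ.exists_answers
  let T : ι × ℕ × ℕ × ℕ → Task := fun p => ⟨nq p.1, desc p.1,
    qv p.1 (nq p.1 + p.2.1 * (p.2.2.1 + 1) + 8), p.2.1, p.2.2.1, p.2.2.2⟩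
  let V : Ctx → Prop := fun c => ∃ p l, c = (T p).ctx l ∧ l.length = (T p).K ∧ (T p).Valid l
  have hsz : ∀ p, (T p).inst.size ≤
      1 + (Data.nat (T p).n).size + cd * ((T p).n + 1) ^ cd := fun p => by
    have := hdesc p.1
    simp only [Task.inst, Data.size, T]; omega
  have hVQ : ∀ c x, V c → x < 2 ^ c.n →
      Q.ev (.pair (.pair c.inst (.nat x)) (.nat c.k)) = codeData (c.qv x) ∧
      Q.cost (.pair (.pair c.inst (.nat x)) (.nat c.k)) ≤ cq * (c.n + c.k + 1) ^ cq := by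
    rintro c x ⟨p, l, rfl, -, -⟩ hx
    have h := hqv p.1 (nq p.1 + p.2.1 * (p.2.2.1 + 1) + 8) ⟨x, hx⟩
    exact ⟨h.1, h.2.1⟩
  have hV : Admissible Q V := by
    refine ⟨?_, ?_, ?_, ?_, ?_⟩
    · rintro c ⟨p, l, rfl, h1, h2⟩; exact h1
    · rintro c ⟨p, l, rfl, h1, h2⟩; exact h2
    · have hn : PolyBdd (fun c : {c // V c} => c.1.sz) fun c => c.1.n :=
        PolyBdd.param.mono fun c => by simp only [Ctx.sz]; omega
      refine PolyBdd.mono (((PolyBdd.const 1).add (Small.nat hn)).add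
        (polyBdd_mul_pow (hn.add (.const 1)) cd)) ?_
      rintro ⟨c, p, l, rfl, h1, h2⟩
      exact hsz p
    · exact fun p => (hVQ p.1.1 p.1.2 p.2.1 p.2.2).1
    · have hk : PolyBdd (fun p : {p : Ctx × ℕ // V p.1 ∧ p.2 < 2 ^ p.1.n} => p.1.1.sz)
          fun p => p.1.1.n + p.1.1.k + 1 := by
        refine ((PolyBdd.const 2).mul (PolyBdd.param.add (.const 5))).mono fun p => ?_
        simp only [Ctx.sz, Ctx.k]; omega
      exact PolyBdd.mono (polyBdd_mul_pow hk cq) fun p => (hVQ p.1.1 p.1.2 p.2.1 p.2.2).2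
  have hT : ∀ p l, l.length = (T p).K → (T p).Valid l → V ((T p).ctx l) :=
    fun p l h1 h2 => ⟨p, l, rfl, h1, h2⟩
  have hinst : Small (fun p => (T p).size) fun p => (T p).inst :=
    PolyBdd.mono (((PolyBdd.const 1).add (Small.nat polyBdd_n)).add
      (polyBdd_mul_pow (polyBdd_n.add (.const 1)) cd)) hsz
  have hStime : PolyTime (fun p => (T p).size) S fun p => .pair (T p).inst (.nat (T p).k) := by
    refine .of_le (polyBdd_mul_pow ((polyBdd_n.add ((polyBdd_n.add polyBdd_W).add (.const 8))).add
      (.const 1)) cs) fun p out ho => ?_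
    exact (hS p.1 (T p).k).1 out ho
  obtain ⟨c, hc⟩ := polyTime_simProg hV s hT hinst hStime
  refine ⟨.simProg S Q s, 3 ^ c + c, fun i t ε δ f hf hε hε6 hδ hδ1 hsp => ?_⟩
  set p : ι × ℕ × ℕ × ℕ := (i, t, ⌊1 / ε⌋₊, ⌈Real.logb 2 (1 / δ)⌉₊) with hp
  have hin : simInput nq desc i t ε δ = (T p).input := rfl
  have hf1 : ‖f‖ = 1 := by
    rw [← sq_eq_sq₀ (norm_nonneg _) (by norm_num), EuclideanSpace.norm_sq_eq]
    simp_rw [hf]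
    rw [sum_norm_sq_fourier hs, ← EuclideanSpace.norm_sq_eq, hψ]
  -- The zero vector is not close to a unit vector.
  have ht : 1 ≤ t := by
    by_contra h
    have ht0 : t = 0 := by omega
    obtain ⟨v, hv, hfv⟩ := hsp
    have hv0 : v = 0 := by
      ext x
      by_contra hx
      rw [ht0, Nat.le_zero, sparsity, Set.ncard_eq_zero] at hv
      exact (Set.eq_empty_iff_forall_notMem.mp hv x) hx
    rw [hv0, sub_zero, hf1] at hfv
    have : Real.sqrt ε < 1 := by rw [Real.sqrt_lt' (by norm_num)]; linarith
    linarith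
  have hE : 1 / ε < (⌊1 / ε⌋₊ : ℝ) + 1 := Nat.lt_floor_add_one _
  have hW : 1 ≤ (T p).W := Nat.mul_pos ht (Nat.succ_pos _)
  have hWcast : ((T p).W : ℝ) = t * ((⌊1 / ε⌋₊ : ℝ) + 1) := by
    simp [T, Task.W, hp]
  have hK : 0 < (T p).K := by rw [Task.K]; positivity
  have hB : ∀ l, 0 < ((T p).ctx l).B := fun l => by
    simp only [Ctx.B, Task.ctx]; omega
  have htW : ((T p).t : ℝ) ≤ ε * (T p).W := by
    have h1 : 1 ≤ ε * ((⌊1 / ε⌋₊ : ℝ) + 1) := by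
      rw [div_lt_iff₀ hε] at hE; linarith
    have h2 : ((T p).t : ℝ) = t := rfl
    have ht' : (0 : ℝ) ≤ t := by positivity
    rw [hWcast, h2]
    nlinarith
  have hA : Accurate (T p) S (ψ i) := by
    refine ⟨hW, ?_, (hS i (T p).k).2, fun x => ?_, fun x => ?_⟩
    · change ∑ x, ‖ψ i x‖ ^ 2 = 1
      rw [← EuclideanSpace.norm_sq_eq, hψ, one_pow]
    · exact (hqv i (T p).k x).2.2.1
    · exact (hqv i (T p).k x).2.2.2
  have hlaw := law_simProg hV (T p) S s (hT p) ((runs_preProg hinst).1 p)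
  have hlists : ∀ l, Lists ((T p).output s l) ((T p).outState s l) := fun l =>
    lists_outputList (c := (T p).ctx (l.map valPair)) hK (hB _) (nodup_treeList _ _ _)
      fun y hy => lt_of_mem_treeList hy
  rw [hin]
  refine ⟨fun out ho => ⟨?_, ?_⟩, ?_⟩
  · exact time_le hε hδ hδ1 (hc p out ho)
  · have h1 : out.1 ∈ ((Prog.simProg S Q s).law (T p).input).support := by
      rw [Prog.law, PMF.support_map]; exact ⟨out, ho, rfl⟩
    rw [hlaw, PMF.support_map] at h1
    obtain ⟨l, -, hl⟩ := h1
    refine ⟨(T p).outState s l, hl ▸ hlists l, norm_outState, ?_⟩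
    have h2 : sparsity ((T p).outState s l) ≤ 2 * (T p).W + 1 :=
      sparsity_outState_le (c := (T p).ctx (l.map valPair)) hK (hB _) (nodup_treeList _ _ _)
        fun y hy => lt_of_mem_treeList hy
    have h3 : (sparsity ((T p).outState s l) : ℝ) ≤ 2 * (T p).W + 1 := by exact_mod_cast h2
    have h4 : ((⌊1 / ε⌋₊ : ℕ) : ℝ) ≤ 1 / ε := Nat.floor_le (by positivity)
    have h5 : 6 ≤ 1 / ε := by rw [le_div_iff₀ hε]; linarith
    have ht' : (1 : ℝ) ≤ t := by exact_mod_cast ht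
    have h6 : (t : ℝ) / ε = t * (1 / ε) := by ring
    rw [hWcast] at h3
    rw [h6]
    nlinarith
  · have h1 : (1 / 2 : ℝ) ^ (T p).L ≤ δ := by
      have h2 : 1 / δ ≤ (2 : ℝ) ^ (T p).L := by
        rw [← Real.rpow_natCast, ← Real.logb_le_iff_le_rpow (by norm_num) (by positivity)]
        exact Nat.le_ceil _
      rw [one_div, inv_pow]
      exact inv_le_of_inv_le₀ hδ (by rwa [one_div] at h2)
    have h2 : (Prog.run (.simProg S Q s) (T p).input).toOuterMeasure
        {out | ∃ φ : Qubits (nq i), Lists out.1 φ ∧ ‖φ - f‖ ≤ 6 * Real.sqrt ε} =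
        ((Prog.simProg S Q s).law (T p).input).toOuterMeasure
          {d | ∃ φ : Qubits (nq i), Lists d φ ∧ ‖φ - f‖ ≤ 6 * Real.sqrt ε} := by
      rw [Prog.law, PMF.toOuterMeasure_map_apply]; rfl
    rw [h2, hlaw, PMF.toOuterMeasure_map_apply]
    calc ENNReal.ofReal (1 - δ) ≤ ENNReal.ofReal (1 - (1 / 2) ^ (T p).L) :=
          ENNReal.ofReal_le_ofReal (by linarith)
      _ ≤ _ := hA.one_sub_le_good hs
      _ ≤ _ := by
          refine MeasureTheory.measure_mono fun l hl => ?_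
          exact ⟨(T p).outState s l, hlists l, hA.norm_outState_sub_le hs hl hf hε htW hsp⟩

end SparseSim

theorem mainTheorem3 :
    ∃ C : ℝ, 0 < C ∧
      ∀ (ι : Type) (nq : ι → ℕ) (desc : ι → Data)
        (ψin : ∀ i, Qubits (nq i))
        (U₁ U₂ : ∀ i, Matrix (Fin (2 ^ nq i)) (Fin (2 ^ nq i)) ℂ),
        (∀ i, ‖ψin i‖ = 1) →
        (∀ i, U₁ i ∈ Matrix.unitaryGroup (Fin (2 ^ nq i)) ℂ) →
        IsCT nq desc (fun i => act (U₁ i) (ψin i)) →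
        ((∀ i, U₂ i = qft (nq i)) ∨ (∀ i, U₂ i = (qft (nq i))⁻¹)) →
        ∃ (A : Prog) (c : ℕ), ∀ (i : ι) (t : ℕ) (ε δ : ℝ),
          0 < ε → ε ≤ 1 / 6 → 0 < δ → δ < 1 →
          IsApproxSparse (Real.sqrt ε) t (act (U₂ i * U₁ i) (ψin i)) →
          (∀ out ∈ (A.run (simInput nq desc i t ε δ)).support,
            (out.2 : ℝ) ≤ c * (nq i + t + 1 / ε + Real.log (1 / δ) + 1) ^ c ∧
            ∃ φ : Qubits (nq i), Lists out.1 φ ∧ ‖φ‖ = 1 ∧ (sparsity φ : ℝ) ≤ C * (t / ε)) ∧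
          ENNReal.ofReal (1 - δ) ≤
            (A.run (simInput nq desc i t ε δ)).toOuterMeasure
              {out | ∃ φ : Qubits (nq i), Lists out.1 φ ∧
                ‖φ - act (U₂ i * U₁ i) (ψin i)‖ ≤ C * Real.sqrt ε} := by
  refine ⟨6, by norm_num, fun ι nq desc ψin U₁ U₂ hin hU hCT h2 => ?_⟩
  have hψ : ∀ i, ‖act (U₁ i) (ψin i)‖ = 1 := fun i => by rw [norm_act (hU i), hin]
  rcases h2 with h2 | h2
  · obtain ⟨A, c, h⟩ := hCT.exists_simulation hψ (s := 1) isUnit_one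
    refine ⟨A, c, fun i t ε δ => h i t ε δ _ fun y => ?_⟩
    rw [act_mul, h2, qft_eq, act_fourierMatrix]
  · obtain ⟨A, c, h⟩ := hCT.exists_simulation hψ (s := -1) isUnit_one.neg
    refine ⟨A, c, fun i t ε δ => h i t ε δ _ fun y => ?_⟩
    rw [act_mul, h2, inv_qft_eq, act_fourierMatrix]
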